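/- **Setting.** Let $q>0$, let $\mathbb X=(X_i)_{i\in\mathbb Z}$ be a real-valued process whose variables $X_i$ all have the same marginal density $f:\mathbb R\to[0,\infty)$ (with respect to Lebesgue measure), let $x_0\in\mathbb R$ and let $n\ge 2$. Put $V_n=[x_0-(1/\log n)^{1/q},\,x_0+(1/\log n)^{1/q}]$. For $u\ge 1$ let $\mathbb G_u$ be the class of functions $g:\mathbb R^u\to\mathbb R$ with support in $V_n^u$ such that $\|g\|_\infty=\sup_{x\in\mathbb R^u}|g(x)|<\infty$ and $\mathrm{Lip}_u(g)=\sup_{x\ne y}|g(x)-g(y)|/\sum_{k=1}^u|x_k-y_k|<\infty$. For $i\in\mathbb Z^u$ write $\mathbb X_i=(X_{i_1},\dots,X_{i_u})$. For $r\ge1$ let $$\rho_r(\mathbb X)=\sup_{u,v\ge1}\ \sup_{\substack{i\in\mathbb Z^u,\ j\in\mathbb Z^v\\ \min(j)-\max(i)\ge r}}\ \sup_{g\in\mathbb G_u,\ \tilde g\in\mathbb G_v}\frac{|\mathrm{Cov}(g(\mathbb X_i),\tilde g(\mathbb X_j))|}{\Psi(u,v,g,\tilde g)}\qquad(0/0=0),$$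 where $\Psi=\max(\Psi_1,\Psi_2)$, $\Psi_1=4\|g\|_\infty\|\tilde g\|_\infty$ and $\Psi_2=u\|\tilde g\|_\infty\mathrm{Lip}_u(g)+v\|g\|_\infty\mathrm{Lip}_v(\tilde g)+uv\,\mathrm{Lip}_u(g)\mathrm{Lip}_v(\tilde g)$. Let also $$\mu(\mathbb X)=\sup_{g,\tilde g\in\mathbb G_1\setminus\{0\}}\ \sup_{i\ne j}\frac{|\mathbb E(g(X_i)\tilde g(X_j))|}{\|g\|_1\|\tilde g\|_1},\qquad \|g\|_1=\int_{\mathbb R}|g(t)|\,dt .$$ **Assumptions.** For positive constants $\mathfrak a,\mathfrak b,\mathfrak c,\mathfrak B,\mathfrak C$: (1) $\sup_{x\in V_n}f(x)\le\mathfrak B$; (2) $\rho_r(\mathbb X)\le\mathfrak c\exp(-\mathfrak a r^{\mathfrak b})$ for all $r\ge1$; (3) $\mu(\mathbb X)\le\mathfrak C$; (4) the kernel $K:\mathbb R\to\mathbb R$ is supported in $[-1,1]$, is Lipschitz, and satisfies $\int_{\mathbb R} K(x)\,dx=1$. **Estimator.** Let $K_h(x)=h^{-1}K(h^{-1}x)$,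 $\delta_n=(\log n)^{-1/2}$ and $\mathcal H_n=\{2^{-k}:k\in\mathbb N\}\cap[\,n^{-1}e^{\sqrt{\log n}},\,(\log n)^{-1/q}]$, and assume that $\mathcal H_n$ is not empty. For $h,\mathfrak h\in\mathcal H_n$ put $$\hat f_h(x_0)=\frac1n\sum_{i=1}^nK_h(x_0-X_i),\qquad \hat J_n(h)=\frac1{n^2}\sum_{i=1}^nK_h^2(x_0-X_i),$$ $$\hat M_n(h)=\sqrt{2q|\log h|\Big(\hat J_n(h)+\frac{\delta_n}{nh}\Big)},\qquad \hat M_n(h,\mathfrak h)=\hat M_n(\mathfrak h)+\hat M_n(h\vee\mathfrak h),$$ $$A(h,x_0)=\max_{\mathfrak h\in\mathcal H_n}\big\{|\hat f_{h\vee\mathfrak h}(x_0)-\hat f_{\mathfrak h}(x_0)|-\hat M_n(h,\mathfrak h)\big\}_+,$$ where $h\vee\mathfrak h=\max(h,\mathfrak h)$ and $\{y\}_+=\max(0,y)$. Let $\hat h(x_0)$ be any (measurable) minimizer of $h\mapsto A(h,x_0)+\hat M_n(h)$ over $\mathcal H_n$, and let $\hat f(x_0)=\hat f_{\hat h(x_0)}(x_0)$.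 **Theorem.** Under assumptions (1)–(4), the risk $R_q(\hat f,f)=(\mathbb E|\hat f(x_0)-f(x_0)|^q)^{1/q}$ is finite and $$R_q^q(\hat f,f)\le C_1^*\min_{h\in\mathcal H_n}\left\{\max_{\substack{\mathfrak h\in\mathcal H_n\\ \mathfrak h\le h}}|K_{\mathfrak h}\star f(x_0)-f(x_0)|^q+\Big(\frac{|\log h|}{nh}\Big)^{q/2}\right\},$$ where $C_1^*$ is a positive constant that depends only on $\mathfrak a,\mathfrak b,\mathfrak c,\mathfrak B,\mathfrak C$, $K$ and $q$ (in particular, not on $n$, $x_0$, $f$ or the law of $\mathbb X$). -/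

import Mathlib

open MeasureTheory ProbabilityTheory
open scoped ENNReal NNReal

namespace GLDensity

noncomputable section

/-! ### The neighbourhood of the estimation point and the functional classes -/

/-- `V_n(x₀) = [x₀ - (1 / log n)^(1/q), x₀ + (1 / log n)^(1/q)]`. -/
def nbhd (q : ℝ) (n : ℕ) (x₀ : ℝ) : Set ℝ :=
  Set.Icc (x₀ - (1 / Real.log n) ^ (1 / q)) (x₀ + (1 / Real.log n) ^ (1 / q))

/-- The supremum norm `‖g‖_{∞,u}` of `g : ℝ^u → ℝ`, with values in `[0, ∞]`. -/
def supNorm {u : ℕ} (g : (Fin u → ℝ) → ℝ) : ℝ≥0∞ :=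
  ⨆ x, ENNReal.ofReal |g x|

/-- The Lipschitz constant `Lip_u(g)` of `g : ℝ^u → ℝ` for the `ℓ¹` distance, in `[0, ∞]`. -/
def lip {u : ℕ} (g : (Fin u → ℝ) → ℝ) : ℝ≥0∞ :=
  ⨆ (x : Fin u → ℝ) (y : Fin u → ℝ) (_ : x ≠ y),
    ENNReal.ofReal (|g x - g y| / ∑ k, |x k - y k|)

/-- The class `𝔾_u` of bounded Lipschitz functions on `ℝ^u` that vanish outside `V^u`. -/
def testClass (V : Set ℝ) (u : ℕ) : Set ((Fin u → ℝ) → ℝ) :=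
  {g | Function.support g ⊆ Set.univ.pi (fun _ => V) ∧ supNorm g < ∞ ∧ lip g < ∞}

/-- `Ψ₁(u, v, g, g')`. -/
def psiOne {u v : ℕ} (g : (Fin u → ℝ) → ℝ) (g' : (Fin v → ℝ) → ℝ) : ℝ≥0∞ :=
  4 * supNorm g * supNorm g'

/-- `Ψ₂(u, v, g, g')`. -/
def psiTwo {u v : ℕ} (g : (Fin u → ℝ) → ℝ) (g' : (Fin v → ℝ) → ℝ) : ℝ≥0∞ :=
  u * supNorm g' * lip g + v * supNorm g * lip g' + u * v * lip g * lip g'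

/-- `Ψ = max(Ψ₁, Ψ₂)`. -/
def psi {u v : ℕ} (g : (Fin u → ℝ) → ℝ) (g' : (Fin v → ℝ) → ℝ) : ℝ≥0∞ :=
  max (psiOne g g') (psiTwo g g')

/-! ### Dependence coefficients of the process -/

section Dependence

variable {Ω : Type*} [MeasurableSpace Ω]

/-- The random vector `𝕏_i = (X_{i₁}, …, X_{i_u})`. -/
def tuple (X : ℤ → Ω → ℝ) {u : ℕ} (i : Fin u → ℤ) (ω : Ω) : Fin u → ℝ :=
  fun k => X (i k) ω

/-- The weak-dependence coefficient `ρ_r(𝕏)`, relative to functions vanishing outside powers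
of `V`. The condition `∀ k l, r ≤ j l - i k` says that the gap `min j - max i` is at least `r`.
If `psi g g' = 0` then `g` or `g'` is zero, and the quotient is `0 / 0 = 0`. -/
def rho (P : Measure Ω) (X : ℤ → Ω → ℝ) (V : Set ℝ) (r : ℕ) : ℝ≥0∞ :=
  ⨆ (u : ℕ) (v : ℕ) (_ : 0 < u) (_ : 0 < v) (i : Fin u → ℤ) (j : Fin v → ℤ)
    (_ : ∀ k l, (r : ℤ) ≤ j l - i k) (g ∈ testClass V u) (g' ∈ testClass V v),
    ENNReal.ofReal |cov[fun ω => g (tuple X i ω), fun ω => g' (tuple X j ω); P]| / psi g g'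

/-- The `L¹` norm of a function of one real variable, in `[0, ∞]`. -/
def oneNorm (g : (Fin 1 → ℝ) → ℝ) : ℝ≥0∞ :=
  ∫⁻ t : ℝ, ENNReal.ofReal |g (fun _ => t)|

/-- The cross-moment coefficient `μ(𝕏)`. -/
def crossMoment (P : Measure Ω) (X : ℤ → Ω → ℝ) (V : Set ℝ) : ℝ≥0∞ :=
  ⨆ (g ∈ testClass V 1 \ {0}) (g' ∈ testClass V 1 \ {0}) (i : ℤ) (j : ℤ) (_ : i ≠ j),
    ENNReal.ofReal |∫ ω, g (fun _ => X i ω) * g' (fun _ => X j ω) ∂P| /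
      (oneNorm g * oneNorm g')

/-- `X` is a real-valued process all of whose marginals have the density `f` with respect to
the Lebesgue measure. -/
structure HasMarginalDensity (P : Measure Ω) (X : ℤ → Ω → ℝ) (f : ℝ → ℝ) : Prop where
  measurable_process : ∀ i, Measurable (X i)
  measurable_density : Measurable f
  nonneg : ∀ x, 0 ≤ f x
  map_eq : ∀ i, P.map (X i) = volume.withDensity (fun x => ENNReal.ofReal (f x))

/-- The pointwise risk `R_q = (E |T - θ|^q)^(1/q)` of an estimator `T` of the number `θ`. -/
def risk (P : Measure Ω) (q : ℝ) (T : Ω → ℝ) (θ : ℝ) : ℝ :=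
  (∫ ω, |T ω - θ| ^ q ∂P) ^ (1 / q)

end Dependence

/-! ### Kernels, bandwidths and kernel estimators -/

/-- A Lipschitz kernel supported in `[-1, 1]` with integral one. -/
structure IsLipschitzKernel (K : ℝ → ℝ) : Prop where
  support_subset : Function.support K ⊆ Set.Icc (-1) 1
  lipschitz : ∃ L : ℝ≥0, LipschitzWith L K
  integral_eq_one : ∫ x, K x = 1

/-- `K_h(x) = h⁻¹ K(h⁻¹ x)`. -/
def scaled (K : ℝ → ℝ) (h : ℝ) : ℝ → ℝ := fun x => h⁻¹ * K (h⁻¹ * x)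

/-- The convolution `K_h ⋆ f` at `x₀`. -/
def smoothed (K f : ℝ → ℝ) (h x₀ : ℝ) : ℝ :=
  MeasureTheory.convolution (scaled K h) f (ContinuousLinearMap.mul ℝ ℝ) volume x₀

/-- `h_* = n⁻¹ exp(√(log n))`. -/
def hLower (n : ℕ) : ℝ := (n : ℝ)⁻¹ * Real.exp (Real.sqrt (Real.log n))

/-- `h^* = (log n)^(-1/q)`. -/
def hUpper (q : ℝ) (n : ℕ) : ℝ := Real.log n ^ (-1 / q)

open Classical in
/-- The dyadic grid `ℋ_n = {2^(-k) : k ∈ ℕ} ∩ [h_*, h^*]`; only the exponents `k ≤ n` matter,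
see `mem_grid`. -/
def grid (q : ℝ) (n : ℕ) : Finset ℝ :=
  ((Finset.range (n + 1)).image (fun k : ℕ => ((2 : ℝ) ^ k)⁻¹)).filter
    (fun h => hLower n ≤ h ∧ h ≤ hUpper q n)

theorem mem_grid {q : ℝ} {n : ℕ} (hn : 1 ≤ n) {h : ℝ} :
    h ∈ grid q n ↔ (∃ k : ℕ, h = ((2 : ℝ) ^ k)⁻¹) ∧ hLower n ≤ h ∧ h ≤ hUpper q n := by
  classical
  unfold grid
  simp only [Finset.mem_filter, Finset.mem_image, Finset.mem_range]
  constructor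
  · rintro ⟨⟨k, -, rfl⟩, h1⟩
    exact ⟨⟨k, rfl⟩, h1⟩
  · rintro ⟨⟨k, rfl⟩, h1, h2⟩
    refine ⟨⟨k, ?_, rfl⟩, h1, h2⟩
    have hn' : (0 : ℝ) < n := by exact_mod_cast hn
    have he : (n : ℝ)⁻¹ ≤ hLower n := by
      unfold hLower
      have : 1 ≤ Real.exp (Real.sqrt (Real.log n)) := Real.one_le_exp (Real.sqrt_nonneg _)
      exact le_mul_of_one_le_right (inv_nonneg.mpr hn'.le) this
    have h3 : (2 : ℝ) ^ k ≤ n := (inv_le_inv₀ hn' (by positivity)).mp (he.trans h1)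
    have h4 : 2 ^ k ≤ n := by exact_mod_cast h3
    have h5 : k < 2 ^ k := Nat.lt_two_pow_self
    omega

/-- The kernel estimator `f̂_h(x₀)` computed from `x₁, …, x_n`. -/
def kernelEst (K : ℝ → ℝ) (n : ℕ) (x : ℤ → ℝ) (x₀ h : ℝ) : ℝ :=
  (1 / (n : ℝ)) * ∑ i ∈ Finset.Icc (1 : ℤ) n, scaled K h (x₀ - x i)

/-! ### The Goldenshluger–Lepski selection rule -/

/-- `δ_n = (log n)^(-1/2)`. -/
def delta (n : ℕ) : ℝ := Real.log n ^ (-(1 / 2) : ℝ)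

/-- `Ĵ_n(h)`. -/
def varEst (K : ℝ → ℝ) (n : ℕ) (x : ℤ → ℝ) (x₀ h : ℝ) : ℝ :=
  (1 / (n : ℝ) ^ 2) * ∑ i ∈ Finset.Icc (1 : ℤ) n, scaled K h (x₀ - x i) ^ 2

/-- The majorant `M̂_n(h)`. -/
def majorant (q : ℝ) (K : ℝ → ℝ) (n : ℕ) (x : ℤ → ℝ) (x₀ h : ℝ) : ℝ :=
  Real.sqrt (2 * q * |Real.log h| * (varEst K n x x₀ h + delta n / (n * h)))

/-- The majorant `M̂_n(h, h')`. -/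
def majorantTwo (q : ℝ) (K : ℝ → ℝ) (n : ℕ) (x : ℤ → ℝ) (x₀ h h' : ℝ) : ℝ :=
  majorant q K n x x₀ h' + majorant q K n x x₀ (max h h')

/-- `A(h, x₀)`, the maximum over `h'` in the grid of the positive parts
`{|f̂_{h ∨ h'}(x₀) - f̂_{h'}(x₀)| - M̂_n(h, h')}_+`. -/
def biasProxy (q : ℝ) (K : ℝ → ℝ) (n : ℕ) (x : ℤ → ℝ) (x₀ h : ℝ) : ℝ≥0 :=
  (grid q n).sup fun h' => Real.toNNReal
    (|kernelEst K n x x₀ (max h h') - kernelEst K n x x₀ h'| - majorantTwo q K n x x₀ h h')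

/-- `h` is a minimizer over the grid of `A(h, x₀) + M̂_n(h)`. -/
def IsSelected (q : ℝ) (K : ℝ → ℝ) (n : ℕ) (x : ℤ → ℝ) (x₀ h : ℝ) : Prop :=
  h ∈ grid q n ∧ ∀ h' ∈ grid q n,
    biasProxy q K n x x₀ h + majorant q K n x x₀ h ≤
      biasProxy q K n x x₀ h' + majorant q K n x x₀ h'

/-! ### The oracle bound -/

open Classical in
/-- `max_{h' ∈ ℋ_n, h' ≤ h} |K_{h'} ⋆ f(x₀) - f(x₀)|^q`. -/
def maxBias (q : ℝ) (K f : ℝ → ℝ) (n : ℕ) (x₀ h : ℝ) : ℝ≥0 :=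
  ((grid q n).filter (fun h' => h' ≤ h)).sup fun h' => ‖smoothed K f h' x₀ - f x₀‖₊ ^ q

/-- `max_{h' ∈ ℋ_n, h' ≤ h} |K_{h'} ⋆ f(x₀) - f(x₀)|^q + (|log h| / (n h))^(q/2)`. -/
def oracleTerm (q : ℝ) (K f : ℝ → ℝ) (n : ℕ) (x₀ h : ℝ) : ℝ :=
  maxBias q K f n x₀ h + (|Real.log h| / (n * h)) ^ (q / 2)

end

end GLDensity

namespace GLDensity

/-! The selected bandwidth is compared with an arbitrary `h` of the grid, path by path. Minimality
bounds the error by twice `A(h) + M̂(h)` plus the error at `h` (`IsSelected.abs_sub_le`), and `A(h)`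
is at most twice the largest bias over `h' ≤ h` plus twice the largest excess of `|f̂_{h'} - K_{h'}
⋆ f|` over `M̂(h')` (`biasProxy_le`). It remains to show that the `q`-th moments of the excesses,
summed over the grid, and `E M̂(h)^q` are both of order `(|log h| / (n h))^(q/2)`.

An excess is estimated by a moment of order `2p` with `p` about `(3/4) q |log h|`. If this moment is
at most a constant times `(200/81 · pW/e)^p`, nearly the Gaussian size `(2pW/e)^p`, Markov's
inequality at the level `√(2q |log h| W)` gains `e^{-p}`, about `h^{3q/4}`. After rescaling this
leaves `n^{-q/2}` times a positive power of `h`, which is summable over dyadic bandwidths. The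
margin between `3/4` and `81/100` is what the argument lives on, so the base of the moment bound
must be nearly sharp.

The moment bound comes from blocking. Expanding the power into monomials, weak dependence replaces
well separated blocks by independent copies (`integral_sum_pow_le_pi`), and Bernstein's bound
applies to the copies (`integral_pi_sum_pow_le`). Long blocks alternate with short ones, and the
short ones hold one percent of the indices, so they barely affect the constant
(`IsModel.integral_sum_pow_le`). Gaps of length about `(log n)^{3/b}` make the decoupling error
negligible, while `n h ≥ exp √(log n)` dominates every power of `log n` that the blocks produce.

The variance `W` must be that of independent variables up to a small remainder. Interpolating
between the mixing bound and the cross-moment bound makes covariances summable in the lag and of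
order `h^{2-4θ}` (`IsModel.abs_cov_le`). The remainder is absorbed partly by the `δ_n` correction of
the majorant and partly by a further integrable excess (`remainder_le`).

Finally, the empirical variance in `M̂` is within the correction of its mean outside an event of
probability `n^{-(2q+1)}` (`IsModel.measureReal_sum_sq_le`). Small `n` are covered by crude bounds.
-/

theorem integrable_of_abs_le {Ω : Type*} [MeasurableSpace Ω] {P : Measure Ω} [IsFiniteMeasure P]
    {f : Ω → ℝ} (hf : Measurable f) {c : ℝ} (h : ∀ ω, |f ω| ≤ c) : Integrable f P :=
  Integrable.of_bound hf.aestronglyMeasurable c (Filter.Eventually.of_forall h)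

theorem memLp_of_abs_le {Ω : Type*} [MeasurableSpace Ω] {P : Measure Ω} [IsFiniteMeasure P]
    {f : Ω → ℝ} (hf : Measurable f) {c : ℝ} (h : ∀ ω, |f ω| ≤ c) : MemLp f 2 P :=
  MemLp.of_bound hf.aestronglyMeasurable c (Filter.Eventually.of_forall h)

theorem abs_integral_le_of_abs_le {Ω : Type*} [MeasurableSpace Ω] {P : Measure Ω}
    [IsProbabilityMeasure P] {f : Ω → ℝ} {c : ℝ} (h : ∀ ω, |f ω| ≤ c) : |∫ ω, f ω ∂P| ≤ c := by
  have := norm_integral_le_of_norm_le_const (μ := P) (f := f) (C := c)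
    (Filter.Eventually.of_forall h)
  simpa using this

/-! ### Exponential moments and the independent case -/

theorem exp_le_quadratic {x : ℝ} (hx : |x| ≤ 1) :
    Real.exp x ≤ 1 + x + x ^ 2 / 2 * (1 + |x|) := by
  have h := (abs_le.mp (Real.exp_bound hx (n := 3) (by norm_num))).2
  simp only [Finset.sum_range_succ, Finset.sum_range_zero, Nat.factorial] at h
  norm_num at h
  have h2 : |x| ^ 3 = x ^ 2 * |x| := by rw [pow_succ, sq_abs]
  have h3 : 0 ≤ x ^ 2 * |x| := by positivity
  rw [h2] at h
  linarith

/-- A Bernstein bound for the moment generating function of a bounded centred variable. -/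
theorem integral_exp_le {Ω : Type*} [MeasurableSpace Ω] {P : Measure Ω} [IsProbabilityMeasure P]
    {Y : Ω → ℝ} (hY : Measurable Y) {L t : ℝ} (hL : ∀ ω, |Y ω| ≤ L) (h0 : ∫ ω, Y ω ∂P = 0)
    (htL : |t| * L ≤ 1) :
    ∫ ω, Real.exp (t * Y ω) ∂P ≤ Real.exp (t ^ 2 / 2 * (1 + |t| * L) * ∫ ω, Y ω ^ 2 ∂P) := by
  have hpt : ∀ ω, Real.exp (t * Y ω) ≤ 1 + t * Y ω + t ^ 2 / 2 * (1 + |t| * L) * Y ω ^ 2 := by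
    intro ω
    have h1 : |t * Y ω| ≤ |t| * L := by
      rw [abs_mul]; exact mul_le_mul_of_nonneg_left (hL ω) (abs_nonneg t)
    have h2 := exp_le_quadratic (h1.trans htL)
    have h3 : (t * Y ω) ^ 2 / 2 * (1 + |t * Y ω|) ≤ (t * Y ω) ^ 2 / 2 * (1 + |t| * L) := by
      gcongr
    calc _ ≤ _ := h2
      _ ≤ 1 + t * Y ω + (t * Y ω) ^ 2 / 2 * (1 + |t| * L) := by linarith
      _ = _ := by ring
  have i1 : Integrable Y P := integrable_of_abs_le hY hL
  have i2 : Integrable (fun ω => Y ω ^ 2) P := by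
    refine integrable_of_abs_le (hY.pow_const 2) (c := L ^ 2) fun ω => ?_
    rw [abs_pow]; exact pow_le_pow_left₀ (abs_nonneg _) (hL ω) 2
  have i3 : Integrable (fun ω => Real.exp (t * Y ω)) P := by
    refine integrable_of_abs_le (by fun_prop) (c := Real.exp 1) fun ω => ?_
    rw [Real.abs_exp]
    refine Real.exp_le_exp.mpr ((le_abs_self _).trans ?_)
    rw [abs_mul]
    exact (mul_le_mul_of_nonneg_left (hL ω) (abs_nonneg t)).trans htL
  have i4 : Integrable (fun ω => 1 + t * Y ω) P := (integrable_const 1).add (i1.const_mul t)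
  calc ∫ ω, Real.exp (t * Y ω) ∂P
      ≤ ∫ ω, (1 + t * Y ω + t ^ 2 / 2 * (1 + |t| * L) * Y ω ^ 2) ∂P :=
        integral_mono i3 (i4.add (i2.const_mul _)) hpt
    _ = 1 + t ^ 2 / 2 * (1 + |t| * L) * ∫ ω, Y ω ^ 2 ∂P := by
        rw [integral_add i4 (i2.const_mul _), integral_add (integrable_const 1) (i1.const_mul t),
          integral_const_mul, integral_const_mul, h0]
        simp
    _ ≤ _ := by rw [add_comm]; exact Real.add_one_le_exp _

/-- From `y ≤ e^{y-1}` at `y = t|x|/m`, raised to the power `m`. This choice keeps the sharp base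
`m/(et)`, hence the Gaussian base after optimising in `t`. -/
theorem abs_pow_le_exp {x t : ℝ} (ht : 0 < t) {m : ℕ} (hm : 0 < m) :
    |x| ^ m ≤ (m / (Real.exp 1 * t)) ^ m * (Real.exp (t * x) + Real.exp (-t * x)) := by
  have hm' : (0 : ℝ) < m := by exact_mod_cast hm
  have h1 : t * |x| / m ≤ Real.exp (t * |x| / m - 1) := by
    have := Real.add_one_le_exp (t * |x| / m - 1); linarith
  have h2 : (t * |x| / m) ^ m ≤ Real.exp (t * |x|) / Real.exp 1 ^ m := by
    calc _ ≤ Real.exp (t * |x| / m - 1) ^ m := pow_le_pow_left₀ (by positivity) h1 m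
      _ = Real.exp (t * |x|) / Real.exp 1 ^ m := by
        rw [← Real.exp_nat_mul, ← Real.exp_nat_mul, ← Real.exp_sub]
        congr 1; field_simp
  have h3 : Real.exp (t * |x|) ≤ Real.exp (t * x) + Real.exp (-t * x) := by
    rcases abs_cases x with ⟨h, _⟩ | ⟨h, _⟩ <;> rw [h]
    · linarith [Real.exp_pos (-t * x)]
    · rw [mul_neg, ← neg_mul]; linarith [Real.exp_pos (t * x)]
  have h4 : |x| ^ m = (m / t) ^ m * (t * |x| / m) ^ m := by
    rw [← mul_pow]; congr 1; field_simp
  rw [h4]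
  calc _ ≤ (m / t) ^ m * ((Real.exp (t * x) + Real.exp (-t * x)) / Real.exp 1 ^ m) := by
        refine mul_le_mul_of_nonneg_left (h2.trans ?_) (by positivity)
        gcongr
    _ = _ := by
        rw [div_pow, div_pow, mul_pow]
        field_simp

/-- Moments of a sum of independent bounded centred variables, realised on a product space. -/
theorem integral_pi_sum_pow_le {Ω : Type*} [MeasurableSpace Ω] {P : Measure Ω}
    [IsProbabilityMeasure P] {N : ℕ} {Y : Fin N → Ω → ℝ} (hY : ∀ k, Measurable (Y k)) {L t v : ℝ}
    (hL : ∀ k ω, |Y k ω| ≤ L) (h0 : ∀ k, ∫ ω, Y k ω ∂P = 0) (ht : 0 < t) (hLnn : 0 ≤ L)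
    (htL : t * L ≤ 1) (hv : ∑ k, ∫ ω, Y k ω ^ 2 ∂P ≤ v) {p : ℕ} (hp : 0 < p) :
    ∫ ω : Fin N → Ω, (∑ k, Y k (ω k)) ^ (2 * p) ∂(Measure.pi fun _ => P) ≤
      2 * ((2 * p) / (Real.exp 1 * t)) ^ (2 * p) * Real.exp (t ^ 2 / 2 * (1 + t * L) * v) := by
  have hsm : Measurable fun ω : Fin N → Ω => ∑ k, Y k (ω k) :=
    Finset.measurable_sum _ fun k _ => (hY k).comp (measurable_pi_apply k)
  have hsb : ∀ ω : Fin N → Ω, |∑ k, Y k (ω k)| ≤ N * L := by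
    intro ω
    refine (Finset.abs_sum_le_sum_abs _ _).trans ?_
    refine (Finset.sum_le_sum fun k _ => hL k (ω k)).trans ?_
    simp
  have iexp : ∀ s : ℝ, Integrable (fun ω : Fin N → Ω => Real.exp (s * ∑ k, Y k (ω k)))
      (Measure.pi fun _ => P) := by
    intro s
    refine integrable_of_abs_le (by fun_prop) (c := Real.exp (|s| * (N * L))) fun ω => ?_
    rw [Real.abs_exp]
    refine Real.exp_le_exp.mpr ((le_abs_self _).trans ?_)
    rw [abs_mul]
    exact mul_le_mul_of_nonneg_left (hsb ω) (abs_nonneg s)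
  have hmgf : ∀ s : ℝ, |s| = t → ∫ ω : Fin N → Ω, Real.exp (s * ∑ k, Y k (ω k))
      ∂(Measure.pi fun _ => P) ≤ Real.exp (t ^ 2 / 2 * (1 + t * L) * v) := by
    intro s hs
    have e1 : ∀ ω : Fin N → Ω, Real.exp (s * ∑ k, Y k (ω k)) = ∏ k, Real.exp (s * Y k (ω k)) := by
      intro ω; rw [Finset.mul_sum, Real.exp_sum]
    simp_rw [e1]
    rw [integral_fintype_prod_eq_prod (fun k ω => Real.exp (s * Y k ω))]
    calc _ ≤ ∏ k, Real.exp (t ^ 2 / 2 * (1 + t * L) * ∫ ω, Y k ω ^ 2 ∂P) := by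
          refine Finset.prod_le_prod (fun k _ => integral_nonneg fun ω => (Real.exp_pos _).le)
            fun k _ => ?_
          have := integral_exp_le (hY k) (hL k) (h0 k) (t := s) (by rw [hs]; exact htL)
          rwa [hs, ← sq_abs, hs] at this
      _ = Real.exp (t ^ 2 / 2 * (1 + t * L) * ∑ k, ∫ ω, Y k ω ^ 2 ∂P) := by
          rw [← Real.exp_sum, Finset.mul_sum]
      _ ≤ _ := by
          refine Real.exp_le_exp.mpr (mul_le_mul_of_nonneg_left hv (by positivity))
  have hpt : ∀ ω : Fin N → Ω, (∑ k, Y k (ω k)) ^ (2 * p) ≤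
      ((2 * p) / (Real.exp 1 * t)) ^ (2 * p) *
        (Real.exp (t * ∑ k, Y k (ω k)) + Real.exp (-t * ∑ k, Y k (ω k))) := by
    intro ω
    have := abs_pow_le_exp (x := ∑ k, Y k (ω k)) ht (m := 2 * p) (by omega)
    rw [(even_two_mul p).pow_abs] at this
    exact_mod_cast this
  calc _ ≤ ∫ ω : Fin N → Ω, ((2 * p) / (Real.exp 1 * t)) ^ (2 * p) *
        (Real.exp (t * ∑ k, Y k (ω k)) + Real.exp (-t * ∑ k, Y k (ω k)))
          ∂(Measure.pi fun _ => P) := by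
        refine integral_mono ?_ (((iexp t).add (iexp (-t))).const_mul _) hpt
        refine integrable_of_abs_le (hsm.pow_const _) (c := (N * L) ^ (2 * p)) fun ω => ?_
        rw [abs_pow]; exact pow_le_pow_left₀ (abs_nonneg _) (hsb ω) _
    _ = ((2 * p) / (Real.exp 1 * t)) ^ (2 * p) *
        ((∫ ω : Fin N → Ω, Real.exp (t * ∑ k, Y k (ω k)) ∂(Measure.pi fun _ => P)) +
        ∫ ω : Fin N → Ω, Real.exp (-t * ∑ k, Y k (ω k)) ∂(Measure.pi fun _ => P)) := by
        rw [integral_const_mul, integral_add (iexp t) (iexp (-t))]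
    _ ≤ ((2 * p) / (Real.exp 1 * t)) ^ (2 * p) * (Real.exp (t ^ 2 / 2 * (1 + t * L) * v) +
          Real.exp (t ^ 2 / 2 * (1 + t * L) * v)) := by
        refine mul_le_mul_of_nonneg_left (add_le_add (hmgf t (abs_of_pos ht))
          (hmgf (-t) (by rw [abs_neg, abs_of_pos ht]))) (by positivity)
    _ = _ := by ring

/-! ### Decoupling of separated blocks -/

section Decoupling

variable {Ω : Type*} [MeasurableSpace Ω] {P : Measure Ω} [IsProbabilityMeasure P]

theorem abs_prod_le_one {ι : Type*} {Z : ι → ℝ} (s : Finset ι) (h : ∀ i ∈ s, |Z i| ≤ 1) :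
    |∏ i ∈ s, Z i| ≤ 1 := by
  rw [Finset.abs_prod]
  exact Finset.prod_le_one (fun _ _ => abs_nonneg _) h

/-- If past and future blocks are almost uncorrelated, the expectation of a product is close to
the product of the expectations over the blocks. -/
theorem abs_integral_prod_sub_prod_le {T : Type*} [Fintype T] {Z : T → Ω → ℝ}
    (hZ : ∀ l, Measurable (Z l)) (hb : ∀ l ω, |Z l ω| ≤ 1) (lab : T → ℕ) {ε : ℝ}
    (hcov : ∀ A B : Finset T, (∀ i ∈ A, ∀ j ∈ B, lab i < lab j) →
      |cov[fun ω => ∏ l ∈ A, Z l ω, fun ω => ∏ l ∈ B, Z l ω; P]| ≤ ε) (N : ℕ) :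
    |(∫ ω, ∏ l with lab l < N, Z l ω ∂P) -
      ∏ k ∈ Finset.range N, ∫ ω, ∏ l with lab l = k, Z l ω ∂P| ≤ N * ε := by
  classical
  induction N with
  | zero => simp
  | succ k ih =>
    have hm : ∀ A : Finset T, Measurable fun ω => ∏ l ∈ A, Z l ω := fun A =>
      Finset.measurable_prod _ fun l _ => hZ l
    have hbA : ∀ (A : Finset T) ω, |∏ l ∈ A, Z l ω| ≤ 1 := fun A ω =>
      abs_prod_le_one A fun l _ => hb l ω
    set A : Finset T := Finset.univ.filter fun l => lab l < k
    set A' : Finset T := Finset.univ.filter fun l => lab l < k + 1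
    set B : Finset T := Finset.univ.filter fun l => lab l = k
    have hAB : A' = A ∪ B := by
      ext l; simp [A, A', B]; omega
    have hd : Disjoint A B := by
      rw [Finset.disjoint_left]; intro l h1 h2; simp [A, B] at h1 h2; omega
    have hc := hcov A B (by intro i hi j hj; simp [A, B] at hi hj; omega)
    rw [covariance_eq_sub (memLp_of_abs_le (hm A) (hbA A)) (memLp_of_abs_le (hm B) (hbA B))] at hc
    have e1 : ∀ ω, ∏ l ∈ A', Z l ω = ((fun ω => ∏ l ∈ A, Z l ω) * fun ω => ∏ l ∈ B, Z l ω) ω := by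
      intro ω; rw [hAB, Finset.prod_union hd]; rfl
    simp_rw [e1]
    rw [Finset.prod_range_succ]
    have hB1 : |∫ ω, ∏ l ∈ B, Z l ω ∂P| ≤ 1 := abs_integral_le_of_abs_le (hbA B)
    set a := ∫ ω, ((fun ω => ∏ l ∈ A, Z l ω) * fun ω => ∏ l ∈ B, Z l ω) ω ∂P
    set x := ∫ ω, ∏ l ∈ A, Z l ω ∂P
    set y := ∫ ω, ∏ l ∈ B, Z l ω ∂P
    set w := ∏ k ∈ Finset.range k, ∫ ω, ∏ l with lab l = k, Z l ω ∂P
    -- Telescoping: splitting off the last block costs one covariance, and the error made on the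
    -- earlier blocks is multiplied by a factor of modulus at most one, so errors only add up.
    have h3 : |(x - w) * y| ≤ k * ε := by
      rw [abs_mul]
      exact (mul_le_of_le_one_right (abs_nonneg _) hB1).trans ih
    calc |a - w * y| = |(a - x * y) + (x - w) * y| := by congr 1; ring
      _ ≤ ε + k * ε := (abs_add_le _ _).trans (add_le_add hc h3)
      _ = _ := by push_cast; ring

/-- Comparison of the moments of a sum with those of the sum of independent copies of its
blocks. -/
theorem integral_sum_pow_le_pi {ι : Type*} {Z : ι → Ω → ℝ} (hZ : ∀ i, Measurable (Z i))
    (hb : ∀ i ω, |Z i ω| ≤ 1) (I : Finset ι) {N : ℕ} (lab : ι → Fin N) (m : ℕ) {ε : ℝ}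
    (hcov : ∀ s : Fin m → ι, (∀ l, s l ∈ I) → ∀ A B : Finset (Fin m),
      (∀ i ∈ A, ∀ j ∈ B, lab (s i) < lab (s j)) →
      |cov[fun ω => ∏ l ∈ A, Z (s l) ω, fun ω => ∏ l ∈ B, Z (s l) ω; P]| ≤ ε) :
    ∫ ω, (∑ i ∈ I, Z i ω) ^ m ∂P ≤
      (∫ ω : Fin N → Ω, (∑ i ∈ I, Z i (ω (lab i))) ^ m ∂(Measure.pi fun _ => P)) +
        (I.card : ℝ) ^ m * (N * ε) := by
  classical
  -- The comparison is made on each of the `card I ^ m` monomials, where the number of factors is at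
  -- most `m` whatever the block sizes.
  have hexp : ∀ g : ι → ℝ, (∑ i ∈ I, g i) ^ m =
      ∑ s ∈ Fintype.piFinset (fun _ : Fin m => I), ∏ l, g (s l) := by
    intro g
    rw [← Finset.prod_univ_sum (fun _ : Fin m => I) (fun _ i => g i)]
    simp
  simp_rw [hexp]
  rw [integral_finsetSum _ fun s _ => integrable_of_abs_le
      (Finset.measurable_prod _ fun l _ => hZ (s l)) (c := 1)
      fun ω => abs_prod_le_one _ fun l _ => hb (s l) ω,
    integral_finsetSum _ fun s _ => integrable_of_abs_le
      (Finset.measurable_prod _ fun l _ => (hZ (s l)).comp (measurable_pi_apply _)) (c := 1)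
      fun ω => abs_prod_le_one _ fun l _ => hb (s l) _]
  have hcard : (I.card : ℝ) ^ m * (N * ε) =
      ∑ s ∈ Fintype.piFinset (fun _ : Fin m => I), N * ε := by
    rw [Finset.sum_const, Fintype.card_piFinset]; simp
  rw [hcard, ← Finset.sum_add_distrib]
  refine Finset.sum_le_sum fun s hs => ?_
  have hs' : ∀ l, s l ∈ I := fun l => Fintype.mem_piFinset.mp hs l
  have key := abs_integral_prod_sub_prod_le (P := P) (fun l => hZ (s l)) (fun l => hb (s l))
    (fun l => (lab (s l) : ℕ)) (hcov s hs') N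
  -- On the product space each label has its own coordinate, so the monomial factorises exactly over
  -- the blocks.
  have e2 : ∫ ω : Fin N → Ω, ∏ l, Z (s l) (ω (lab (s l))) ∂(Measure.pi fun _ => P) =
      ∏ k ∈ Finset.range N, ∫ ω, ∏ l with (lab (s l) : ℕ) = k, Z (s l) ω ∂P := by
    have e3 : ∀ ω : Fin N → Ω, ∏ l, Z (s l) (ω (lab (s l))) =
        ∏ k : Fin N, ∏ l with lab (s l) = k, Z (s l) (ω k) := by
      intro ω
      rw [← Finset.prod_fiberwise Finset.univ (fun l => lab (s l))]
      refine Finset.prod_congr rfl fun k _ => Finset.prod_congr rfl fun l hl => ?_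
      rw [(Finset.mem_filter.mp hl).2]
    simp_rw [e3]
    rw [integral_fintype_prod_eq_prod (fun k ω => ∏ l with lab (s l) = k, Z (s l) ω),
      ← Fin.prod_univ_eq_prod_range (fun k => ∫ ω, ∏ l with (lab (s l) : ℕ) = k, Z (s l) ω ∂P)]
    refine Finset.prod_congr rfl fun k _ => ?_
    simp [Fin.ext_iff]
  rw [e2]
  have e4 : (Finset.univ.filter fun l => (lab (s l) : ℕ) < N) = Finset.univ := by
    ext l; simp
  rw [e4] at key
  linarith [(abs_le.mp key).2]

/-- Moment bound for sums over well separated blocks. -/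
theorem integral_block_sum_pow_le {ι : Type*} {Z : ι → Ω → ℝ} (hZ : ∀ i, Measurable (Z i))
    (hb : ∀ i ω, |Z i ω| ≤ 1) (h0 : ∀ i, ∫ ω, Z i ω ∂P = 0) (I : Finset ι) {N : ℕ}
    (lab : ι → Fin N) {p : ℕ} (hp : 0 < p) {ε L t v : ℝ}
    (hcov : ∀ s : Fin (2 * p) → ι, (∀ l, s l ∈ I) → ∀ A B : Finset (Fin (2 * p)),
      (∀ i ∈ A, ∀ j ∈ B, lab (s i) < lab (s j)) →
      |cov[fun ω => ∏ l ∈ A, Z (s l) ω, fun ω => ∏ l ∈ B, Z (s l) ω; P]| ≤ ε)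
    (hL : ∀ k, ((I.filter fun i => lab i = k).card : ℝ) ≤ L) (hLnn : 0 ≤ L)
    (ht : 0 < t) (htL : t * L ≤ 1)
    (hv : ∑ k, ∫ ω, (∑ i ∈ I with lab i = k, Z i ω) ^ 2 ∂P ≤ v) :
    ∫ ω, (∑ i ∈ I, Z i ω) ^ (2 * p) ∂P ≤
      2 * ((2 * p) / (Real.exp 1 * t)) ^ (2 * p) * Real.exp (t ^ 2 / 2 * (1 + t * L) * v) +
        (I.card : ℝ) ^ (2 * p) * (N * ε) := by
  refine (integral_sum_pow_le_pi hZ hb I lab (2 * p) hcov).trans ?_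
  gcongr
  have e : ∀ ω : Fin N → Ω, ∑ i ∈ I, Z i (ω (lab i)) =
      ∑ k, (fun ω => ∑ i ∈ I with lab i = k, Z i ω) (ω k) := by
    intro ω
    rw [← Finset.sum_fiberwise I lab]
    refine Finset.sum_congr rfl fun k _ => Finset.sum_congr rfl fun i hi => ?_
    rw [(Finset.mem_filter.mp hi).2]
  simp_rw [e]
  refine integral_pi_sum_pow_le (Y := fun k ω => ∑ i ∈ I with lab i = k, Z i ω)
    (fun k => Finset.measurable_sum _ fun i _ => hZ i) (fun k ω => ?_) (fun k => ?_) ht hLnn htL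
    hv hp
  · refine (Finset.abs_sum_le_sum_abs _ _).trans ((Finset.sum_le_sum fun i _ => hb i ω).trans ?_)
    simpa using hL k
  · rw [integral_finsetSum _ fun i _ => integrable_of_abs_le (hZ i) (hb i)]
    exact Finset.sum_eq_zero fun i _ => h0 i

end Decoupling

/-! ### Products as test functions and covariances of products -/

theorem supNorm_le {u : ℕ} {g : (Fin u → ℝ) → ℝ} {M : ℝ} (h : ∀ x, |g x| ≤ M) :
    supNorm g ≤ ENNReal.ofReal M :=
  iSup_le fun x => ENNReal.ofReal_le_ofReal (h x)

theorem lip_le {u : ℕ} {g : (Fin u → ℝ) → ℝ} {L : ℝ}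
    (h : ∀ x y, |g x - g y| ≤ L * ∑ k, |x k - y k|) : lip g ≤ ENNReal.ofReal L := by
  refine iSup_le fun x => iSup_le fun y => iSup_le fun hxy => ENNReal.ofReal_le_ofReal ?_
  have hpos : 0 < ∑ k, |x k - y k| := by
    obtain ⟨k, hk⟩ := Function.ne_iff.mp hxy
    exact Finset.sum_pos' (fun _ _ => abs_nonneg _)
      ⟨k, Finset.mem_univ k, abs_pos.mpr (sub_ne_zero.mpr hk)⟩
  exact (div_le_iff₀ hpos).mpr (h x y)

theorem abs_prod_sub_prod_le {ι : Type*} (s : Finset ι) {a b : ι → ℝ} (ha : ∀ i, |a i| ≤ 1)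
    (hb : ∀ i, |b i| ≤ 1) : |∏ i ∈ s, a i - ∏ i ∈ s, b i| ≤ ∑ i ∈ s, |a i - b i| := by
  classical
  induction s using Finset.induction_on with
  | empty => simp
  | insert i s hi ih =>
    rw [Finset.prod_insert hi, Finset.prod_insert hi, Finset.sum_insert hi]
    have h1 : |∏ i ∈ s, b i| ≤ 1 := abs_prod_le_one s fun i _ => hb i
    calc |a i * ∏ i ∈ s, a i - b i * ∏ i ∈ s, b i|
        = |(a i - b i) * ∏ i ∈ s, b i + a i * (∏ i ∈ s, a i - ∏ i ∈ s, b i)| := by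
          congr 1; ring
      _ ≤ |a i - b i| * |∏ i ∈ s, b i| + |a i| * |∏ i ∈ s, a i - ∏ i ∈ s, b i| := by
          rw [← abs_mul, ← abs_mul]; exact abs_add_le _ _
      _ ≤ _ := add_le_add (mul_le_of_le_one_right (abs_nonneg _) h1)
          ((mul_le_of_le_one_left (abs_nonneg _) (ha i)).trans ih)

section Product

variable {φ : ℝ → ℝ} {V : Set ℝ} {lam : ℝ}

/-- Swapping factors one at a time. For the `ℓ¹` distance the Lipschitz constant does not grow with
`u`, so `psi` of two such products grows only polynomially in `u` and `v`. -/
theorem abs_prod_comp_sub_le (h1 : ∀ x, |φ x| ≤ 1) (hlip : ∀ x y, |φ x - φ y| ≤ lam * |x - y|)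
    {u : ℕ} (x y : Fin u → ℝ) :
    |∏ k, φ (x k) - ∏ k, φ (y k)| ≤ lam * ∑ k, |x k - y k| := by
  refine (abs_prod_sub_prod_le _ (fun k => h1 (x k)) fun k => h1 (y k)).trans ?_
  rw [Finset.mul_sum]
  exact Finset.sum_le_sum fun k _ => hlip _ _

theorem prod_mem_testClass (hsupp : Function.support φ ⊆ V) (h1 : ∀ x, |φ x| ≤ 1)
    (hlip : ∀ x y, |φ x - φ y| ≤ lam * |x - y|) (u : ℕ) :
    (fun x : Fin u → ℝ => ∏ k, φ (x k)) ∈ testClass V u := by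
  refine ⟨fun x hx k _ => hsupp ?_, ?_, ?_⟩
  · exact (Finset.prod_ne_zero_iff.mp hx) k (Finset.mem_univ k)
  · exact (supNorm_le fun x => abs_prod_le_one _ fun k _ => h1 (x k)).trans_lt
      ENNReal.ofReal_lt_top
  · exact (lip_le fun x y => abs_prod_comp_sub_le h1 hlip x y).trans_lt ENNReal.ofReal_lt_top

theorem psi_prod_le (h1 : ∀ x, |φ x| ≤ 1) (hlip : ∀ x y, |φ x - φ y| ≤ lam * |x - y|)
    (hlam : 0 ≤ lam) (u v : ℕ) :
    psi (fun x : Fin u → ℝ => ∏ k, φ (x k)) (fun x : Fin v → ℝ => ∏ k, φ (x k)) ≤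
      ENNReal.ofReal (4 * (1 + u) * (1 + v) * (1 + lam) ^ 2) := by
  have s1 : ∀ u : ℕ, supNorm (fun x : Fin u → ℝ => ∏ k, φ (x k)) ≤ 1 := fun u => by
    simpa using supNorm_le (g := fun x : Fin u → ℝ => ∏ k, φ (x k)) (M := 1)
      fun x => abs_prod_le_one _ fun k _ => h1 (x k)
  have l1 : ∀ u : ℕ, lip (fun x : Fin u → ℝ => ∏ k, φ (x k)) ≤ ENNReal.ofReal lam := fun u =>
    lip_le fun x y => abs_prod_comp_sub_le h1 hlip x y
  have hu : (0 : ℝ) ≤ u := Nat.cast_nonneg u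
  have hv : (0 : ℝ) ≤ v := Nat.cast_nonneg v
  refine max_le ?_ ?_
  · calc _ ≤ (4 : ℝ≥0∞) * 1 * 1 := by unfold psiOne; gcongr <;> exact s1 _
      _ = ENNReal.ofReal 4 := by simp
      _ ≤ _ := by
        refine ENNReal.ofReal_le_ofReal ?_
        have e1 : 1 ≤ (1 + (u : ℝ)) * (1 + v) := by nlinarith
        have e2 : 1 ≤ (1 + lam) ^ 2 := by nlinarith
        have e3 := one_le_mul_of_one_le_of_one_le e1 e2
        nlinarith
  · calc _ ≤ (u : ℝ≥0∞) * 1 * ENNReal.ofReal lam + v * 1 * ENNReal.ofReal lam +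
          u * v * ENNReal.ofReal lam * ENNReal.ofReal lam := by
          unfold psiTwo; gcongr <;> first | exact s1 _ | exact l1 _
      _ = ENNReal.ofReal (u * lam + v * lam + u * v * lam * lam) := by
          rw [ENNReal.ofReal_add (by positivity) (by positivity),
            ENNReal.ofReal_add (by positivity) (by positivity),
            ENNReal.ofReal_mul (by positivity), ENNReal.ofReal_mul (by positivity),
            ENNReal.ofReal_mul (by positivity), ENNReal.ofReal_mul (by positivity),
            ENNReal.ofReal_mul (by positivity)]
          simp
      _ ≤ _ := by
          refine ENNReal.ofReal_le_ofReal ?_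
          have p1 : 0 ≤ u * lam := by positivity
          have p2 : 0 ≤ v * lam := by positivity
          have p3 : 0 ≤ (u : ℝ) * v := by positivity
          have p4 : 0 ≤ u * v * lam := by positivity
          have p5 : 0 ≤ u * v * lam * lam := by positivity
          have p6 : 0 ≤ u * lam * lam := by positivity
          have p7 : 0 ≤ v * lam * lam := by positivity
          nlinarith

end Product

/-- Turns a bound on a supremum of quotients into a product bound. When `b = 0`, a nonzero `a` would
make the quotient infinite, which a finite `c` excludes. -/
theorem le_mul_of_div_le_of_ne_top {a b c : ℝ≥0∞} (h : a / b ≤ c) (hc : c ≠ ∞) (hb : b ≠ ∞) :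
    a ≤ c * b := by
  by_cases h0 : b = 0
  · by_cases ha : a = 0
    · simp [ha]
    · rw [h0, ENNReal.div_zero ha] at h
      exact absurd (top_le_iff.mp h) hc
  · exact (ENNReal.div_le_iff_le_mul (Or.inl h0) (Or.inl hb)).mp h

section Covariance

variable {Ω : Type*} [MeasurableSpace Ω] {P : Measure Ω} {X : ℤ → Ω → ℝ} {V : Set ℝ}
  {φ : ℝ → ℝ} {lam : ℝ}

theorem abs_cov_prod_fin_le (hsupp : Function.support φ ⊆ V) (h1 : ∀ x, |φ x| ≤ 1)
    (hlip : ∀ x y, |φ x - φ y| ≤ lam * |x - y|) (hlam : 0 ≤ lam) {r : ℕ} {R : ℝ} (hR : 0 ≤ R)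
    (hrho : rho P X V r ≤ ENNReal.ofReal R) {u v : ℕ} (hu : 0 < u) (hv : 0 < v)
    (i : Fin u → ℤ) (j : Fin v → ℤ) (hij : ∀ k l, (r : ℤ) ≤ j l - i k) :
    |cov[fun ω => ∏ k, φ (X (i k) ω), fun ω => ∏ k, φ (X (j k) ω); P]| ≤
      R * (4 * (1 + u) * (1 + v) * (1 + lam) ^ 2) := by
  set g : (Fin u → ℝ) → ℝ := fun x => ∏ k, φ (x k)
  set g' : (Fin v → ℝ) → ℝ := fun x => ∏ k, φ (x k)
  have h2 : ENNReal.ofReal |cov[fun ω => g (tuple X i ω), fun ω => g' (tuple X j ω); P]| /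
      psi g g' ≤ ENNReal.ofReal R := by
    refine le_trans ?_ hrho
    unfold rho
    refine le_iSup_of_le u (le_iSup_of_le v (le_iSup_of_le hu (le_iSup_of_le hv
      (le_iSup_of_le i (le_iSup_of_le j (le_iSup_of_le hij (le_iSup_of_le g
      (le_iSup_of_le (prod_mem_testClass hsupp h1 hlip u) (le_iSup_of_le g'
      (le_iSup_of_le (prod_mem_testClass hsupp h1 hlip v) le_rfl))))))))))
  have hpsi := psi_prod_le h1 hlip hlam u v
  have h3 := le_mul_of_div_le_of_ne_top h2 ENNReal.ofReal_ne_top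
    (hpsi.trans_lt ENNReal.ofReal_lt_top).ne
  have h4 := h3.trans (mul_le_mul_right hpsi _)
  rw [← ENNReal.ofReal_mul hR] at h4
  exact (ENNReal.ofReal_le_ofReal_iff (by positivity)).mp h4

variable [IsProbabilityMeasure P]

theorem abs_cov_prod_le (hsupp : Function.support φ ⊆ V) (h1 : ∀ x, |φ x| ≤ 1)
    (hlip : ∀ x y, |φ x - φ y| ≤ lam * |x - y|) (hlam : 0 ≤ lam) {r : ℕ} {R : ℝ} (hR : 0 ≤ R)
    (hrho : rho P X V r ≤ ENNReal.ofReal R) {T : Type*} (s : T → ℤ) (A B : Finset T)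
    (hij : ∀ k ∈ A, ∀ l ∈ B, (r : ℤ) ≤ s l - s k) :
    |cov[fun ω => ∏ k ∈ A, φ (X (s k) ω), fun ω => ∏ k ∈ B, φ (X (s k) ω); P]| ≤
      R * (4 * (1 + A.card) * (1 + B.card) * (1 + lam) ^ 2) := by
  have hnn : 0 ≤ R * (4 * (1 + (A.card : ℝ)) * (1 + B.card) * (1 + lam) ^ 2) := by positivity
  rcases A.eq_empty_or_nonempty with rfl | hA
  · simpa using hnn
  rcases B.eq_empty_or_nonempty with rfl | hB
  · simpa using hnn
  have e : ∀ (A : Finset T) ω, ∏ k ∈ A, φ (X (s k) ω) =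
      ∏ k : Fin A.card, φ (X (s (A.equivFin.symm k)) ω) := by
    intro A ω
    rw [← Finset.prod_coe_sort A (fun k => φ (X (s k) ω)),
      ← Equiv.prod_comp A.equivFin.symm]
  simp_rw [e]
  exact abs_cov_prod_fin_le hsupp h1 hlip hlam hR hrho hA.card_pos hB.card_pos
    (fun k => s (A.equivFin.symm k)) (fun k => s (B.equivFin.symm k))
    fun k l => hij _ (A.equivFin.symm k).2 _ (B.equivFin.symm l).2

/-- Weak dependence for products of centred variables. -/
theorem abs_cov_prod_centred_le (hX : ∀ i, Measurable (X i)) (hφ : Measurable φ)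
    (hsupp : Function.support φ ⊆ V) (h1 : ∀ x, |φ x| ≤ 1)
    (hlip : ∀ x y, |φ x - φ y| ≤ lam * |x - y|) (hlam : 0 ≤ lam) {r : ℕ} {R : ℝ} (hR : 0 ≤ R)
    (hrho : rho P X V r ≤ ENNReal.ofReal R) {m : ℕ} (s : Fin m → ℤ) (A B : Finset (Fin m))
    (hij : ∀ k ∈ A, ∀ l ∈ B, (r : ℤ) ≤ s l - s k) {z : ℤ → ℝ} (hz : ∀ i, |z i| ≤ 1) :
    |cov[fun ω => ∏ k ∈ A, (φ (X (s k) ω) - z (s k)),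
      fun ω => ∏ k ∈ B, (φ (X (s k) ω) - z (s k)); P]| ≤
      4 ^ m * (R * (4 * (1 + m) * (1 + m) * (1 + lam) ^ 2)) := by
  classical
  have hcardm : ∀ A : Finset (Fin m), A.card ≤ m := fun A => by
    simpa using Finset.card_le_univ A
  -- A centred function need not vanish outside `V`, so it cannot be used as a test function.
  -- Expanding over subsets leaves products of uncentred `φ` with coefficients bounded by one; the
  -- number of pairs of subsets gives `4 ^ m`.
  have e : ∀ (A : Finset (Fin m)) ω, ∏ k ∈ A, (φ (X (s k) ω) - z (s k)) =
      ∑ S ∈ A.powerset, (∏ k ∈ A \ S, -z (s k)) * ∏ k ∈ S, φ (X (s k) ω) := by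
    intro A ω
    simp_rw [sub_eq_add_neg]
    rw [Finset.prod_add]
    exact Finset.sum_congr rfl fun S _ => mul_comm _ _
  have hm : ∀ A : Finset (Fin m), MemLp (fun ω => ∏ k ∈ A, φ (X (s k) ω)) 2 P := fun A =>
    memLp_of_abs_le (Finset.measurable_prod _ fun k _ => hφ.comp (hX _)) (c := 1)
      fun ω => abs_prod_le_one _ fun k _ => h1 _
  have hc : ∀ A S : Finset (Fin m), |∏ k ∈ A \ S, -z (s k)| ≤ 1 := fun A S =>
    abs_prod_le_one _ fun k _ => by rw [abs_neg]; exact hz _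
  simp_rw [e]
  rw [covariance_fun_sum_fun_sum' (fun S _ => (hm S).const_mul _) (fun S _ => (hm S).const_mul _)]
  have hterm : ∀ S ∈ A.powerset, ∀ S' ∈ B.powerset,
      |cov[fun ω => (∏ k ∈ A \ S, -z (s k)) * ∏ k ∈ S, φ (X (s k) ω),
        fun ω => (∏ k ∈ B \ S', -z (s k)) * ∏ k ∈ S', φ (X (s k) ω); P]| ≤
      R * (4 * (1 + m) * (1 + m) * (1 + lam) ^ 2) := by
    intro S hS S' hS'
    rw [covariance_const_mul_left, covariance_const_mul_right, abs_mul, abs_mul]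
    refine (mul_le_of_le_one_left (by positivity) (hc A S)).trans
      ((mul_le_of_le_one_left (abs_nonneg _) (hc B S')).trans ?_)
    refine (abs_cov_prod_le hsupp h1 hlip hlam hR hrho s S S' fun k hk l hl =>
      hij k (Finset.mem_powerset.mp hS hk) l (Finset.mem_powerset.mp hS' hl)).trans ?_
    have := hcardm S
    have := hcardm S'
    gcongr
  refine (Finset.abs_sum_le_sum_abs _ _).trans ((Finset.sum_le_sum fun S hS =>
    (Finset.abs_sum_le_sum_abs _ _).trans (Finset.sum_le_sum fun S' hS' =>
      hterm S hS S' hS')).trans ?_)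
  rw [Finset.sum_const, Finset.sum_const, Finset.card_powerset, Finset.card_powerset, nsmul_eq_mul,
    nsmul_eq_mul, ← mul_assoc]
  refine mul_le_mul_of_nonneg_right ?_ (by positivity)
  have e4 : (4 : ℝ) ^ m = 2 ^ m * 2 ^ m := by rw [← mul_pow]; norm_num
  rw [e4]
  push_cast
  exact mul_le_mul (pow_le_pow_right₀ (by norm_num) (hcardm A))
    (pow_le_pow_right₀ (by norm_num) (hcardm B)) (by positivity) (by positivity)

end Covariance

/-! ### Marginals and cross moments near `x₀` -/

section Density

variable {Ω : Type*} [MeasurableSpace Ω] {P : Measure Ω}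
  {X : ℤ → Ω → ℝ} {V : Set ℝ} {f φ : ℝ → ℝ} {x₀ h B : ℝ}

theorem measureReal_Icc_le (hX : HasMarginalDensity P X f)
    (hB : ∀ x ∈ Set.Icc (x₀ - h) (x₀ + h), f x ≤ B) (hB0 : 0 ≤ B) (hh : 0 ≤ h) (i : ℤ) :
    P.real (X i ⁻¹' Set.Icc (x₀ - h) (x₀ + h)) ≤ 2 * B * h := by
  have h1 : P (X i ⁻¹' Set.Icc (x₀ - h) (x₀ + h)) ≤ ENNReal.ofReal (2 * B * h) := by
    rw [← Measure.map_apply (hX.measurable_process i) measurableSet_Icc, hX.map_eq i,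
      withDensity_apply _ measurableSet_Icc]
    calc _ ≤ ∫⁻ _ in Set.Icc (x₀ - h) (x₀ + h), ENNReal.ofReal B :=
          setLIntegral_mono measurable_const fun x hx => ENNReal.ofReal_le_ofReal (hB x hx)
      _ = _ := by
          rw [setLIntegral_const, Real.volume_Icc, ← ENNReal.ofReal_mul hB0]
          congr 1; ring
  exact ENNReal.toReal_le_of_le_ofReal (by positivity) h1

theorem integral_le_of_support_Icc [IsProbabilityMeasure P] (hX : HasMarginalDensity P X f) {ψ : ℝ → ℝ} {M : ℝ}
    (hψ : Measurable ψ) (hψM : ∀ x, |ψ x| ≤ M)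
    (hsupp : Function.support ψ ⊆ Set.Icc (x₀ - h) (x₀ + h))
    (hB : ∀ x ∈ Set.Icc (x₀ - h) (x₀ + h), f x ≤ B) (hB0 : 0 ≤ B) (hh : 0 ≤ h) (i : ℤ) :
    |∫ ω, ψ (X i ω) ∂P| ≤ M * (2 * B * h) := by
  have hM0 : 0 ≤ M := (abs_nonneg _).trans (hψM 0)
  have hms : MeasurableSet (X i ⁻¹' Set.Icc (x₀ - h) (x₀ + h)) :=
    hX.measurable_process i measurableSet_Icc
  have hpt : ∀ ω, |ψ (X i ω)| ≤ (X i ⁻¹' Set.Icc (x₀ - h) (x₀ + h)).indicator (fun _ => M) ω := by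
    intro ω
    by_cases hω : X i ω ∈ Set.Icc (x₀ - h) (x₀ + h)
    · rw [Set.indicator_of_mem (by exact hω)]; exact hψM _
    · rw [Set.indicator_of_notMem (by exact hω)]
      have : ψ (X i ω) = 0 := by
        by_contra hne; exact hω (hsupp hne)
      simp [this]
  calc |∫ ω, ψ (X i ω) ∂P| ≤ ∫ ω, |ψ (X i ω)| ∂P := abs_integral_le_integral_abs
    _ ≤ ∫ ω, (X i ⁻¹' Set.Icc (x₀ - h) (x₀ + h)).indicator (fun _ => M) ω ∂P := by
        refine integral_mono (integrable_of_abs_le (hψ.comp (hX.measurable_process i))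
          fun ω => hψM (X i ω)).abs
          ((integrable_const M).indicator hms) hpt
    _ = M * P.real (X i ⁻¹' Set.Icc (x₀ - h) (x₀ + h)) := by
        rw [integral_indicator_const _ hms, smul_eq_mul, mul_comm]
    _ ≤ _ := mul_le_mul_of_nonneg_left (measureReal_Icc_le hX hB hB0 hh i) hM0

/-- The function `φ` is bounded by `1/2` on an interval of length `2h`, so its `L¹` norm is at most
`h`, and it is paired with itself. The zero function is treated apart because `crossMoment` leaves
it out. -/
theorem abs_integral_mul_le_of_crossMoment {C lam : ℝ} (hC0 : 0 ≤ C) (hh : 0 ≤ h)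
    (hcm : crossMoment P X V ≤ ENNReal.ofReal C) (hsuppV : Function.support φ ⊆ V)
    (hsupp : Function.support φ ⊆ Set.Icc (x₀ - h) (x₀ + h)) (h1 : ∀ x, |φ x| ≤ 1 / 2)
    (hlip : ∀ x y, |φ x - φ y| ≤ lam * |x - y|) {i j : ℤ} (hij : i ≠ j) :
    |∫ ω, φ (X i ω) * φ (X j ω) ∂P| ≤ C * h ^ 2 := by
  set g : (Fin 1 → ℝ) → ℝ := fun x => ∏ k, φ (x k)
  have hg : ∀ t : ℝ, g (fun _ => t) = φ t := fun t => by simp [g]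
  by_cases hg0 : g = 0
  · have hφ : ∀ t, φ t = 0 := fun t => by rw [← hg t, hg0]; rfl
    simp only [hφ, mul_zero, integral_zero, abs_zero]
    positivity
  have hgT : g ∈ testClass V 1 \ {0} :=
    ⟨prod_mem_testClass hsuppV (fun x => (h1 x).trans (by norm_num)) hlip 1, hg0⟩
  have hN : oneNorm g ≤ ENNReal.ofReal h := by
    unfold oneNorm
    simp_rw [hg]
    calc ∫⁻ t, ENNReal.ofReal |φ t|
        ≤ ∫⁻ t, (Set.Icc (x₀ - h) (x₀ + h)).indicator (fun _ => ENNReal.ofReal (1 / 2)) t := by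
          refine lintegral_mono fun t => ?_
          by_cases ht : t ∈ Set.Icc (x₀ - h) (x₀ + h)
          · rw [Set.indicator_of_mem ht]; exact ENNReal.ofReal_le_ofReal (h1 t)
          · rw [Set.indicator_of_notMem ht]
            have : φ t = 0 := by by_contra hne; exact ht (hsupp hne)
            simp [this]
      _ = ENNReal.ofReal h := by
          rw [lintegral_indicator_const measurableSet_Icc, Real.volume_Icc,
            ← ENNReal.ofReal_mul (by norm_num)]
          congr 1; ring
  have h2 : ENNReal.ofReal |∫ ω, g (fun _ => X i ω) * g (fun _ => X j ω) ∂P| /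
      (oneNorm g * oneNorm g) ≤ ENNReal.ofReal C := by
    refine le_trans ?_ hcm
    unfold crossMoment
    exact le_iSup_of_le g (le_iSup_of_le hgT (le_iSup_of_le g (le_iSup_of_le hgT
      (le_iSup_of_le i (le_iSup_of_le j (le_iSup_of_le hij le_rfl))))))
  have hNN : oneNorm g * oneNorm g ≤ ENNReal.ofReal (h ^ 2) := by
    rw [sq, ENNReal.ofReal_mul hh]; exact mul_le_mul' hN hN
  have h3 := (le_mul_of_div_le_of_ne_top h2 ENNReal.ofReal_ne_top
    (hNN.trans_lt ENNReal.ofReal_lt_top).ne).trans (mul_le_mul_right hNN _)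
  rw [← ENNReal.ofReal_mul hC0] at h3
  simp_rw [hg] at h3
  exact (ENNReal.ofReal_le_ofReal_iff (by positivity)).mp h3

end Density

/-! ### Covariance and variance of localised variables -/

/-- The standing assumptions on the process, relative to a neighbourhood `V`. -/
structure IsModel {Ω : Type*} [MeasurableSpace Ω] (P : Measure Ω) (X : ℤ → Ω → ℝ) (f : ℝ → ℝ)
    (V : Set ℝ) (a b c B C : ℝ) : Prop where
  density : HasMarginalDensity P X f
  le_bound : ∀ x ∈ V, f x ≤ B
  rho_le : ∀ r : ℕ, 1 ≤ r → rho P X V r ≤ ENNReal.ofReal (c * Real.exp (-a * (r : ℝ) ^ b))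
  cross_le : crossMoment P X V ≤ ENNReal.ofReal C

/-- A bounded Lipschitz function localised at scale `h` around `x₀`. -/
structure IsWindow (φ : ℝ → ℝ) (V : Set ℝ) (x₀ h lam : ℝ) : Prop where
  support_subset : Function.support φ ⊆ Set.Icc (x₀ - h) (x₀ + h)
  Icc_subset : Set.Icc (x₀ - h) (x₀ + h) ⊆ V
  abs_le : ∀ x, |φ x| ≤ 1 / 2
  lip : ∀ x y, |φ x - φ y| ≤ lam / h * |x - y|
  measurable : Measurable φ
  scale_pos : 0 < h
  scale_le_one : h ≤ 1
  lam_nonneg : 0 ≤ lam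

/-- Comparison with `k^{-2}`: the exponential in `x = k^b` is negligible against `x^{-2/b}`. -/
theorem summable_exp_neg_rpow {a b : ℝ} (ha : 0 < a) (hb : 0 < b) :
    Summable fun k : ℤ => Real.exp (-a * |(k : ℝ)| ^ b) := by
  have hnat : Summable fun k : ℕ => Real.exp (-a * (k : ℝ) ^ b) := by
    have h1 := (isLittleO_exp_neg_mul_rpow_atTop ha (-2 / b)).comp_tendsto
      ((tendsto_rpow_atTop hb).comp tendsto_natCast_atTop_atTop)
    refine summable_of_isBigO_nat (g := fun n : ℕ => (n : ℝ) ^ (-2 : ℝ))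
      (Real.summable_nat_rpow.mpr (by norm_num)) ?_
    refine h1.isBigO.trans (Asymptotics.isBigO_of_le _ fun n => ?_)
    simp only [Function.comp]
    rw [← Real.rpow_mul (Nat.cast_nonneg n), mul_div_cancel₀ _ hb.ne']
  refine Summable.of_nat_of_neg ?_ ?_
  · simpa using hnat
  · simpa using hnat

theorem le_rpow_mul_rpow {x y z θ : ℝ} (hx : 0 ≤ x) (hxy : x ≤ y) (hxz : x ≤ z) (h0 : 0 ≤ θ)
    (h1 : θ ≤ 1) : x ≤ y ^ (1 - θ) * z ^ θ := by
  rcases hx.eq_or_lt with rfl | hx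
  · positivity
  calc x = x ^ (1 - θ) * x ^ θ := by rw [← Real.rpow_add hx]; simp
    _ ≤ _ := by
      have h2 : 0 ≤ 1 - θ := by linarith
      have h3 : 0 ≤ y := hx.le.trans hxy
      gcongr

/-- The constant in the bound for the covariance of two localised variables. -/
noncomputable def covConst (c B C lam θ : ℝ) : ℝ :=
  (C + B ^ 2) ^ (1 - θ) * (16 * c * (1 + lam) ^ 2) ^ θ

/-- The sum over all lags of the mixing rate. -/
noncomputable def lagSum (a b θ : ℝ) : ℝ := ∑' k : ℤ, Real.exp (-(a * θ) * |(k : ℝ)| ^ b)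

section

variable {Ω : Type*} [MeasurableSpace Ω] {P : Measure Ω} {X : ℤ → Ω → ℝ} {f φ : ℝ → ℝ} {V : Set ℝ} {a b c B C x₀ h lam θ : ℝ}

theorem IsWindow.abs_le_one (hφ : IsWindow φ V x₀ h lam) (x : ℝ) : |φ x| ≤ 1 :=
  (hφ.abs_le x).trans (by norm_num)

theorem IsModel.measurable_comp (hM : IsModel P X f V a b c B C) (hφ : IsWindow φ V x₀ h lam)
    (i : ℤ) : Measurable fun ω => φ (X i ω) :=
  hφ.measurable.comp (hM.density.measurable_process i)

variable [IsProbabilityMeasure P]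

theorem IsModel.abs_integral_le (hM : IsModel P X f V a b c B C) (hB : 0 < B)
    (hφ : IsWindow φ V x₀ h lam) (i : ℤ) : |∫ ω, φ (X i ω) ∂P| ≤ B * h := by
  refine (integral_le_of_support_Icc hM.density hφ.measurable hφ.abs_le hφ.support_subset
    (fun x hx => hM.le_bound x (hφ.Icc_subset hx)) hB.le hφ.scale_pos.le i).trans_eq (by ring)

theorem IsModel.integral_sq_le (hM : IsModel P X f V a b c B C) (hB : 0 < B)
    (hφ : IsWindow φ V x₀ h lam) (i : ℤ) : ∫ ω, φ (X i ω) ^ 2 ∂P ≤ B * h := by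
  have h1 := integral_le_of_support_Icc (P := P) hM.density (hφ.measurable.pow_const 2) (M := 1 / 2)
    (fun x => by
      have := hφ.abs_le x
      rw [abs_pow]
      nlinarith [abs_nonneg (φ x)])
    (fun x hx => hφ.support_subset fun h0 => hx (by simp [h0]))
    (fun x hx => hM.le_bound x (hφ.Icc_subset hx)) hB.le hφ.scale_pos.le i
  exact (le_abs_self _).trans (h1.trans_eq (by ring))

/-- Two bounds hold at once: order `h^2` from the cross moment, with no decay in the lag, and
`h^{-2}` times the mixing rate, the Lipschitz constant of a window being `lam / h`. Their geometric
mean with weights `1 - θ` and `θ` decays in the lag and loses only `h^{-4θ}` against `h^2`. -/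
theorem IsModel.abs_cov_le (hM : IsModel P X f V a b c B C) (hB : 0 < B) (hc : 0 < c) (hC : 0 < C)
    (hφ : IsWindow φ V x₀ h lam) (hθ0 : 0 ≤ θ) (hθ1 : θ ≤ 1) {i j : ℤ} (hij : i ≠ j) :
    |cov[fun ω => φ (X i ω), fun ω => φ (X j ω); P]| ≤
      covConst c B C lam θ * h ^ (2 - 4 * θ) *
        Real.exp (-(a * θ) * |((j - i : ℤ) : ℝ)| ^ b) := by
  have hh := hφ.scale_pos
  have hlam := hφ.lam_nonneg
  have hmem : ∀ i, MemLp (fun ω => φ (X i ω)) 2 P := fun i =>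
    memLp_of_abs_le (hM.measurable_comp hφ i) fun ω => hφ.abs_le _
  have k1 : |cov[fun ω => φ (X i ω), fun ω => φ (X j ω); P]| ≤ (C + B ^ 2) * h ^ 2 := by
    rw [covariance_eq_sub (hmem i) (hmem j)]
    have e1 := abs_integral_mul_le_of_crossMoment hC.le hh.le hM.cross_le
      (hφ.support_subset.trans hφ.Icc_subset) hφ.support_subset hφ.abs_le hφ.lip hij
    have e2 := mul_le_mul (hM.abs_integral_le hB hφ i) (hM.abs_integral_le hB hφ j)
      (abs_nonneg _) (by positivity)
    rw [← abs_mul] at e2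
    calc _ ≤ C * h ^ 2 + B * h * (B * h) := (abs_sub _ _).trans (add_le_add e1 e2)
      _ = _ := by ring
  have k2 : |cov[fun ω => φ (X i ω), fun ω => φ (X j ω); P]| ≤
      16 * c * (1 + lam) ^ 2 * (h ^ 2)⁻¹ * Real.exp (-a * |((j - i : ℤ) : ℝ)| ^ b) := by
    have main : ∀ i j : ℤ, i < j → |cov[fun ω => φ (X i ω), fun ω => φ (X j ω); P]| ≤
      16 * c * (1 + lam) ^ 2 * (h ^ 2)⁻¹ * Real.exp (-a * |((j - i : ℤ) : ℝ)| ^ b) := by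
      intro i j hlt
      obtain ⟨r, hr⟩ : ∃ r : ℕ, (r : ℤ) = j - i := ⟨(j - i).toNat, by omega⟩
      have hrr : ((r : ℕ) : ℝ) = |((j - i : ℤ) : ℝ)| := by
        rw [← hr]; simp
      have := abs_cov_prod_le (P := P) (hφ.support_subset.trans hφ.Icc_subset) hφ.abs_le_one
        hφ.lip (by positivity) (by positivity) (hM.rho_le r (by omega)) (fun i : ℤ => i) {i} {j}
        (by simp [hr])
      simp only [Finset.prod_singleton, Finset.card_singleton] at this
      rw [← hrr]
      refine this.trans ?_
      have hl : (1 + lam / h) ^ 2 ≤ (1 + lam) ^ 2 * (h ^ 2)⁻¹ := by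
        rw [← inv_pow, ← mul_pow]
        refine pow_le_pow_left₀ (by positivity) ?_ 2
        rw [add_mul, one_mul, ← div_eq_mul_inv]
        have := (one_le_inv₀ hh).mpr hφ.scale_le_one
        linarith
      calc _ = 16 * c * Real.exp (-a * (r : ℝ) ^ b) * (1 + lam / h) ^ 2 := by push_cast; ring
        _ ≤ 16 * c * Real.exp (-a * (r : ℝ) ^ b) * ((1 + lam) ^ 2 * (h ^ 2)⁻¹) := by gcongr
        _ = _ := by ring
    rcases lt_or_gt_of_ne hij with hlt | hlt
    · exact main i j hlt
    · have := main j i hlt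
      rw [covariance_comm] at this
      have e : |((i - j : ℤ) : ℝ)| = |((j - i : ℤ) : ℝ)| := by push_cast; exact abs_sub_comm _ _
      rwa [e] at this
  refine (le_rpow_mul_rpow (abs_nonneg _) k1 k2 hθ0 hθ1).trans_eq ?_
  unfold covConst
  have hr2 : (h ^ 2) ^ (1 - θ) * ((h ^ 2)⁻¹) ^ θ = h ^ (2 - 4 * θ) := by
    rw [← Real.rpow_natCast, ← Real.rpow_neg hh.le, ← Real.rpow_mul hh.le, ← Real.rpow_mul hh.le,
      ← Real.rpow_add hh]
    congr 1; push_cast; ring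
  rw [Real.mul_rpow (by positivity) (by positivity), Real.mul_rpow (by positivity) (by positivity),
    Real.mul_rpow (by positivity) (by positivity), ← Real.exp_mul, ← hr2]
  rw [show -a * |((j - i : ℤ) : ℝ)| ^ b * θ = -(a * θ) * |((j - i : ℤ) : ℝ)| ^ b by ring]
  ring

/-- The variance of a sum of localised variables is that of independent variables, up to a
remainder of smaller order in the bandwidth. -/
theorem IsModel.integral_sum_sq_le (hM : IsModel P X f V a b c B C) (ha : 0 < a) (hb : 0 < b)
    (hB : 0 < B) (hc : 0 < c) (hC : 0 < C) (hφ : IsWindow φ V x₀ h lam) (hθ0 : 0 < θ)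
    (hθ1 : θ ≤ 1) {m₂ : ℝ} (hm₂ : ∀ i, ∫ ω, φ (X i ω) ^ 2 ∂P ≤ m₂) (S : Finset ℤ) :
    ∫ ω, (∑ i ∈ S, (φ (X i ω) - ∫ ω, φ (X i ω) ∂P)) ^ 2 ∂P ≤
      S.card * (m₂ + covConst c B C lam θ * lagSum a b θ * h ^ (2 - 4 * θ)) := by
  classical
  have hh := hφ.scale_pos
  have hlam := hφ.lam_nonneg
  have hD : 0 ≤ covConst c B C lam θ := by unfold covConst; positivity
  have hsum := summable_exp_neg_rpow (mul_pos ha hθ0) hb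
  have hmeas : ∀ i, Measurable fun ω => φ (X i ω) - ∫ ω, φ (X i ω) ∂P := fun i =>
    (hM.measurable_comp hφ i).sub_const _
  have hbd : ∀ i ω, |φ (X i ω) - ∫ ω, φ (X i ω) ∂P| ≤ 1 := fun i ω => by
    have e1 := hφ.abs_le (X i ω)
    have e2 : |∫ ω, φ (X i ω) ∂P| ≤ 1 / 2 := abs_integral_le_of_abs_le fun ω => hφ.abs_le _
    linarith [abs_sub (φ (X i ω)) (∫ ω, φ (X i ω) ∂P)]
  have hint : ∀ i j, Integrable (fun ω => (φ (X i ω) - ∫ ω, φ (X i ω) ∂P) *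
      (φ (X j ω) - ∫ ω, φ (X j ω) ∂P)) P := fun i j =>
    integrable_of_abs_le ((hmeas i).mul (hmeas j)) (c := 1) fun ω => by
      rw [abs_mul]; exact mul_le_one₀ (hbd i ω) (abs_nonneg _) (hbd j ω)
  have e1 : ∀ ω, (∑ i ∈ S, (φ (X i ω) - ∫ ω, φ (X i ω) ∂P)) ^ 2 = ∑ i ∈ S, ∑ j ∈ S,
      (φ (X i ω) - ∫ ω, φ (X i ω) ∂P) * (φ (X j ω) - ∫ ω, φ (X j ω) ∂P) := fun ω => by
    rw [sq, Finset.sum_mul_sum]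
  simp_rw [e1]
  rw [integral_finsetSum _ fun i _ => integrable_finsetSum _ fun j _ => hint i j]
  simp_rw [integral_finsetSum S fun j _ => hint _ j]
  -- Row by row: the diagonal entry is a variance, and the lags `j - i` of the other entries are
  -- distinct, so their sum is dominated by the series over all integers, uniformly in `S`.
  have hrow : ∀ i ∈ S, ∑ j ∈ S, ∫ ω, (φ (X i ω) - ∫ ω, φ (X i ω) ∂P) *
      (φ (X j ω) - ∫ ω, φ (X j ω) ∂P) ∂P ≤
      m₂ + covConst c B C lam θ * lagSum a b θ * h ^ (2 - 4 * θ) := by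
    intro i hi
    rw [← Finset.add_sum_erase S _ hi]
    refine add_le_add ?_ ?_
    · have hv : ∫ ω, (φ (X i ω) - ∫ ω, φ (X i ω) ∂P) * (φ (X i ω) - ∫ ω, φ (X i ω) ∂P) ∂P =
          Var[fun ω => φ (X i ω); P] := by
        rw [variance_eq_integral (hM.measurable_comp hφ i).aemeasurable]
        simp_rw [sq]
      rw [hv]
      exact (variance_le_expectation_sq (hM.measurable_comp hφ i).aestronglyMeasurable).trans
        (hm₂ i)
    · calc _ ≤ ∑ j ∈ S.erase i, covConst c B C lam θ * h ^ (2 - 4 * θ) *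
            Real.exp (-(a * θ) * |((j - i : ℤ) : ℝ)| ^ b) :=
            Finset.sum_le_sum fun j hj => (le_abs_self _).trans
              (hM.abs_cov_le hB hc hC hφ hθ0.le hθ1 (Finset.ne_of_mem_erase hj).symm)
        _ = covConst c B C lam θ * h ^ (2 - 4 * θ) * ∑ k ∈ (S.erase i).image (fun j => j - i),
            Real.exp (-(a * θ) * |(k : ℝ)| ^ b) := by
            rw [Finset.sum_image (fun x _ y _ hxy => by simpa using hxy), Finset.mul_sum]
        _ ≤ covConst c B C lam θ * h ^ (2 - 4 * θ) * lagSum a b θ := by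
            gcongr
            exact hsum.sum_le_tsum _ fun _ _ => (Real.exp_pos _).le
        _ = _ := by ring
  refine (Finset.sum_le_sum hrow).trans_eq ?_
  rw [Finset.sum_const, nsmul_eq_mul]

end

/-! ### Moment bounds by blocking -/

section

variable {Ω : Type*} [MeasurableSpace Ω] {P : Measure Ω} [IsProbabilityMeasure P]
  {X : ℤ → Ω → ℝ} {f φ : ℝ → ℝ} {V : Set ℝ} {a b c B C x₀ h lam θ : ℝ}

/-- The bound on the decoupling error of moments of order `m`, with gaps of length `r`. -/
noncomputable def decouplingError (a b c h lam : ℝ) (n r m : ℕ) : ℝ :=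
  (n : ℝ) ^ m * ((n + 1 : ℕ) * (4 ^ m * (c * Real.exp (-a * (r : ℝ) ^ b) *
    (4 * (1 + m) * (1 + m) * (1 + lam / h) ^ 2))))

/-- Moment bound for the sum over a union of separated blocks. -/
theorem IsModel.integral_separated_pow_le (hM : IsModel P X f V a b c B C) (ha : 0 < a)
    (hb : 0 < b) (hB : 0 < B) (hc : 0 < c) (hC : 0 < C) (hφ : IsWindow φ V x₀ h lam)
    (hθ0 : 0 < θ) (hθ1 : θ ≤ 1) {m₂ : ℝ} (hm₂ : ∀ i, ∫ ω, φ (X i ω) ^ 2 ∂P ≤ m₂) {n r p : ℕ}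
    (hr : 1 ≤ r) (hp : 1 ≤ p) {I : Finset ℤ} (hI : I ⊆ Finset.Icc 1 (n : ℤ))
    (lab : ℤ → Fin (n + 1))
    (hsep : ∀ i ∈ I, ∀ j ∈ I, lab i < lab j → (r : ℤ) ≤ j - i)
    (hsize : ∀ k, (I.filter fun i => lab i = k).card ≤ 200 * r) {v : ℝ}
    (hv : I.card * (m₂ + covConst c B C lam θ * lagSum a b θ * h ^ (2 - 4 * θ)) ≤ v)
    (hv2 : 80000 * (p : ℝ) ^ 3 * (r : ℝ) ^ 2 ≤ v)
    (herr : decouplingError a b c h lam n r (2 * p) ≤ 1) :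
    ∫ ω, (∑ i ∈ I, (φ (X i ω) - ∫ ω, φ (X i ω) ∂P)) ^ (2 * p) ∂P ≤
      7 * (2 * p * v / Real.exp 1) ^ p := by
  have hh := hφ.scale_pos
  have hlam := hφ.lam_nonneg
  have hp' : (1 : ℝ) ≤ p := by exact_mod_cast hp
  have hr' : (1 : ℝ) ≤ r := by exact_mod_cast hr
  have hpr : (1 : ℝ) ≤ (p : ℝ) ^ 3 * (r : ℝ) ^ 2 :=
    one_le_mul_of_one_le_of_one_le (one_le_pow₀ hp') (one_le_pow₀ hr')
  have hvpos : 0 < v := by linarith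
  -- The optimal parameter for a Gaussian of variance `v` and the moment of order `2p`.
  set t := Real.sqrt (2 * p / v)
  have ht2 : t ^ 2 = 2 * p / v := Real.sq_sqrt (by positivity)
  have htpos : 0 < t := Real.sqrt_pos.mpr (by positivity)
  -- The factor `p` is essential: the Bernstein correction multiplies an exponent equal to `p`, so
  -- it must be at most `1/p` to cost only a constant factor `e` and leave the base of the `p`-th
  -- power intact. This is where `80000 = 2 · 200 ^ 2` comes from.
  have hptL : p * (t * (200 * r)) ≤ 1 := by
    refine (sq_le_one_iff₀ (by positivity)).mp ?_
    rw [mul_pow, mul_pow, ht2, mul_pow]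
    have e : (p : ℝ) ^ 2 * (2 * p / v * (200 ^ 2 * r ^ 2)) = 80000 * p ^ 3 * r ^ 2 / v := by ring
    rw [e]
    exact (div_le_one hvpos).mpr hv2
  have htL : t * (200 * r) ≤ 1 := by
    refine le_trans ?_ hptL
    exact le_mul_of_one_le_left (by positivity) hp'
  have hz : ∀ i, |∫ ω, φ (X i ω) ∂P| ≤ 1 / 2 := fun i =>
    abs_integral_le_of_abs_le fun ω => hφ.abs_le _
  have key := integral_block_sum_pow_le (P := P)
    (Z := fun i ω => φ (X i ω) - ∫ ω, φ (X i ω) ∂P)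
    (fun i => (hM.measurable_comp hφ i).sub_const _)
    (fun i ω => by
      have e1 := hφ.abs_le (X i ω)
      linarith [hz i, abs_sub (φ (X i ω)) (∫ ω, φ (X i ω) ∂P)])
    (fun i => by
      rw [integral_sub (integrable_of_abs_le (hM.measurable_comp hφ i) fun ω => hφ.abs_le _)
        (integrable_const _)]
      simp)
    I lab hp
    (ε := 4 ^ (2 * p) * (c * Real.exp (-a * (r : ℝ) ^ b) *
      (4 * (1 + (2 * p : ℕ)) * (1 + (2 * p : ℕ)) * (1 + lam / h) ^ 2)))
    (fun s hs A B' hAB => abs_cov_prod_centred_le hM.density.measurable_process hφ.measurable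
      (hφ.support_subset.trans hφ.Icc_subset) hφ.abs_le_one hφ.lip (by positivity) (by positivity)
      (hM.rho_le r hr) s A B' (fun k hk l hl => hsep _ (hs k) _ (hs l) (hAB k hk l hl))
      fun i => (hz i).trans (by norm_num))
    (L := 200 * r) (fun k => by exact_mod_cast hsize k) (by positivity) htpos htL (v := v) (by
      refine le_trans ?_ hv
      refine (Finset.sum_le_sum fun k _ =>
        hM.integral_sum_sq_le ha hb hB hc hC hφ hθ0 hθ1 hm₂ _).trans_eq ?_
      rw [← Finset.sum_mul]
      congr 1
      rw [← Nat.cast_sum, Finset.card_eq_sum_card_fiberwise (f := lab) (t := Finset.univ)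
        (fun _ _ => Finset.mem_coe.mpr (Finset.mem_univ _))])
  refine key.trans ?_
  have hcard : (I.card : ℝ) ≤ n := by
    have := Finset.card_le_card hI
    simp at this
    exact_mod_cast this
  have e1 : (I.card : ℝ) ^ (2 * p) * ((n + 1 : ℕ) * (4 ^ (2 * p) *
      (c * Real.exp (-a * (r : ℝ) ^ b) *
      (4 * (1 + (2 * p : ℕ)) * (1 + (2 * p : ℕ)) * (1 + lam / h) ^ 2)))) ≤ 1 := by
    refine le_trans ?_ herr
    unfold decouplingError
    gcongr
  have e2 : 2 * ((2 * p) / (Real.exp 1 * t)) ^ (2 * p) *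
      Real.exp (t ^ 2 / 2 * (1 + t * (200 * r)) * v) ≤ 2 * Real.exp 1 * (2 * p * v / Real.exp 1) ^ p := by
    have f1 : ((2 * p : ℝ) / (Real.exp 1 * t)) ^ (2 * p) = (2 * p * v / Real.exp 1 ^ 2) ^ p := by
      rw [pow_mul, div_pow, mul_pow (Real.exp 1), ht2]
      congr 1; field_simp
    have f2 : t ^ 2 / 2 * (1 + t * (200 * r)) * v = p + p * (t * (200 * r)) := by
      rw [ht2]; field_simp
    have f3 : Real.exp (p + p * (t * (200 * r))) ≤ Real.exp 1 ^ p * Real.exp 1 := by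
      rw [← Real.exp_nat_mul, ← Real.exp_add]
      exact Real.exp_le_exp.mpr (by linarith)
    rw [f1, f2]
    calc _ ≤ 2 * (2 * p * v / Real.exp 1 ^ 2) ^ p * (Real.exp 1 ^ p * Real.exp 1) := by gcongr
      _ = 2 * Real.exp 1 * (2 * p * v / Real.exp 1 ^ 2 * Real.exp 1) ^ p := by rw [mul_pow]; ring
      _ = _ := by congr 2; field_simp
  -- Allows the additive decoupling error, at most one, to be absorbed in the main term; `2e + 1 ≤
  -- 7` then yields the constant.
  have e3 : 1 ≤ (2 * p * v / Real.exp 1) ^ p := by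
    refine one_le_pow₀ ?_
    rw [le_div_iff₀ (Real.exp_pos 1)]
    have : v ≤ p * v := le_mul_of_one_le_left hvpos.le hp'
    linarith [Real.exp_one_lt_three]
  push_cast at e1 ⊢
  have e4 : 2 * Real.exp 1 + 1 ≤ 7 := by linarith [Real.exp_one_lt_three]
  nlinarith

/-- Quotient and shifted remainder embed these indices into at most `n/(200r) + 1` blocks of length
`r`. The condition `200 r ≤ n` lets the incomplete last period be paid by a second `n/200`. -/
theorem card_small_blocks_le {n r : ℕ} (hr : 1 ≤ r) (hrn : 200 * r ≤ n) :
    (((Finset.Icc 1 (n : ℤ)).filter fun i : ℤ => ¬ i % (200 * r : ℕ) < (199 * r : ℕ)).card : ℝ) ≤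
      n / 100 := by
  have h1 : ((Finset.Icc 1 (n : ℤ)).filter fun i : ℤ => ¬ i % (200 * r : ℕ) < (199 * r : ℕ)).card ≤
      (Finset.range (n / (200 * r) + 1) ×ˢ Finset.range r).card := by
    refine Finset.card_le_card_of_injOn
      (fun i : ℤ => ((i / (200 * r : ℕ)).toNat, (i % (200 * r : ℕ) - (199 * r : ℕ)).toNat)) ?_ ?_
    · intro i hi
      simp only [Finset.coe_filter, Finset.mem_Icc, Set.mem_ofPred_eq, not_lt] at hi
      obtain ⟨⟨hi1, hi2⟩, hi3⟩ := hi
      simp only [Finset.coe_product, Finset.coe_range, Set.mem_prod, Set.mem_Iio]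
      have hlt := Int.emod_lt_of_pos i (b := (200 * r : ℕ)) (by omega)
      have hq : i / (200 * r : ℕ) ≤ (n : ℤ) / (200 * r : ℕ) :=
        Int.ediv_le_ediv (by omega) hi2
      have hq0 : 0 ≤ (n : ℤ) / (200 * r : ℕ) := Int.ediv_nonneg (by omega) (by omega)
      rw [← Int.natCast_ediv] at hq hq0
      constructor
      · omega
      · omega
    · intro i hi j hj hij
      simp only [Finset.coe_filter, Finset.mem_Icc, Set.mem_ofPred_eq, not_lt] at hi hj
      simp only [Prod.mk.injEq] at hij
      have q1 : 0 ≤ i / (200 * r : ℕ) := Int.ediv_nonneg (by omega) (by omega)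
      have q2 : 0 ≤ j / (200 * r : ℕ) := Int.ediv_nonneg (by omega) (by omega)
      have q3 : i / (200 * r : ℕ) = j / (200 * r : ℕ) := by omega
      have q4 : i % (200 * r : ℕ) = j % (200 * r : ℕ) := by omega
      rw [← Int.mul_ediv_add_emod i (200 * r : ℕ), ← Int.mul_ediv_add_emod j (200 * r : ℕ), q3, q4]
  rw [Finset.card_product, Finset.card_range, Finset.card_range] at h1
  have h2 : (n / (200 * r) + 1) * r * 100 ≤ n := by
    have := Nat.div_mul_le_self n (200 * r)
    nlinarith
  rw [le_div_iff₀ (by norm_num)]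
  have h3 := Nat.mul_le_mul_right 100 h1
  exact_mod_cast h3.trans h2

/-- Moment bound for the sum of `n` localised variables. -/
theorem IsModel.integral_sum_pow_le (hM : IsModel P X f V a b c B C) (ha : 0 < a)
    (hb : 0 < b) (hB : 0 < B) (hc : 0 < c) (hC : 0 < C) (hφ : IsWindow φ V x₀ h lam)
    (hθ0 : 0 < θ) (hθ1 : θ ≤ 1) {m₂ : ℝ} (hm₂ : ∀ i, ∫ ω, φ (X i ω) ^ 2 ∂P ≤ m₂) {n r p : ℕ}
    (hr : 1 ≤ r) (hrn : 200 * r ≤ n) (hp : 1 ≤ p) {W : ℝ}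
    (hW : n * (m₂ + covConst c B C lam θ * lagSum a b θ * h ^ (2 - 4 * θ)) ≤ W)
    (hW2 : 8000000 * (p : ℝ) ^ 3 * (r : ℝ) ^ 2 ≤ W)
    (herr : decouplingError a b c h lam n r (2 * p) ≤ 1) :
    ∫ ω, (∑ i ∈ Finset.Icc 1 (n : ℤ), (φ (X i ω) - ∫ ω, φ (X i ω) ∂P)) ^ (2 * p) ∂P ≤
      14 * (200 / 81 * (p * W) / Real.exp 1) ^ p := by
  classical
  have hh := hφ.scale_pos
  have hlam := hφ.lam_nonneg
  have hper : (0 : ℤ) < (200 * r : ℕ) := by omega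
  -- The label is the number of the period; the truncation at `n` is never active on `Icc 1 n`.
  set lab : ℤ → Fin (n + 1) := fun i => ⟨min (i / (200 * r : ℕ)).toNat n, by omega⟩
  have hlab : ∀ i ∈ Finset.Icc 1 (n : ℤ), ((lab i : ℕ) : ℤ) = i / (200 * r : ℕ) := by
    intro i hi
    rw [Finset.mem_Icc] at hi
    have q1 : 0 ≤ i / (200 * r : ℕ) := Int.ediv_nonneg (by omega) (by omega)
    have q2 : i / (200 * r : ℕ) ≤ i := Int.ediv_le_self _ (by omega)
    simp only [lab]
    omega
  have hsize : ∀ I ⊆ Finset.Icc 1 (n : ℤ), ∀ k, (I.filter fun i => lab i = k).card ≤ 200 * r := by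
    intro I hI k
    have hsub : (I.filter fun i => lab i = k) ⊆
        Finset.Ico ((200 * r : ℕ) * (k : ℤ)) ((200 * r : ℕ) * (k : ℤ) + (200 * r : ℕ)) := by
      intro i hi
      obtain ⟨hi1, hi2⟩ := Finset.mem_filter.mp hi
      have h1 := hlab i (hI hi1)
      rw [hi2] at h1
      have h2 := Int.mul_ediv_add_emod i (200 * r : ℕ)
      have h3 := Int.emod_nonneg i hper.ne'
      have h4 := Int.emod_lt_of_pos i hper
      rw [← h1] at h2
      rw [Finset.mem_Ico]
      constructor <;> linarith
    refine (Finset.card_le_card hsub).trans ?_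
    simp
  have hgap : ∀ i ∈ Finset.Icc 1 (n : ℤ), ∀ j ∈ Finset.Icc 1 (n : ℤ), lab i < lab j →
      (200 * r : ℕ) + j % (200 * r : ℕ) - i % (200 * r : ℕ) ≤ j - i := by
    intro i hi j hj hij
    have h1 := hlab i hi
    have h2 := hlab j hj
    have h3 : ((lab i : ℕ) : ℤ) + 1 ≤ (lab j : ℕ) := by exact_mod_cast hij
    rw [h1, h2] at h3
    have h4 := Int.mul_ediv_add_emod i (200 * r : ℕ)
    have h5 := Int.mul_ediv_add_emod j (200 * r : ℕ)
    have h6 := mul_le_mul_of_nonneg_left h3 hper.le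
    linarith
  have hp' : (1 : ℝ) ≤ p := by exact_mod_cast hp
  have hr' : (1 : ℝ) ≤ r := by exact_mod_cast hr
  have hpr : (1 : ℝ) ≤ (p : ℝ) ^ 3 * (r : ℝ) ^ 2 :=
    one_le_mul_of_one_le_of_one_le (one_le_pow₀ hp') (one_le_pow₀ hr')
  have hWpos : 0 < W := by linarith
  -- Each period consists of a block of length `199 r` and one of length `r`. Blocks of either kind
  -- are separated by those of the other, so all gaps are at least `r`.
  set Ib := (Finset.Icc 1 (n : ℤ)).filter fun i : ℤ => i % (200 * r : ℕ) < (199 * r : ℕ)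
  set Is := (Finset.Icc 1 (n : ℤ)).filter fun i : ℤ => ¬ i % (200 * r : ℕ) < (199 * r : ℕ)
  have hvnn : 0 ≤ m₂ + covConst c B C lam θ * lagSum a b θ * h ^ (2 - 4 * θ) := by
    have h1 : 0 ≤ m₂ := (integral_nonneg fun ω => sq_nonneg (φ (X 0 ω))).trans (hm₂ 0)
    have h2 : 0 ≤ covConst c B C lam θ := by unfold covConst; positivity
    have h3 : 0 ≤ lagSum a b θ := tsum_nonneg fun _ => (Real.exp_pos _).le
    positivity
  have hcb : (Ib.card : ℝ) ≤ n := by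
    have := Finset.card_filter_le (Finset.Icc 1 (n : ℤ)) fun i : ℤ => i % (200 * r : ℕ) < (199 * r : ℕ)
    simp only [Int.card_Icc] at this
    exact_mod_cast this.trans (by omega)
  have hbig := hM.integral_separated_pow_le ha hb hB hc hC hφ hθ0 hθ1 hm₂ hr hp
    (Finset.filter_subset _ _ : Ib ⊆ _) lab
    (fun i hi j hj hij => by
      obtain ⟨hi1, hi2⟩ := Finset.mem_filter.mp hi
      obtain ⟨hj1, hj2⟩ := Finset.mem_filter.mp hj
      have := hgap i hi1 j hj1 hij
      have := Int.emod_nonneg j hper.ne'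
      push_cast at *
      omega)
    (hsize Ib (Finset.filter_subset _ _)) (v := W)
    ((mul_le_mul_of_nonneg_right hcb hvnn).trans hW)
    (le_trans (by nlinarith) hW2) herr
  have hsmall := hM.integral_separated_pow_le ha hb hB hc hC hφ hθ0 hθ1 hm₂ hr hp
    (Finset.filter_subset _ _ : Is ⊆ _) lab
    (fun i hi j hj hij => by
      obtain ⟨hi1, hi2⟩ := Finset.mem_filter.mp hi
      obtain ⟨hj1, hj2⟩ := Finset.mem_filter.mp hj
      have := hgap i hi1 j hj1 hij
      have := Int.emod_lt_of_pos i hper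
      push_cast at *
      omega)
    (hsize Is (Finset.filter_subset _ _)) (v := W / 100)
    (by
      refine (mul_le_mul_of_nonneg_right (card_small_blocks_le hr hrn) hvnn).trans ?_
      linarith)
    (by rw [le_div_iff₀ (by norm_num)]; linarith) herr
  -- Convexity with weights `9/10` and `1/10`. The long blocks get the factor `(10/9)^2`, turning
  -- `2` into `200/81`. The factor `10^2` on the short blocks is offset by their variance `W / 100`,
  -- for which `hW2` carries `8000000 = 100 · 80000`.
  have hsplit : ∀ x y : ℝ, (x + y) ^ (2 * p) ≤
      (10 / 9) ^ (2 * p) * x ^ (2 * p) + 10 ^ (2 * p) * y ^ (2 * p) := by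
    intro x y
    have hcv : ConvexOn ℝ Set.univ fun x : ℝ => x ^ (2 * p) := (even_two_mul p).convexOn_pow
    have := hcv.2 (Set.mem_univ (10 / 9 * x)) (Set.mem_univ (10 * y))
      (by norm_num : (0 : ℝ) ≤ 9 / 10) (by norm_num : (0 : ℝ) ≤ 1 / 10) (by norm_num)
    simp only [smul_eq_mul] at this
    have e1 : 9 / 10 * (10 / 9 * x) + 1 / 10 * (10 * y) = x + y := by ring
    rw [e1, mul_pow, mul_pow] at this
    have p1 : 0 ≤ (10 / 9 : ℝ) ^ (2 * p) * x ^ (2 * p) :=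
      mul_nonneg (by positivity) ((even_two_mul p).pow_nonneg x)
    have p2 : 0 ≤ (10 : ℝ) ^ (2 * p) * y ^ (2 * p) :=
      mul_nonneg (by positivity) ((even_two_mul p).pow_nonneg y)
    linarith
  have hint : ∀ I : Finset ℤ, Integrable
      (fun ω => (∑ i ∈ I, (φ (X i ω) - ∫ ω, φ (X i ω) ∂P)) ^ (2 * p)) P := fun I => by
    refine integrable_of_abs_le ((Finset.measurable_sum _ fun i _ =>
      (hM.measurable_comp hφ i).sub_const _).pow_const _) (c := (I.card : ℝ) ^ (2 * p)) fun ω => ?_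
    rw [abs_pow]
    refine pow_le_pow_left₀ (abs_nonneg _) ((Finset.abs_sum_le_sum_abs _ _).trans ?_) _
    refine (Finset.sum_le_sum (g := fun _ => (1 : ℝ)) fun i _ => ?_).trans (by simp)
    have e1 := hφ.abs_le (X i ω)
    have e2 : |∫ ω, φ (X i ω) ∂P| ≤ 1 / 2 := abs_integral_le_of_abs_le fun ω => hφ.abs_le _
    linarith [abs_sub (φ (X i ω)) (∫ ω, φ (X i ω) ∂P)]
  have hmain : ∫ ω, (∑ i ∈ Finset.Icc 1 (n : ℤ), (φ (X i ω) - ∫ ω, φ (X i ω) ∂P)) ^ (2 * p) ∂P ≤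
      (10 / 9) ^ (2 * p) * (7 * (2 * p * W / Real.exp 1) ^ p) +
      10 ^ (2 * p) * (7 * (2 * p * (W / 100) / Real.exp 1) ^ p) := by
    calc _ ≤ ∫ ω, ((10 / 9) ^ (2 * p) * (∑ i ∈ Ib, (φ (X i ω) - ∫ ω, φ (X i ω) ∂P)) ^ (2 * p) +
          10 ^ (2 * p) * (∑ i ∈ Is, (φ (X i ω) - ∫ ω, φ (X i ω) ∂P)) ^ (2 * p)) ∂P := by
          refine integral_mono (hint _) (((hint Ib).const_mul _).add ((hint Is).const_mul _))
            fun ω => ?_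
          have := hsplit (∑ i ∈ Ib, (φ (X i ω) - ∫ ω, φ (X i ω) ∂P))
            (∑ i ∈ Is, (φ (X i ω) - ∫ ω, φ (X i ω) ∂P))
          rwa [Finset.sum_filter_add_sum_filter_not] at this
      _ ≤ _ := by
          rw [integral_add ((hint Ib).const_mul _) ((hint Is).const_mul _), integral_const_mul,
            integral_const_mul]
          gcongr
  refine hmain.trans ?_
  have f1 : (10 / 9 : ℝ) ^ (2 * p) * (7 * (2 * p * W / Real.exp 1) ^ p) =
      7 * (200 / 81 * (p * W) / Real.exp 1) ^ p := by
    rw [pow_mul, mul_left_comm, ← mul_pow]; congr 2; ring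
  have f2 : (10 : ℝ) ^ (2 * p) * (7 * (2 * p * (W / 100) / Real.exp 1) ^ p) ≤
      7 * (200 / 81 * (p * W) / Real.exp 1) ^ p := by
    rw [pow_mul, mul_left_comm, ← mul_pow]
    have e : (10 : ℝ) ^ 2 * (2 * p * (W / 100) / Real.exp 1) = 2 * (p * W) / Real.exp 1 := by ring
    rw [e]
    gcongr
    norm_num
  linarith

end

/-! ### The kernel normalised as a window -/

section Kernel

variable {K : ℝ → ℝ}

theorem IsLipschitzKernel.exists_bound (hK : IsLipschitzKernel K) :
    ∃ κ L : ℝ, 1 ≤ κ ∧ 0 ≤ L ∧ (∀ x, |K x| ≤ κ) ∧ ∀ x y, |K x - K y| ≤ L * |x - y| := by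
  obtain ⟨L, hL⟩ := hK.lipschitz
  have hlip : ∀ x y, |K x - K y| ≤ L * |x - y| := fun x y => by
    simpa [Real.dist_eq] using hL.dist_le_mul x y
  -- The kernel vanishes at `2`, which is within distance `3` of its support; the added `1` makes
  -- the bound at least one.
  refine ⟨3 * L + 1, L, by have := L.2; linarith, L.2, fun x => ?_, hlip⟩
  have hL0 : (0 : ℝ) ≤ L := L.2
  by_cases hx : K x = 0
  · rw [hx, abs_zero]; positivity
  · have hxm := hK.support_subset hx
    have h2 : K 2 = 0 := by
      by_contra h
      have := (hK.support_subset h).2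
      norm_num at this
    have h3 := hlip x 2
    rw [h2, sub_zero] at h3
    have h4 : |x - 2| ≤ 3 := abs_le.mpr ⟨by linarith [hxm.1], by linarith [hxm.2]⟩
    nlinarith

/-- The kernel at scale `h`, centred at `x₀` and normalised by `2 κ`. -/
noncomputable def localKernel (K : ℝ → ℝ) (κ x₀ h : ℝ) : ℝ → ℝ :=
  fun x => K (h⁻¹ * (x₀ - x)) / (2 * κ)

theorem isWindow_localKernel {κ L x₀ h : ℝ} {V : Set ℝ} (hK : IsLipschitzKernel K) (hκ : 1 ≤ κ)
    (hL0 : 0 ≤ L) (hb : ∀ x, |K x| ≤ κ) (hlip : ∀ x y, |K x - K y| ≤ L * |x - y|) (hh : 0 < h)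
    (hh1 : h ≤ 1) (hV : Set.Icc (x₀ - h) (x₀ + h) ⊆ V) :
    IsWindow (localKernel K κ x₀ h) V x₀ h L where
  support_subset := by
    intro x hx
    have h1 : K (h⁻¹ * (x₀ - x)) ≠ 0 := fun h0 => hx (by simp [localKernel, h0])
    have h2 := hK.support_subset h1
    have h3 : |h⁻¹ * (x₀ - x)| ≤ 1 := abs_le.mpr h2
    rw [abs_mul, abs_of_pos (inv_pos.mpr hh), inv_mul_le_iff₀ hh, mul_one, abs_le] at h3
    exact ⟨by linarith [h3.2], by linarith [h3.1]⟩
  Icc_subset := hV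
  abs_le := by
    intro x
    unfold localKernel
    rw [abs_div, abs_of_pos (by linarith : 0 < 2 * κ), div_le_iff₀ (by linarith)]
    linarith [hb (h⁻¹ * (x₀ - x))]
  lip := by
    intro x y
    unfold localKernel
    rw [← sub_div, abs_div, abs_of_pos (by linarith : 0 < 2 * κ)]
    have h1 := hlip (h⁻¹ * (x₀ - x)) (h⁻¹ * (x₀ - y))
    rw [show h⁻¹ * (x₀ - x) - h⁻¹ * (x₀ - y) = h⁻¹ * (y - x) by ring, abs_mul,
      abs_of_pos (inv_pos.mpr hh), abs_sub_comm y x] at h1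
    refine (div_le_self (abs_nonneg _) (by linarith)).trans (h1.trans_eq ?_)
    ring
  measurable := by
    have hc : Continuous K := hK.lipschitz.choose_spec.continuous
    unfold localKernel
    exact (hc.comp (by fun_prop)).measurable.div_const _
  scale_pos := hh
  scale_le_one := hh1
  lam_nonneg := hL0

/-- The bound `1/2` makes squaring non-expansive on the range of `φ`. The moment inequality
therefore applies with the same parameters to the summands of the empirical variance. -/
theorem IsWindow.sq {φ : ℝ → ℝ} {V : Set ℝ} {x₀ h lam : ℝ} (hφ : IsWindow φ V x₀ h lam) :
    IsWindow (fun x => φ x ^ 2) V x₀ h lam where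
  support_subset := fun x hx => hφ.support_subset fun h0 => hx (by simp [h0])
  Icc_subset := hφ.Icc_subset
  abs_le := fun x => by
    rw [abs_pow]; nlinarith [abs_nonneg (φ x), hφ.abs_le x]
  lip := fun x y => by
    have h1 : φ x ^ 2 - φ y ^ 2 = (φ x - φ y) * (φ x + φ y) := by ring
    rw [h1, abs_mul]
    have h2 : |φ x + φ y| ≤ 1 := (abs_add_le _ _).trans (by linarith [hφ.abs_le x, hφ.abs_le y])
    exact (mul_le_of_le_one_right (abs_nonneg _) h2).trans (hφ.lip x y)
  measurable := hφ.measurable.pow_const 2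
  scale_pos := hφ.scale_pos
  scale_le_one := hφ.scale_le_one
  lam_nonneg := hφ.lam_nonneg

theorem kernelEst_eq {κ x₀ h : ℝ} (hκ : 1 ≤ κ) (n : ℕ) (x : ℤ → ℝ) :
    kernelEst K n x x₀ h =
      2 * κ / (n * h) * ∑ i ∈ Finset.Icc (1 : ℤ) n, localKernel K κ x₀ h (x i) := by
  unfold kernelEst scaled localKernel
  rw [Finset.mul_sum, Finset.mul_sum]
  refine Finset.sum_congr rfl fun i _ => ?_
  have : κ ≠ 0 := by linarith
  field_simp

theorem varEst_eq {κ x₀ h : ℝ} (hκ : 1 ≤ κ) (n : ℕ) (x : ℤ → ℝ) :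
    varEst K n x x₀ h =
      (2 * κ / (n * h)) ^ 2 * ∑ i ∈ Finset.Icc (1 : ℤ) n, localKernel K κ x₀ h (x i) ^ 2 := by
  unfold varEst scaled localKernel
  rw [Finset.mul_sum, Finset.mul_sum]
  refine Finset.sum_congr rfl fun i _ => ?_
  have : κ ≠ 0 := by linarith
  field_simp

/-- The factor `2κ/(nh)` is the one that `kernelEst_eq` extracts, so an excess of the estimator over
its majorant is this factor times an excess for a sum of bounded variables. -/
theorem majorant_eq {κ x₀ h : ℝ} (hκ : 1 ≤ κ) (q : ℝ) {n : ℕ} (hn : 0 < n) (hh : 0 < h)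
    (x : ℤ → ℝ) :
    majorant q K n x x₀ h = 2 * κ / (n * h) * Real.sqrt (2 * q * |Real.log h| *
      (∑ i ∈ Finset.Icc (1 : ℤ) n, localKernel K κ x₀ h (x i) ^ 2 +
        delta n / (4 * κ ^ 2) * (n * h))) := by
  have hn' : (0 : ℝ) < n := by exact_mod_cast hn
  unfold majorant
  rw [varEst_eq hκ]
  have hk : 0 ≤ 2 * κ / (n * h) := by positivity
  nth_rewrite 2 [← Real.sqrt_sq hk]
  rw [← Real.sqrt_mul (sq_nonneg _)]
  congr 1
  field_simp
  ring

end Kernel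

section Model

variable {Ω : Type*} [MeasurableSpace Ω] {P : Measure Ω} {X : ℤ → Ω → ℝ} {f : ℝ → ℝ}

theorem HasMarginalDensity.integral_comp_eq (hX : HasMarginalDensity P X f) {ψ : ℝ → ℝ}
    (hψ : Measurable ψ) (i : ℤ) : ∫ ω, ψ (X i ω) ∂P = ∫ x, ψ x * f x := by
  rw [← integral_map (hX.measurable_process i).aemeasurable hψ.aestronglyMeasurable, hX.map_eq i]
  have h1 : (fun x => ENNReal.ofReal (f x)) = fun x => ((f x).toNNReal : ℝ≥0∞) := rfl
  rw [h1, integral_withDensity_eq_integral_smul hX.measurable_density.real_toNNReal]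
  refine integral_congr_ae (Filter.Eventually.of_forall fun x => ?_)
  simp [NNReal.smul_def, Real.coe_toNNReal _ (hX.nonneg x), mul_comm]

theorem HasMarginalDensity.integral_localKernel (hX : HasMarginalDensity P X f) {K : ℝ → ℝ}
    (hK : Measurable K) {κ x₀ h : ℝ} (hκ : 1 ≤ κ) (hh : 0 < h) (i : ℤ) :
    ∫ ω, localKernel K κ x₀ h (X i ω) ∂P = h / (2 * κ) * smoothed K f h x₀ := by
  have hm : Measurable (localKernel K κ x₀ h) := by
    unfold localKernel
    exact (hK.comp (by fun_prop)).div_const _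
  rw [hX.integral_comp_eq hm]
  -- Reflection `t ↦ x₀ - t` in the convolution.
  have h1 : smoothed K f h x₀ = ∫ t, scaled K h (x₀ - t) * f t := by
    unfold smoothed convolution
    rw [← integral_sub_left_eq_self _ volume x₀]
    simp
  rw [h1, ← integral_const_mul]
  refine integral_congr_ae (Filter.Eventually.of_forall fun x => ?_)
  have : κ ≠ 0 := by linarith
  simp only [localKernel, scaled]
  field_simp

theorem HasMarginalDensity.kernelEst_sub_smoothed (hX : HasMarginalDensity P X f) {K : ℝ → ℝ}
    (hK : Measurable K) {κ x₀ h : ℝ} (hκ : 1 ≤ κ) (hh : 0 < h) {n : ℕ} (hn : 0 < n) (ω : Ω) :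
    kernelEst K n (fun i => X i ω) x₀ h - smoothed K f h x₀ =
      2 * κ / (n * h) * ∑ i ∈ Finset.Icc (1 : ℤ) n,
        (localKernel K κ x₀ h (X i ω) - ∫ ω, localKernel K κ x₀ h (X i ω) ∂P) := by
  have hn' : (0 : ℝ) < n := by exact_mod_cast hn
  have hκ' : 0 < κ := by linarith
  rw [kernelEst_eq hκ, Finset.sum_sub_distrib, mul_sub]
  congr 1
  simp_rw [hX.integral_localKernel hK hκ hh]
  rw [Finset.sum_const, Int.card_Icc]
  simp
  field_simp

end Model

/-! ### The deterministic oracle inequality -/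

section Selection

variable {q : ℝ} {K : ℝ → ℝ} {n : ℕ} {x : ℤ → ℝ} {x₀ : ℝ}

theorem abs_sub_le_biasProxy {h h' : ℝ} (hh' : h' ∈ grid q n) :
    |kernelEst K n x x₀ (max h h') - kernelEst K n x x₀ h'| ≤
      biasProxy q K n x x₀ h + majorantTwo q K n x x₀ h h' := by
  have h1 : Real.toNNReal (|kernelEst K n x x₀ (max h h') - kernelEst K n x x₀ h'| -
      majorantTwo q K n x x₀ h h') ≤ biasProxy q K n x x₀ h :=
    Finset.le_sup (f := fun h' => Real.toNNReal
      (|kernelEst K n x x₀ (max h h') - kernelEst K n x x₀ h'| - majorantTwo q K n x x₀ h h')) hh'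
  have h2 : |kernelEst K n x x₀ (max h h') - kernelEst K n x x₀ h'| -
      majorantTwo q K n x x₀ h h' ≤ (biasProxy q K n x x₀ h : ℝ) :=
    (Real.le_coe_toNNReal _).trans (by exact_mod_cast h1)
  linarith

theorem majorant_nonneg (h : ℝ) : 0 ≤ majorant q K n x x₀ h := Real.sqrt_nonneg _

/-- The oracle inequality of the selection rule, before bounding the bias proxy. -/
theorem IsSelected.abs_sub_le {h hs : ℝ} (hsel : IsSelected q K n x x₀ hs) (hh : h ∈ grid q n)
    (y : ℝ) : |kernelEst K n x x₀ hs - y| ≤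
      2 * (biasProxy q K n x x₀ h + majorant q K n x x₀ h) + |kernelEst K n x x₀ h - y| := by
  have h1 := hsel.2 h hh
  have h2 : |kernelEst K n x x₀ hs - y| ≤
      |kernelEst K n x x₀ hs - kernelEst K n x x₀ h| + |kernelEst K n x x₀ h - y| :=
    _root_.abs_sub_le _ _ _
  have a1 : 0 ≤ (biasProxy q K n x x₀ h : ℝ) := NNReal.coe_nonneg _
  have a2 : 0 ≤ (biasProxy q K n x x₀ hs : ℝ) := NNReal.coe_nonneg _
  -- The pair is read in `A` of the larger bandwidth, at the smaller one. In both cases the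
  -- remaining terms recombine into the criterion at `h` and the criterion at `hs`, and the latter
  -- is no larger.
  rcases le_total hs h with hle | hle
  · have h3 := abs_sub_le_biasProxy (K := K) (x := x) (x₀ := x₀) (h := h) hsel.1
    rw [majorantTwo, max_eq_left hle, abs_sub_comm] at h3
    linarith
  · have h3 := abs_sub_le_biasProxy (K := K) (x := x) (x₀ := x₀) (h := hs) hh
    rw [majorantTwo, max_eq_left hle] at h3
    linarith

/-- The bias proxy is controlled by the bias and the excess of the stochastic terms over the
majorants. -/
theorem biasProxy_le {h β ρ : ℝ} (hh : h ∈ grid q n) (m : ℝ → ℝ) (y : ℝ) (hβ : 0 ≤ β)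
    (hρ : 0 ≤ ρ) (hbias : ∀ h' ∈ grid q n, h' ≤ h → |m h' - y| ≤ β)
    (hexc : ∀ h' ∈ grid q n, |kernelEst K n x x₀ h' - m h'| - majorant q K n x x₀ h' ≤ ρ) :
    (biasProxy q K n x x₀ h : ℝ) ≤ 2 * β + 2 * ρ := by
  have hnn : 0 ≤ 2 * β + 2 * ρ := by positivity
  have key : biasProxy q K n x x₀ h ≤ (2 * β + 2 * ρ).toNNReal := by
    refine Finset.sup_le fun h' hh' => Real.toNNReal_le_toNNReal ?_
    unfold majorantTwo
    -- For `h' ≥ h` the two estimators coincide. Hence only the biases at bandwidths below `h` enter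
    -- the oracle bound.
    rcases le_total h h' with hle | hle
    · rw [max_eq_right hle, sub_self, abs_zero]
      linarith [majorant_nonneg (q := q) (K := K) (n := n) (x := x) (x₀ := x₀) h']
    · rw [max_eq_left hle]
      have e1 := hbias h' hh' hle
      have e2 := hbias h hh le_rfl
      have e3 := hexc h' hh'
      have e4 := hexc h hh
      have e5 : |kernelEst K n x x₀ h - kernelEst K n x x₀ h'| ≤
          |kernelEst K n x x₀ h - m h| + |m h - y| + |m h' - y| +
            |kernelEst K n x x₀ h' - m h'| := by
        have f1 := abs_sub_le (kernelEst K n x x₀ h) (m h) (kernelEst K n x x₀ h')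
        have f2 := abs_sub_le (m h) y (kernelEst K n x x₀ h')
        have f3 := abs_sub_le y (m h') (kernelEst K n x x₀ h')
        rw [abs_sub_comm y (m h'), abs_sub_comm (m h') (kernelEst K n x x₀ h')] at f3
        linarith
      linarith
  have := NNReal.coe_le_coe.mpr key
  rwa [Real.coe_toNNReal _ hnn] at this

theorem add_rpow_le {x y q : ℝ} (hx : 0 ≤ x) (hy : 0 ≤ y) (hq : 0 < q) :
    (x + y) ^ q ≤ 2 ^ q * (x ^ q + y ^ q) := by
  have h1 : x + y ≤ 2 * max x y := by linarith [le_max_left x y, le_max_right x y]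
  have h2 : (x + y) ^ q ≤ 2 ^ q * (max x y) ^ q := by
    rw [← Real.mul_rpow (by norm_num) (le_max_of_le_left hx)]
    exact Real.rpow_le_rpow (by positivity) h1 hq.le
  refine h2.trans (mul_le_mul_of_nonneg_left ?_ (by positivity))
  rcases max_cases x y with ⟨h, _⟩ | ⟨h, _⟩ <;> rw [h]
  · linarith [Real.rpow_nonneg hy q]
  · linarith [Real.rpow_nonneg hx q]

theorem abs_bias_le_maxBias_rpow (hq : 0 < q) {f : ℝ → ℝ} {h h' : ℝ} (hh' : h' ∈ grid q n)
    (hle : h' ≤ h) : |smoothed K f h' x₀ - f x₀| ≤ (maxBias q K f n x₀ h : ℝ) ^ (1 / q) := by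
  have h1 : ‖smoothed K f h' x₀ - f x₀‖₊ ^ q ≤ maxBias q K f n x₀ h :=
    Finset.le_sup (f := fun h' => ‖smoothed K f h' x₀ - f x₀‖₊ ^ q)
      (Finset.mem_filter.mpr ⟨hh', hle⟩)
  have h2 : |smoothed K f h' x₀ - f x₀| ^ q ≤ (maxBias q K f n x₀ h : ℝ) := by
    have := NNReal.coe_le_coe.mpr h1
    simpa using this
  calc _ = (|smoothed K f h' x₀ - f x₀| ^ q) ^ (1 / q) := by
        rw [← Real.rpow_mul (abs_nonneg _), mul_one_div_cancel hq.ne', Real.rpow_one]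
    _ ≤ _ := Real.rpow_le_rpow (by positivity) h2 (by positivity)

/-- Pathwise oracle inequality. -/
theorem IsSelected.abs_sub_rpow_le (hq : 0 < q) {f : ℝ → ℝ} {h hs : ℝ}
    (hsel : IsSelected q K n x x₀ hs) (hh : h ∈ grid q n) :
    |kernelEst K n x x₀ hs - f x₀| ^ q ≤ 20 ^ q * (maxBias q K f n x₀ h +
      ((∑ h' ∈ grid q n, (max (|kernelEst K n x x₀ h' - smoothed K f h' x₀| -
        majorant q K n x x₀ h') 0) ^ q) + majorant q K n x x₀ h ^ q)) := by
  set η : ℝ → ℝ := fun h' => max (|kernelEst K n x x₀ h' - smoothed K f h' x₀| -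
        majorant q K n x x₀ h') 0
  have hη : ∀ h', 0 ≤ η h' := fun h' => le_max_right _ _
  -- The maximal excess is replaced by the `q`-th root of a sum, whose expectation can be taken term
  -- by term.
  set R := ∑ h' ∈ grid q n, η h' ^ q
  have hR : 0 ≤ R := Finset.sum_nonneg fun h' _ => Real.rpow_nonneg (hη h') q
  set β := (maxBias q K f n x₀ h : ℝ) ^ (1 / q)
  have hβ : 0 ≤ β := by positivity
  have hρ : 0 ≤ R ^ (1 / q) := by positivity
  have hηR : ∀ h' ∈ grid q n, η h' ≤ R ^ (1 / q) := by
    intro h' hh'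
    calc η h' = (η h' ^ q) ^ (1 / q) := by
          rw [← Real.rpow_mul (hη h'), mul_one_div_cancel hq.ne', Real.rpow_one]
      _ ≤ _ := Real.rpow_le_rpow (Real.rpow_nonneg (hη h') q)
          (Finset.single_le_sum (f := fun h' => η h' ^ q)
            (fun h' _ => Real.rpow_nonneg (hη h') q) hh') (by positivity)
  have h1 := hsel.abs_sub_le hh (f x₀)
  have h2 := biasProxy_le (K := K) (x := x) (x₀ := x₀) hh (fun h' => smoothed K f h' x₀) (f x₀) hβ
    hρ (fun h' hh' hle => abs_bias_le_maxBias_rpow hq hh' hle)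
    fun h' hh' => (le_max_left _ _).trans (hηR h' hh')
  have h3 : |kernelEst K n x x₀ h - f x₀| ≤ R ^ (1 / q) + majorant q K n x x₀ h + β := by
    have f1 := _root_.abs_sub_le (kernelEst K n x x₀ h) (smoothed K f h x₀) (f x₀)
    have f2 := abs_bias_le_maxBias_rpow (K := K) (x₀ := x₀) hq (f := f) hh le_rfl
    have f3 := (le_max_left (|kernelEst K n x x₀ h - smoothed K f h x₀| -
      majorant q K n x x₀ h) 0).trans (hηR h hh)
    linarith
  have hM := majorant_nonneg (q := q) (K := K) (n := n) (x := x) (x₀ := x₀) h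
  -- Collecting the bounds gives `5β + 5R^(1/q) + 3M̂`. Two applications of `add_rpow_le` then turn
  -- `5^q` into `20^q`.
  have h4 : |kernelEst K n x x₀ hs - f x₀| ≤
      5 * (β + (R ^ (1 / q) + majorant q K n x x₀ h)) := by linarith
  have g1 : β ^ q = maxBias q K f n x₀ h := by
    rw [← Real.rpow_mul (NNReal.coe_nonneg _), one_div_mul_cancel hq.ne', Real.rpow_one]
  have g2 : (R ^ (1 / q)) ^ q = R := by
    rw [← Real.rpow_mul hR, one_div_mul_cancel hq.ne', Real.rpow_one]
  have h5 := add_rpow_le hβ (add_nonneg hρ hM) hq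
  have h6 := add_rpow_le hρ hM hq
  rw [g1] at h5
  rw [g2] at h6
  have one2 : (1 : ℝ) ≤ 2 ^ q := Real.one_le_rpow (by norm_num) hq.le
  have hMq : 0 ≤ majorant q K n x x₀ h ^ q := Real.rpow_nonneg hM q
  calc _ ≤ (5 * (β + (R ^ (1 / q) + majorant q K n x x₀ h))) ^ q :=
        Real.rpow_le_rpow (abs_nonneg _) h4 hq.le
    _ = 5 ^ q * (β + (R ^ (1 / q) + majorant q K n x x₀ h)) ^ q :=
        Real.mul_rpow (by norm_num) (by positivity)
    _ ≤ 5 ^ q * (2 ^ q * (maxBias q K f n x₀ h +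
          2 ^ q * (R + majorant q K n x x₀ h ^ q))) := by
        refine mul_le_mul_of_nonneg_left (h5.trans ?_) (by positivity)
        gcongr
    _ ≤ 5 ^ q * (2 ^ q * (2 ^ q * maxBias q K f n x₀ h +
          2 ^ q * (R + majorant q K n x x₀ h ^ q))) := by
        gcongr
        exact le_mul_of_one_le_left (NNReal.coe_nonneg _) one2
    _ = (5 * (2 * 2)) ^ q * (maxBias q K f n x₀ h + (R + majorant q K n x x₀ h ^ q)) := by
        rw [Real.mul_rpow (by norm_num) (by norm_num), Real.mul_rpow (by norm_num) (by norm_num)]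
        ring
    _ = _ := by norm_num

end Selection

/-! ### From moments to excesses over a threshold -/

theorem sqrt_add_le {x y : ℝ} (hx : 0 ≤ x) (hy : 0 ≤ y) :
    Real.sqrt (x + y) ≤ Real.sqrt x + Real.sqrt y := by
  rw [Real.sqrt_le_left (by positivity)]
  nlinarith [Real.sq_sqrt hx, Real.sq_sqrt hy, mul_nonneg (Real.sqrt_nonneg x) (Real.sqrt_nonneg y)]

/-- Markov's inequality for an excess: above the threshold, `|y|^{q-2p} ≤ M^{q-2p}` since the
exponent is not positive. -/
theorem max_sub_rpow_le {y M q : ℝ} {p : ℕ} (hM : 0 < M) (hq : 0 < q)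
    (hqp : q ≤ 2 * p) : (max (|y| - M) 0) ^ q ≤ y ^ (2 * p) * M ^ (q - 2 * p) := by
  have hev : y ^ (2 * p) = |y| ^ (2 * p) := ((even_two_mul p).pow_abs y).symm
  rcases le_total |y| M with h | h
  · rw [max_eq_right (by linarith), Real.zero_rpow hq.ne', hev]
    positivity
  · have hy : 0 < |y| := hM.trans_le h
    rw [max_eq_left (by linarith), hev]
    calc (|y| - M) ^ q ≤ |y| ^ q := Real.rpow_le_rpow (by linarith) (by linarith) hq.le
      _ = |y| ^ (2 * p) * |y| ^ (q - 2 * p) := by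
          rw [← Real.rpow_natCast, ← Real.rpow_add hy]; congr 1; push_cast; ring
      _ ≤ _ := mul_le_mul_of_nonneg_left
          (Real.rpow_le_rpow_of_nonpos hM h (by linarith)) (by positivity)

section

variable {Ω : Type*} [MeasurableSpace Ω] {P : Measure Ω} [IsProbabilityMeasure P]

theorem integrable_max_sub_rpow {S T : Ω → ℝ} (hS : Measurable S) (hT : Measurable T) {c q : ℝ}
    (hq : 0 < q) (hSc : ∀ ω, |S ω| ≤ c) (hT0 : ∀ ω, 0 ≤ T ω) :
    Integrable (fun ω => (max (|S ω| - T ω) 0) ^ q) P := by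
  refine integrable_of_abs_le (((hS.abs.sub hT).max measurable_const).pow_const q) (c := c ^ q)
    fun ω => ?_
  have h0 : 0 ≤ max (|S ω| - T ω) 0 := le_max_right _ _
  rw [abs_of_nonneg (Real.rpow_nonneg h0 q)]
  refine Real.rpow_le_rpow h0 (max_le ?_ ((abs_nonneg _).trans (hSc ω))) hq.le
  linarith [hSc ω, hT0 ω]

/-- A Gaussian-type moment bound controls the excess over a deterministic threshold. -/
theorem integral_max_sub_rpow_le {S : Ω → ℝ} (hS : Measurable S) {c q l W : ℝ} {p : ℕ}
    (hSc : ∀ ω, |S ω| ≤ c) (hq : 0 < q) (hl : 0 < l) (hW : 0 < W)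
    (hpl : (p : ℝ) ≤ 3 / 4 * (q * l)) (hqp : q ≤ 2 * p)
    (hmom : ∫ ω, S ω ^ (2 * p) ∂P ≤ 14 * (200 / 81 * (p * W) / Real.exp 1) ^ p) :
    ∫ ω, (max (|S ω| - Real.sqrt (2 * q * l * W)) 0) ^ q ∂P ≤
      14 * (2 * q * l * W) ^ (q / 2) * Real.exp (-p) := by
  have hA : 0 < 2 * q * l * W := by positivity
  set M := Real.sqrt (2 * q * l * W)
  have hM : 0 < M := Real.sqrt_pos.mpr hA
  have hMq : M ^ (q - 2 * p) = (2 * q * l * W) ^ (q / 2) * ((2 * q * l * W) ^ p)⁻¹ := by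
    rw [Real.rpow_sub hM, div_eq_mul_inv]
    congr 1
    · simp only [M]
      rw [Real.sqrt_eq_rpow, ← Real.rpow_mul hA.le]; congr 1; ring
    · congr 1
      rw [show (2 * (p : ℝ)) = ((2 * p : ℕ) : ℝ) by push_cast; ring, Real.rpow_natCast, pow_mul,
        Real.sq_sqrt hA.le]
  have iS : Integrable (fun ω => S ω ^ (2 * p)) P := by
    refine integrable_of_abs_le (hS.pow_const _) (c := c ^ (2 * p)) fun ω => ?_
    rw [abs_pow]; exact pow_le_pow_left₀ (abs_nonneg _) (hSc ω) _
  calc _ ≤ ∫ ω, S ω ^ (2 * p) * M ^ (q - 2 * p) ∂P :=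
        integral_mono (integrable_max_sub_rpow hS measurable_const hq hSc fun _ => hM.le)
          (iS.mul_const _) fun ω => max_sub_rpow_le hM hq hqp
    _ = (∫ ω, S ω ^ (2 * p) ∂P) * M ^ (q - 2 * p) := integral_mul_const _ _
    _ ≤ 14 * (200 / 81 * (p * W) / Real.exp 1) ^ p * M ^ (q - 2 * p) := by
        gcongr
    _ = 14 * (2 * q * l * W) ^ (q / 2) *
          (200 / 81 * (p * W) / Real.exp 1 / (2 * q * l * W)) ^ p := by
        rw [hMq, div_pow _ (2 * q * l * W)]; ring
    _ ≤ 14 * (2 * q * l * W) ^ (q / 2) * Real.exp (-1) ^ p := by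
        gcongr
        -- The numerical margin: `200/81 · 3/4 < 2`.
        rw [div_le_iff₀ hA, Real.exp_neg, div_eq_mul_inv, mul_comm _ (Real.exp 1)⁻¹]
        refine mul_le_mul_of_nonneg_left ?_ (by positivity)
        have e1 : (p : ℝ) * W ≤ 3 / 4 * (q * l) * W := mul_le_mul_of_nonneg_right hpl hW.le
        have e2 : 0 < q * l * W := by positivity
        nlinarith
    _ = _ := by rw [← Real.exp_nat_mul]; congr 2; ring

theorem measureReal_abs_ge_le {S : Ω → ℝ} (hS : Measurable S) {c y : ℝ} (hSc : ∀ ω, |S ω| ≤ c)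
    (hy : 0 < y) (p : ℕ) : P.real {ω | y < |S ω|} ≤ (∫ ω, S ω ^ (2 * p) ∂P) / y ^ (2 * p) := by
  have iS : Integrable (fun ω => S ω ^ (2 * p)) P := by
    refine integrable_of_abs_le (hS.pow_const _) (c := c ^ (2 * p)) fun ω => ?_
    rw [abs_pow]; exact pow_le_pow_left₀ (abs_nonneg _) (hSc ω) _
  have h1 := mul_meas_ge_le_integral_of_nonneg (μ := P)
    (Filter.Eventually.of_forall fun ω => (even_two_mul p).pow_nonneg (S ω)) iS (y ^ (2 * p))
  rw [le_div_iff₀ (by positivity), mul_comm]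
  refine le_trans (mul_le_mul_of_nonneg_left (measureReal_mono fun ω hω => ?_) (by positivity)) h1
  rw [Set.mem_ofPred_eq] at hω ⊢
  rw [← (even_two_mul p).pow_abs (S ω)]
  exact pow_le_pow_left₀ hy.le hω.le _

/-- Passing from a deterministic to an empirical threshold. -/
theorem integral_max_sub_sqrt_rpow_le {S U : Ω → ℝ} (hS : Measurable S) (hU : Measurable U)
    {c q A V d e π : ℝ} (hSc : ∀ ω, |S ω| ≤ c) (hU0 : ∀ ω, 0 ≤ U ω) (hq : 0 < q) (hA : 0 ≤ A)
    (hd : 0 ≤ d) (he : 0 ≤ e) (hbad : P.real {ω | d / 2 < |U ω - V|} ≤ π) :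
    ∫ ω, (max (|S ω| - Real.sqrt (A * (U ω + d))) 0) ^ q ∂P ≤
      2 ^ q * ((∫ ω, (max (|S ω| - Real.sqrt (A * (V + d / 2 + e))) 0) ^ q ∂P) +
        (A * e) ^ (q / 2)) + c ^ q * π := by
  have hc0 : 0 ≤ c := by
    obtain ⟨ω⟩ := P.nonempty_of_neZero
    exact (abs_nonneg _).trans (hSc ω)
  have hms : MeasurableSet {ω | d / 2 < |U ω - V|} :=
    measurableSet_lt measurable_const (hU.sub_const V).abs
  have hpt : ∀ ω, (max (|S ω| - Real.sqrt (A * (U ω + d))) 0) ^ q ≤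
      2 ^ q * ((max (|S ω| - Real.sqrt (A * (V + d / 2 + e))) 0) ^ q + (A * e) ^ (q / 2)) +
        {ω | d / 2 < |U ω - V|}.indicator (fun _ => c ^ q) ω := by
    intro ω
    have hm0 : 0 ≤ max (|S ω| - Real.sqrt (A * (V + d / 2 + e))) 0 := le_max_right _ _
    by_cases hω : d / 2 < |U ω - V|
    · rw [Set.indicator_of_mem (by exact hω)]
      have h1 : (max (|S ω| - Real.sqrt (A * (U ω + d))) 0) ^ q ≤ c ^ q := by
        refine Real.rpow_le_rpow (le_max_right _ _) (max_le ?_ hc0) hq.le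
        linarith [hSc ω, Real.sqrt_nonneg (A * (U ω + d))]
      have h2 : 0 ≤ 2 ^ q * ((max (|S ω| - Real.sqrt (A * (V + d / 2 + e))) 0) ^ q +
        (A * e) ^ (q / 2)) := by positivity
      linarith
    · rw [Set.indicator_of_notMem (by exact hω), add_zero]
      have hω' := abs_le.mp (not_lt.mp hω)
      -- Off the bad event `V + d/2 ≤ U + d`, so the empirical threshold dominates the deterministic
      -- one except for `e`, paid separately by subadditivity of the square root.
      have h1 : Real.sqrt (A * (V + d / 2 + e)) ≤
          Real.sqrt (A * (U ω + d)) + Real.sqrt (A * e) := by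
        refine (Real.sqrt_le_sqrt ?_).trans
          (sqrt_add_le (mul_nonneg hA (add_nonneg (hU0 ω) hd)) (mul_nonneg hA he))
        rw [← mul_add]
        exact mul_le_mul_of_nonneg_left (by linarith [hω'.1]) hA
      have h2 : max (|S ω| - Real.sqrt (A * (U ω + d))) 0 ≤
          max (|S ω| - Real.sqrt (A * (V + d / 2 + e))) 0 + Real.sqrt (A * e) := by
        refine max_le ?_ (by positivity)
        linarith [le_max_left (|S ω| - Real.sqrt (A * (V + d / 2 + e))) 0]
      have h3 : Real.sqrt (A * e) ^ q = (A * e) ^ (q / 2) := by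
        rw [Real.sqrt_eq_rpow, ← Real.rpow_mul (by positivity)]; congr 1; ring
      rw [← h3]
      exact (Real.rpow_le_rpow (le_max_right _ _) h2 hq.le).trans
        (add_rpow_le hm0 (Real.sqrt_nonneg _) hq)
  have i1 : Integrable (fun ω => (max (|S ω| - Real.sqrt (A * (V + d / 2 + e))) 0) ^ q) P :=
    integrable_max_sub_rpow hS measurable_const hq hSc fun _ => Real.sqrt_nonneg _
  have i2 : Integrable (fun ω => 2 ^ q * ((max (|S ω| - Real.sqrt (A * (V + d / 2 + e))) 0) ^ q +
      (A * e) ^ (q / 2))) P := (i1.add (integrable_const _)).const_mul _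
  have i3 : Integrable ({ω | d / 2 < |U ω - V|}.indicator fun _ => c ^ q) P :=
    (integrable_const _).indicator hms
  refine (integral_mono (integrable_max_sub_rpow hS
    (Real.continuous_sqrt.measurable.comp ((hU.add_const d).const_mul A)) hq hSc
    fun _ => Real.sqrt_nonneg _) (i2.add i3) hpt).trans ?_
  simp only [Pi.add_apply]
  rw [integral_add i2 i3, integral_const_mul, integral_add i1 (integrable_const _),
    integral_indicator_const _ hms]
  simp only [integral_const, probReal_univ, smul_eq_mul, one_mul]
  have : P.real {ω | d / 2 < |U ω - V|} * c ^ q ≤ c ^ q * π := by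
    rw [mul_comm]; exact mul_le_mul_of_nonneg_left hbad (by positivity)
  linarith

/-- Off the bad event `U + d` is at most `V + 3d/2`; on it the worst-case bound `c` is weighted by
the small probability. -/
theorem integral_sqrt_rpow_le {U : Ω → ℝ} (hU : Measurable U) {c q A V d π : ℝ}
    (hU0 : ∀ ω, 0 ≤ U ω) (hUc : ∀ ω, U ω ≤ c) (hV : 0 ≤ V) (hq : 0 < q) (hA : 0 ≤ A) (hd : 0 ≤ d)
    (hbad : P.real {ω | d / 2 < |U ω - V|} ≤ π) :
    ∫ ω, Real.sqrt (A * (U ω + d)) ^ q ∂P ≤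
      (A * (V + 2 * d)) ^ (q / 2) + (A * (c + d)) ^ (q / 2) * π := by
  have hc0 : 0 ≤ c := by
    obtain ⟨ω⟩ := P.nonempty_of_neZero
    exact (hU0 ω).trans (hUc ω)
  have hms : MeasurableSet {ω | d / 2 < |U ω - V|} :=
    measurableSet_lt measurable_const (hU.sub_const V).abs
  have hsq : ∀ ω, Real.sqrt (A * (U ω + d)) ^ q = (A * (U ω + d)) ^ (q / 2) := fun ω => by
    have := hU0 ω
    rw [Real.sqrt_eq_rpow, ← Real.rpow_mul (by positivity)]; congr 1; ring
  have hle : ∀ ω, (A * (U ω + d)) ^ (q / 2) ≤ (A * (c + d)) ^ (q / 2) := fun ω => by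
    have := hU0 ω
    have := hUc ω
    gcongr
  have hpt : ∀ ω, Real.sqrt (A * (U ω + d)) ^ q ≤ (A * (V + 2 * d)) ^ (q / 2) +
      {ω | d / 2 < |U ω - V|}.indicator (fun _ => (A * (c + d)) ^ (q / 2)) ω := by
    intro ω
    rw [hsq]
    have h0 := hU0 ω
    by_cases hω : d / 2 < |U ω - V|
    · rw [Set.indicator_of_mem (by exact hω)]
      have h2 : 0 ≤ (A * (V + 2 * d)) ^ (q / 2) := by positivity
      linarith [hle ω]
    · rw [Set.indicator_of_notMem (by exact hω), add_zero]
      have hω' := abs_le.mp (not_lt.mp hω)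
      refine Real.rpow_le_rpow (by positivity) (mul_le_mul_of_nonneg_left ?_ hA) (by positivity)
      linarith [hω'.2]
  have i1 : Integrable (fun ω => Real.sqrt (A * (U ω + d)) ^ q) P := by
    refine integrable_of_abs_le ((Real.continuous_sqrt.measurable.comp
      ((hU.add_const d).const_mul A)).pow_const q) (c := (A * (c + d)) ^ (q / 2)) fun ω => ?_
    rw [abs_of_nonneg (by positivity), hsq]
    exact hle ω
  have i3 : Integrable ({ω | d / 2 < |U ω - V|}.indicator fun _ => (A * (c + d)) ^ (q / 2)) P :=
    (integrable_const _).indicator hms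
  refine (integral_mono i1 ((integrable_const _).add i3) hpt).trans ?_
  simp only [Pi.add_apply]
  rw [integral_add (integrable_const _) i3, integral_indicator_const _ hms]
  simp only [integral_const, probReal_univ, smul_eq_mul, one_mul]
  have : P.real {ω | d / 2 < |U ω - V|} * (A * (c + d)) ^ (q / 2) ≤
      (A * (c + d)) ^ (q / 2) * π := by
    rw [mul_comm]; exact mul_le_mul_of_nonneg_left hbad (by positivity)
  linarith

end

/-! ### Growth conditions in `log n` -/

-- On the grid `n h` is at least `exp √(log n)`; this is what beats the powers of `log n` coming
-- from block lengths and moment orders.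
open Filter in
theorem eventually_rpow_le_exp_sqrt (C s : ℝ) {ε : ℝ} (hε : 0 < ε) :
    ∀ᶠ L : ℝ in atTop, C * L ^ s ≤ ε * Real.exp (Real.sqrt L) := by
  have h1 : (fun L : ℝ => L ^ s) =o[atTop] fun L => Real.exp (Real.sqrt L) := by
    have h2 := (isLittleO_rpow_exp_atTop (2 * s)).comp_tendsto Real.tendsto_sqrt_atTop
    refine h2.congr' ?_ (Eventually.of_forall fun _ => rfl)
    filter_upwards [eventually_ge_atTop 0] with L hL
    simp only [Function.comp]
    rw [Real.sqrt_eq_rpow, ← Real.rpow_mul hL]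
    congr 1; ring
  have h3 := h1.bound (c := ε / (|C| + 1)) (by positivity)
  filter_upwards [h3, eventually_ge_atTop 0] with L hL hL0
  rw [Real.norm_of_nonneg (Real.rpow_nonneg hL0 s), Real.norm_of_nonneg (Real.exp_pos _).le] at hL
  have h4 : C * L ^ s ≤ (|C| + 1) * L ^ s :=
    mul_le_mul_of_nonneg_right (by linarith [le_abs_self C]) (Real.rpow_nonneg hL0 s)
  refine h4.trans ((mul_le_mul_of_nonneg_left hL (by positivity)).trans_eq ?_)
  field_simp

/-- The gap between the blocks, as a function of `log n`. -/
noncomputable def gapLength (b : ℝ) (n : ℕ) : ℕ := ⌈Real.log n ^ (3 / b)⌉₊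

theorem gapLength_bounds {b : ℝ} (hb : 0 < b) {n : ℕ} (hL : 1 ≤ Real.log n) :
    1 ≤ gapLength b n ∧ (gapLength b n : ℝ) ≤ 2 * Real.log n ^ (3 / b) ∧
      Real.log n ^ 3 ≤ (gapLength b n : ℝ) ^ b := by
  have h1 : 1 ≤ Real.log n ^ (3 / b) := Real.one_le_rpow hL (by positivity)
  refine ⟨Nat.one_le_ceil_iff.mpr (by linarith), ?_, ?_⟩
  · exact (Nat.ceil_lt_add_one (by linarith)).le.trans (by linarith)
  · calc Real.log n ^ 3 = (Real.log n ^ (3 / b)) ^ b := by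
          rw [← Real.rpow_mul (by linarith), div_mul_cancel₀ _ hb.ne']; norm_cast
      _ ≤ _ := Real.rpow_le_rpow (by linarith) (Nat.le_ceil _) hb.le

/-- With `L = log n` and `m` of order `L`, the number of monomials is `exp(O(L^2))`, whereas gaps
with `r^b ≥ L^3` give a mixing rate `exp(-a L^3)`. The condition `hLD` makes the cubic term win. -/
theorem decouplingError_le_one {a b c lam D : ℝ} (ha : 0 < a) (hb : 0 < b) (hc : 0 < c)
    (hlam : 0 ≤ lam) {n m : ℕ} (hL : 1 ≤ Real.log n) (hn : 0 < n)
    (hLD : (|Real.log (8 * c * (1 + lam) ^ 2)| + 10 * D + 3) / a ≤ Real.log n)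
    (hm : (m : ℝ) ≤ 2 * D * Real.log n) {h : ℝ} (hh : (n : ℝ)⁻¹ ≤ h) :
    decouplingError a b c h lam n (gapLength b n) m ≤ 1 := by
  have hn' : (1 : ℝ) ≤ n := by exact_mod_cast hn
  have hn0 : (0 : ℝ) < n := by linarith
  set L := Real.log n
  have hnL : (n : ℝ) = Real.exp L := (Real.exp_log hn0).symm
  obtain ⟨-, -, hr⟩ := gapLength_bounds hb hL
  have hD0 : 0 ≤ 2 * D * L := (Nat.cast_nonneg m).trans hm
  have e1 : (n : ℝ) ^ m ≤ Real.exp (2 * D * L * L) := by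
    rw [hnL, ← Real.exp_nat_mul]
    exact Real.exp_le_exp.mpr (mul_le_mul_of_nonneg_right hm (by linarith))
  have e2 : ((n + 1 : ℕ) : ℝ) ≤ 2 * Real.exp L := by rw [← hnL]; push_cast; linarith
  have e3 : (4 : ℝ) ^ m ≤ Real.exp (4 * D * L) := by
    have h4 : (4 : ℝ) ≤ Real.exp 2 := by
      have := Real.exp_one_gt_d9
      have h5 : Real.exp 2 = Real.exp 1 * Real.exp 1 := by rw [← Real.exp_add]; norm_num
      rw [h5]; nlinarith
    calc (4 : ℝ) ^ m ≤ Real.exp 2 ^ m := pow_le_pow_left₀ (by norm_num) h4 m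
      _ = Real.exp (m * 2) := by rw [← Real.exp_nat_mul]
      _ ≤ _ := Real.exp_le_exp.mpr (by linarith)
  have e4 : 1 + (m : ℝ) ≤ Real.exp (2 * D * L) := by
    have := Real.add_one_le_exp (m : ℝ)
    linarith [Real.exp_le_exp.mpr hm]
  have e5 : 1 + lam / h ≤ (1 + lam) * Real.exp L := by
    rw [← hnL]
    have hh0 : 0 < h := lt_of_lt_of_le (inv_pos.mpr hn0) hh
    have : h⁻¹ ≤ n := inv_le_of_inv_le₀ hn0 hh
    rw [div_eq_mul_inv]
    nlinarith [mul_le_mul_of_nonneg_left this hlam]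
  have e6 : Real.exp (-a * (gapLength b n : ℝ) ^ b) ≤ Real.exp (-a * L ^ 3) :=
    Real.exp_le_exp.mpr (by nlinarith)
  have hh0 : 0 < h := lt_of_lt_of_le (inv_pos.mpr hn0) hh
  unfold decouplingError
  calc _ ≤ Real.exp (2 * D * L * L) * (2 * Real.exp L * (Real.exp (4 * D * L) *
        (c * Real.exp (-a * L ^ 3) * (4 * Real.exp (2 * D * L) * Real.exp (2 * D * L) *
          ((1 + lam) * Real.exp L) ^ 2)))) := by
        gcongr
    _ = 8 * c * (1 + lam) ^ 2 * (Real.exp (2 * D * L * L) * Real.exp L * Real.exp (4 * D * L) *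
          Real.exp (-a * L ^ 3) * Real.exp (2 * D * L) * Real.exp (2 * D * L) *
          (Real.exp L * Real.exp L)) := by ring
    _ = 8 * c * (1 + lam) ^ 2 *
          Real.exp (2 * D * L ^ 2 + 8 * D * L + 3 * L - a * L ^ 3) := by
        simp only [← Real.exp_add]
        congr 2; ring
    _ = Real.exp (Real.log (8 * c * (1 + lam) ^ 2) +
          (2 * D * L ^ 2 + 8 * D * L + 3 * L - a * L ^ 3)) := by
        rw [Real.exp_add, Real.exp_log (by positivity)]
    _ ≤ 1 := by
        rw [Real.exp_le_one_iff]
        have g1 := le_abs_self (Real.log (8 * c * (1 + lam) ^ 2))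
        have g2 : |Real.log (8 * c * (1 + lam) ^ 2)| + 10 * D + 3 ≤ a * L := by
          rw [div_le_iff₀ ha] at hLD; linarith
        have g0 : 0 ≤ D := by
          by_contra hneg; nlinarith
        have g3 := abs_nonneg (Real.log (8 * c * (1 + lam) ^ 2))
        have g4 : 1 ≤ L ^ 2 := one_le_pow₀ hL
        have g5 : L ≤ L ^ 2 := by nlinarith
        have g6 := mul_le_mul_of_nonneg_right g2 (sq_nonneg L)
        have g7 : |Real.log (8 * c * (1 + lam) ^ 2)| ≤
          |Real.log (8 * c * (1 + lam) ^ 2)| * L ^ 2 := le_mul_of_one_le_right g3 g4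
        have g8 : D * L ≤ D * L ^ 2 := mul_le_mul_of_nonneg_left g5 g0
        nlinarith

theorem abs_log_mul_rpow_le {h t : ℝ} (h0 : 0 < h) (h1 : h ≤ 1) (ht : 0 < t) :
    |Real.log h| * h ^ t ≤ 1 / t := by
  have := (Real.abs_log_mul_self_rpow_lt h t h0 h1 ht).le
  rwa [abs_mul, abs_of_nonneg (Real.rpow_nonneg h0.le t)] at this

/-- When `x ≥ y` the second term is `x (x/y)^τ ≥ x`. It trades the part of `x` above `y` for a
higher power of `x`. -/
theorem le_add_rpow_mul_rpow_neg {x y τ : ℝ} (hx : 0 ≤ x) (hy : 0 < y) (hτ : 0 ≤ τ) :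
    x ≤ y + x ^ (1 + τ) * y ^ (-τ) := by
  rcases le_total x y with h | h
  · have : 0 ≤ x ^ (1 + τ) * y ^ (-τ) := by positivity
    linarith
  · have hx' : 0 < x := hy.trans_le h
    have h1 : x ^ (1 + τ) * y ^ (-τ) = x * (x / y) ^ τ := by
      rw [Real.rpow_add hx', Real.rpow_one, Real.rpow_neg hy.le, Real.div_rpow hx hy.le,
        div_eq_mul_inv, mul_assoc]
    rw [h1]
    have h2 : 1 ≤ (x / y) ^ τ := Real.one_le_rpow ((one_le_div hy).mpr h) hτ
    have := le_mul_of_one_le_right hx h2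
    linarith

/-! ### Properties of the dyadic grid -/

section Grid

variable {q : ℝ} {n : ℕ} {h : ℝ}

theorem grid_pos (hn : 1 ≤ n) (hh : h ∈ grid q n) : 0 < h := by
  obtain ⟨⟨k, rfl⟩, -⟩ := (mem_grid hn).mp hh
  positivity

theorem grid_le_one (hn : 1 ≤ n) (hh : h ∈ grid q n) : h ≤ 1 := by
  obtain ⟨⟨k, rfl⟩, -⟩ := (mem_grid hn).mp hh
  exact inv_le_one_of_one_le₀ (one_le_pow₀ (by norm_num))

theorem exp_sqrt_le_of_mem_grid (hn : 1 ≤ n) (hh : h ∈ grid q n) :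
    Real.exp (Real.sqrt (Real.log n)) ≤ n * h := by
  have hn' : (0 : ℝ) < n := by exact_mod_cast hn
  have h1 := ((mem_grid hn).mp hh).2.1
  unfold hLower at h1
  rwa [inv_mul_le_iff₀ hn'] at h1

theorem inv_le_of_mem_grid (hn : 1 ≤ n) (hh : h ∈ grid q n) : (n : ℝ)⁻¹ ≤ h := by
  have hn' : (0 : ℝ) < n := by exact_mod_cast hn
  rw [inv_le_iff_one_le_mul₀ hn', mul_comm]
  exact (Real.one_le_exp (Real.sqrt_nonneg _)).trans (exp_sqrt_le_of_mem_grid hn hh)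

/-- The bandwidth `1` must be excluded, since the variance term of the oracle bound vanishes there.
-/
theorem log_two_le_of_mem_grid (hq : 0 < q) (hn : 2 ≤ n) (hh : h ∈ grid q n) :
    Real.log 2 ≤ |Real.log h| := by
  have hn1 : 1 ≤ n := by omega
  obtain ⟨⟨k, hk⟩, h1, h2⟩ := (mem_grid hn1).mp hh
  have hlt : h < 1 := by
    -- For `n ≥ 3` the upper edge is below one. For `n = 2` it is not, but `exp √(log 2) > 2`
    -- already puts the lower edge above one, so the grid is empty.
    rcases Nat.lt_or_ge n 3 with h3 | h3
    · obtain rfl : n = 2 := by omega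
      have h4 := exp_sqrt_le_of_mem_grid hn1 hh
      have h5 := grid_le_one hn1 hh
      have h8 := Real.log_two_gt_d9
      have h9 : Real.log 2 < Real.sqrt (Real.log (2 : ℕ)) := by
        rw [Real.lt_sqrt (by linarith)]
        have := Real.log_two_lt_d9
        push_cast
        nlinarith
      have h10 : (2 : ℝ) < Real.exp (Real.sqrt (Real.log (2 : ℕ))) := by
        calc (2 : ℝ) = Real.exp (Real.log 2) := (Real.exp_log (by norm_num)).symm
          _ < _ := Real.exp_lt_exp.mpr h9
      push_cast at h4 h10
      linarith
    · have h4 : 1 < Real.log n := by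
        rw [Real.lt_log_iff_exp_lt (by positivity)]
        have : (3 : ℝ) ≤ n := by exact_mod_cast h3
        linarith [Real.exp_one_lt_three]
      refine h2.trans_lt ?_
      unfold hUpper
      exact Real.rpow_lt_one_of_one_lt_of_neg h4 (div_neg_of_neg_of_pos (by norm_num) hq)
  have hk1 : 1 ≤ k := by
    by_contra h0
    obtain rfl : k = 0 := by omega
    simp at hk
    linarith
  rw [hk, Real.log_inv, abs_neg, Real.log_pow, abs_of_nonneg (by positivity)]
  have : (1 : ℝ) ≤ k := by exact_mod_cast hk1
  nlinarith [Real.log_pos (by norm_num : (1 : ℝ) < 2)]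

theorem abs_log_le_of_mem_grid (hn : 1 ≤ n) (hh : h ∈ grid q n) : |Real.log h| ≤ Real.log n := by
  have hn' : (0 : ℝ) < n := by exact_mod_cast hn
  have h0 := grid_pos hn hh
  rw [abs_of_nonpos (Real.log_nonpos h0.le (grid_le_one hn hh))]
  have := Real.log_le_log (inv_pos.mpr hn') (inv_le_of_mem_grid hn hh)
  rw [Real.log_inv] at this
  linarith

theorem log_rpow_le_inv_of_mem_grid (hL : 1 ≤ Real.log n) (hn : 1 ≤ n)
    (hh : h ∈ grid q n) : Real.log n ^ (1 / q) ≤ h⁻¹ := by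
  have h0 := grid_pos hn hh
  have h1 := ((mem_grid hn).mp hh).2.2
  unfold hUpper at h1
  rw [neg_div, Real.rpow_neg (by linarith)] at h1
  exact (le_inv_comm₀ (by positivity) h0).mpr h1

theorem Icc_subset_nbhd_of_mem_grid (hn : 1 ≤ n) (x₀ : ℝ) (hh : h ∈ grid q n) :
    Set.Icc (x₀ - h) (x₀ + h) ⊆ nbhd q n x₀ := by
  have h1 := ((mem_grid hn).mp hh).2.2
  have h2 : (1 / Real.log n) ^ (1 / q) = hUpper q n := by
    unfold hUpper
    rw [one_div (Real.log n), Real.inv_rpow (Real.log_natCast_nonneg n), neg_div,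
      Real.rpow_neg (Real.log_natCast_nonneg n)]
  unfold nbhd
  rw [h2]
  exact Set.Icc_subset_Icc (by linarith) (by linarith)

theorem card_grid_le : ((grid q n).card : ℝ) ≤ n + 1 := by
  have h1 : (grid q n).card ≤ n + 1 := by
    unfold grid
    exact (Finset.card_filter_le _ _).trans (Finset.card_image_le.trans (by simp))
  exact_mod_cast h1

/-- Dyadic bandwidths make this a geometric series, so no factor depending on the size of the grid
is lost. -/
theorem sum_grid_rpow_le {s : ℝ} (hs : 0 < s) :
    ∑ h ∈ grid q n, h ^ s ≤ (1 - (2 : ℝ)⁻¹ ^ s)⁻¹ := by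
  classical
  have hρ0 : 0 ≤ (2 : ℝ)⁻¹ ^ s := by positivity
  have hρ1 : (2 : ℝ)⁻¹ ^ s < 1 := Real.rpow_lt_one (by norm_num) (by norm_num) hs
  have h1 : ∑ h ∈ grid q n, h ^ s ≤
      ∑ h ∈ (Finset.range (n + 1)).image (fun k : ℕ => ((2 : ℝ) ^ k)⁻¹), h ^ s := by
    refine Finset.sum_le_sum_of_subset_of_nonneg (Finset.filter_subset _ _) fun h hh _ => ?_
    obtain ⟨k, -, rfl⟩ := Finset.mem_image.mp hh
    positivity
  refine h1.trans ?_
  rw [Finset.sum_image (fun x _ y _ hxy => by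
    have := inv_injective hxy
    exact Nat.pow_right_injective (le_refl 2) (by exact_mod_cast this))]
  have e : ∀ k : ℕ, (((2 : ℝ) ^ k)⁻¹) ^ s = ((2 : ℝ)⁻¹ ^ s) ^ k := fun k => by
    rw [← inv_pow, ← Real.rpow_natCast, ← Real.rpow_mul (by norm_num), mul_comm,
      Real.rpow_mul (by norm_num), Real.rpow_natCast]
  simp_rw [e]
  rw [← tsum_geometric_of_lt_one hρ0 hρ1]
  exact (summable_geometric_of_lt_one hρ0 hρ1).sum_le_tsum _ fun _ _ => by positivity

end Grid

/-! ### Concentration of the empirical variance -/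

/-- The constant in front of the covariance remainder. -/
noncomputable def remConst (a b c B C lam θ : ℝ) : ℝ := covConst c B C lam θ * lagSum a b θ

theorem remConst_nonneg {a b c B C lam θ : ℝ} (hc : 0 < c) (hC : 0 < C) (hlam : 0 ≤ lam) :
    0 ≤ remConst a b c B C lam θ := by
  unfold remConst covConst lagSum
  have : 0 ≤ ∑' k : ℤ, Real.exp (-(a * θ) * |(k : ℝ)| ^ b) :=
    tsum_nonneg fun _ => (Real.exp_pos _).le
  positivity

/-- The exponent `7/2 + 6/b` collects `3` from `p^3`, `6/b` from the squared gap and `1/2` from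
`δ_n`. -/
theorem gap_conditions {b D Y c₀ : ℝ} (hb : 0 < b) {n : ℕ} (hL : 1 ≤ Real.log n) (hn : 0 < n)
    (hgap : 400 * Real.log n ^ (3 / b) ≤ Real.exp (Real.sqrt (Real.log n)))
    (hD : 0 ≤ D)
    (hgap2 : 32000000 * D ^ 3 * Real.log n ^ (7 / 2 + 6 / b) ≤
      c₀ * Real.exp (Real.sqrt (Real.log n)))
    (hY : Real.exp (Real.sqrt (Real.log n)) ≤ Y) (hc₀ : 0 ≤ c₀)
    {p : ℕ} (hp : (p : ℝ) ≤ D * Real.log n) :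
    200 * gapLength b n ≤ n ∧
      8000000 * (p : ℝ) ^ 3 * (gapLength b n : ℝ) ^ 2 ≤ c₀ * Real.log n ^ (-(1 / 2) : ℝ) * Y := by
  have hn0 : (0 : ℝ) < n := by exact_mod_cast hn
  obtain ⟨-, hr, -⟩ := gapLength_bounds hb hL
  set L := Real.log n
  have hL0 : 0 < L := by linarith
  constructor
  · have h1 : Real.exp (Real.sqrt L) ≤ n := by
      rw [← Real.exp_log hn0]
      refine Real.exp_le_exp.mpr ?_
      rw [Real.sqrt_le_left hL0.le]
      nlinarith
    have : (200 * gapLength b n : ℝ) ≤ n := by linarith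
    exact_mod_cast this
  · calc 8000000 * (p : ℝ) ^ 3 * (gapLength b n : ℝ) ^ 2
        ≤ 8000000 * (D * L) ^ 3 * (2 * L ^ (3 / b)) ^ 2 := by gcongr
      _ = 32000000 * D ^ 3 * L ^ (7 / 2 + 6 / b) * L ^ (-(1 / 2) : ℝ) := by
          have e1 : L ^ (7 / 2 + 6 / b) * L ^ (-(1 / 2) : ℝ) = L ^ 3 * (L ^ (3 / b)) ^ 2 := by
            rw [← Real.rpow_natCast, ← Real.rpow_natCast, ← Real.rpow_mul hL0.le,
              ← Real.rpow_add hL0, ← Real.rpow_add hL0]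
            congr 1; push_cast; ring
          rw [mul_assoc _ (L ^ (7 / 2 + 6 / b)), e1]; ring
      _ ≤ c₀ * Real.exp (Real.sqrt L) * L ^ (-(1 / 2) : ℝ) := by gcongr
      _ ≤ c₀ * Y * L ^ (-(1 / 2) : ℝ) := by gcongr
      _ = _ := by ring

section

variable {Ω : Type*} [MeasurableSpace Ω] {P : Measure Ω} [IsProbabilityMeasure P]
  {X : ℤ → Ω → ℝ} {f φ : ℝ → ℝ} {V : Set ℝ} {a b c B C x₀ h lam θ : ℝ}

/-- The empirical sum of squares is close to its expectation with high probability. -/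
theorem IsModel.measureReal_sum_sq_le (hM : IsModel P X f V a b c B C) (ha : 0 < a) (hb : 0 < b)
    (hB : 0 < B) (hc : 0 < c) (hC : 0 < C) (hφ : IsWindow φ V x₀ h lam) (hθ0 : 0 < θ)
    (hθ1 : θ ≤ 1 / 4) {n : ℕ} (hL : 1 ≤ Real.log n) (hn : 0 < n) {q κ : ℝ} (hκ : 1 ≤ κ)
    (hq : 0 < q) (hY : Real.exp (Real.sqrt (Real.log n)) ≤ n * h) (hnh : (n : ℝ)⁻¹ ≤ h)
    (hgap : 400 * Real.log n ^ (3 / b) ≤ Real.exp (Real.sqrt (Real.log n)))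
    (hgap2 : 32000000 * 2 ^ 3 * Real.log n ^ (7 / 2 + 6 / b) ≤
      B * Real.exp (Real.sqrt (Real.log n)))
    (hLD : (|Real.log (8 * c * (1 + lam) ^ 2)| + 10 * 2 + 3) / a ≤ Real.log n)
    (hbad : 320 * κ ^ 4 * (B + remConst a b c B C lam θ) * Real.log n ^ (2 : ℝ) ≤
      Real.exp (-(2 * q + 4)) * Real.exp (Real.sqrt (Real.log n))) :
    P.real {ω | delta n / (4 * κ ^ 2) * (n * h) / 2 <
      |∑ i ∈ Finset.Icc (1 : ℤ) n, φ (X i ω) ^ 2 - n * ∫ x, φ x ^ 2 * f x|} ≤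
      (n : ℝ) ^ (-(2 * q + 1)) := by
  have hn0 : (0 : ℝ) < n := by exact_mod_cast hn
  have hh := hφ.scale_pos
  have hlam := hφ.lam_nonneg
  have hR := remConst_nonneg (a := a) (b := b) (c := c) (B := B) (C := C) (lam := lam) (θ := θ)
    hc hC hlam
  set R := remConst a b c B C lam θ
  set L := Real.log n
  have hL0 : 0 < L := by linarith
  have hNH : 0 < n * h := by positivity
  have hψ := hφ.sq
  set p := ⌈L⌉₊
  have hp1 : 1 ≤ p := Nat.one_le_ceil_iff.mpr hL0
  have hpL : L ≤ p := Nat.le_ceil _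
  have hpL2 : (p : ℝ) ≤ 2 * L := (Nat.ceil_lt_add_one hL0.le).le.trans (by linarith)
  obtain ⟨hr1, -, -⟩ := gapLength_bounds hb hL
  obtain ⟨g1, g2⟩ := gap_conditions hb hL hn hgap (by norm_num) hgap2 hY hB.le hpL2
  have hdL : L ^ (-(1 / 2) : ℝ) ≤ 1 := Real.rpow_le_one_of_one_le_of_nonpos hL (by norm_num)
  -- Only the order of `W` matters here, so the covariance remainder is bounded crudely: `θ ≤ 1/4`
  -- gives `h^{2-4θ} ≤ h`.
  have hmom := hM.integral_sum_pow_le ha hb hB hc hC hψ hθ0 (by linarith)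
    (fun i => hM.integral_sq_le hB hψ i) hr1 g1 hp1 (W := (B + R) * (n * h))
    (by
      have e1 : h ^ (2 - 4 * θ) ≤ h := by
        calc h ^ (2 - 4 * θ) ≤ h ^ (1 : ℝ) :=
              Real.rpow_le_rpow_of_exponent_ge hh hφ.scale_le_one (by linarith)
          _ = h := Real.rpow_one h
      have e2 : R * h ^ (2 - 4 * θ) ≤ R * h := mul_le_mul_of_nonneg_left e1 hR
      have e3 := mul_le_mul_of_nonneg_left (add_le_add_right e2 (B * h)) hn0.le
      exact e3.trans_eq (by ring))
    (g2.trans (by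
      have e1 : B * L ^ (-(1 / 2) : ℝ) ≤ B + R := by nlinarith
      exact mul_le_mul_of_nonneg_right e1 hNH.le))
    (decouplingError_le_one ha hb hc hlam hL hn hLD (by push_cast; linarith) hnh)
  have hcent : ∀ ω, ∑ i ∈ Finset.Icc (1 : ℤ) n, φ (X i ω) ^ 2 - n * ∫ x, φ x ^ 2 * f x =
      ∑ i ∈ Finset.Icc (1 : ℤ) n, (φ (X i ω) ^ 2 - ∫ ω, φ (X i ω) ^ 2 ∂P) := by
    intro ω
    simp_rw [hM.density.integral_comp_eq hψ.measurable]
    rw [Finset.sum_sub_distrib, Finset.sum_const, Int.card_Icc]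
    simp
  simp_rw [hcent]
  set y := delta n / (4 * κ ^ 2) * (n * h) / 2
  have hδ : 0 < delta n := Real.rpow_pos_of_pos hL0 _
  have hy : 0 < y := by positivity
  refine (measureReal_abs_ge_le (Finset.measurable_sum _ fun i _ =>
    (hM.measurable_comp hψ i).sub_const _) (c := n) (fun ω => ?_) hy p).trans ?_
  · refine (Finset.abs_sum_le_sum_abs _ _).trans
      ((Finset.sum_le_sum (g := fun _ => (1 : ℝ)) fun i _ => ?_).trans (by simp))
    have e1 := hψ.abs_le (X i ω)
    have e2 : |∫ ω, φ (X i ω) ^ 2 ∂P| ≤ 1 / 2 := abs_integral_le_of_abs_le fun ω => hψ.abs_le _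
    linarith [abs_sub (φ (X i ω) ^ 2) (∫ ω, φ (X i ω) ^ 2 ∂P)]
  have hδ2 : delta n ^ 2 = L⁻¹ := by
    unfold delta
    rw [← Real.rpow_natCast, ← Real.rpow_mul hL0.le, ← Real.rpow_neg_one]
    norm_num
  have hy2 : y ^ 2 = (n * h) ^ 2 / (64 * κ ^ 4 * L) := by
    have : y ^ 2 = delta n ^ 2 * (n * h) ^ 2 / (64 * κ ^ 4) := by simp only [y]; ring
    rw [this, hδ2]; field_simp
  -- The base is about `(log n)^2 / (n h)`, hence below any fixed constant. As `p ≥ log n`, this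
  -- produces `n^{-(2q+4)}`; the three spare powers of `n` absorb the factor `14`.
  have hbase : 200 / 81 * (p * ((B + R) * (n * h))) / Real.exp 1 / y ^ 2 ≤
      Real.exp (-(2 * q + 4)) := by
    rw [hy2]
    have hBR : 0 ≤ B + R := by positivity
    calc _ ≤ 200 / 81 * (2 * L * ((B + R) * (n * h))) / 1 / ((n * h) ^ 2 / (64 * κ ^ 4 * L)) := by
          gcongr
          exact Real.one_le_exp (by norm_num)
      _ = (200 / 81 * 2 * 64) * (κ ^ 4 * (B + R) * L ^ 2) / (n * h) := by field_simp
      _ ≤ 320 * (κ ^ 4 * (B + R) * L ^ 2) / Real.exp (Real.sqrt L) := by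
          gcongr; norm_num
      _ ≤ _ := by
          rw [div_le_iff₀ (Real.exp_pos _)]
          rw [show (2 : ℝ) = ((2 : ℕ) : ℝ) by norm_num, Real.rpow_natCast] at hbad
          calc _ = 320 * κ ^ 4 * (B + R) * L ^ 2 := by ring
            _ ≤ _ := by exact_mod_cast hbad
  calc _ ≤ 14 * (200 / 81 * (p * ((B + R) * (n * h))) / Real.exp 1) ^ p / y ^ (2 * p) := by
        gcongr
    _ = 14 * (200 / 81 * (p * ((B + R) * (n * h))) / Real.exp 1 / y ^ 2) ^ p := by
        rw [pow_mul, div_pow _ (y ^ 2)]; ring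
    _ ≤ 14 * Real.exp (-(2 * q + 4)) ^ p := by
        have hBR : 0 ≤ B + R := by positivity
        gcongr
    _ = 14 * Real.exp (-(2 * q + 4) * p) := by rw [← Real.exp_nat_mul]; congr 2; ring
    _ ≤ 14 * Real.exp (-(2 * q + 4) * L) := by
        gcongr 14 * Real.exp ?_
        nlinarith
    _ = 14 * Real.exp (-3 * L) * (n : ℝ) ^ (-(2 * q + 1)) := by
        rw [Real.rpow_def_of_pos hn0, mul_assoc, ← Real.exp_add]
        congr 2
        simp only [L]; ring
    _ ≤ 1 * (n : ℝ) ^ (-(2 * q + 1)) := by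
        gcongr
        have e1 : Real.exp (-3 * L) ≤ Real.exp (-3) := Real.exp_le_exp.mpr (by linarith)
        have e2 : Real.exp (-3) * Real.exp 1 ^ 3 = 1 := by
          rw [← Real.exp_nat_mul, ← Real.exp_add]; norm_num
        have e3 : (14 : ℝ) ≤ Real.exp 1 ^ 3 := by
          have := Real.exp_one_gt_d9
          calc (14 : ℝ) ≤ 2.7 ^ 3 := by norm_num
            _ ≤ _ := pow_le_pow_left₀ (by norm_num) (by linarith) 3
        nlinarith [Real.exp_pos (-3)]
    _ = _ := one_mul _

end

/-! ### Excess and majorant at a single bandwidth -/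

section

variable {Ω : Type*} [MeasurableSpace Ω] {P : Measure Ω} [IsProbabilityMeasure P]
  {X : ℤ → Ω → ℝ} {f φ : ℝ → ℝ} {V : Set ℝ} {a b c B C x₀ h lam θ : ℝ}

/-- The constant in front of the part of the variance that the majorant does not dominate. -/
noncomputable def excessConst (q κ R : ℝ) : ℝ := R ^ (1 + 2 / q) * (8 * κ ^ 2) ^ (2 / q)

/-- For `q > 2` the upper edge of the grid exceeds `δ_n`, so the remainder cannot simply be put
below the correction of the majorant. The splitting is done with `τ = 2/q`; the value of `θ` is such
that `(1 - 4θ)(1 + τ) = 1 + 1/q`, and `δ_n^{-τ} = L^{1/q}`. -/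
theorem remainder_le {q κ R L : ℝ} (hq : 0 < q) (hκ : 1 ≤ κ) (hR : 0 ≤ R) (hL : 1 ≤ L)
    (hh : 0 < h) :
    R * h ^ (1 - 4 * ((2 / q) / (8 * (1 + 2 / q)))) ≤ L ^ (-(1 / 2) : ℝ) / (4 * κ ^ 2) / 2 +
      excessConst q κ R * h * (h * L) ^ (1 / q) := by
  have hL0 : 0 < L := by linarith
  have hτ : 0 < 2 / q := by positivity
  have h1 := le_add_rpow_mul_rpow_neg (x := R * h ^ (1 - 4 * ((2 / q) / (8 * (1 + 2 / q)))))
    (y := L ^ (-(1 / 2) : ℝ) / (4 * κ ^ 2) / 2) (τ := 2 / q) (by positivity) (by positivity) hτ.le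
  refine h1.trans_eq ?_
  congr 1
  have e1 : (h ^ (1 - 4 * ((2 / q) / (8 * (1 + 2 / q))))) ^ (1 + 2 / q) = h * h ^ (1 / q) := by
    rw [← Real.rpow_mul hh.le]
    nth_rewrite 2 [← Real.rpow_one h]
    rw [← Real.rpow_add hh]
    congr 1
    field_simp
    ring
  have e2 : (L ^ (-(1 / 2) : ℝ) / (4 * κ ^ 2) / 2) ^ (-(2 / q)) =
      L ^ (1 / q) * (8 * κ ^ 2) ^ (2 / q) := by
    rw [div_div, show 4 * κ ^ 2 * 2 = 8 * κ ^ 2 by ring,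
      Real.div_rpow (by positivity) (by positivity), ← Real.rpow_mul hL0.le,
      Real.rpow_neg (by positivity : 0 ≤ 8 * κ ^ 2), div_inv_eq_mul]
    congr 2
    field_simp
  unfold excessConst
  rw [Real.mul_rpow hR (by positivity), e1, e2, Real.mul_rpow hh.le hL0.le]
  ring

set_option maxHeartbeats 1000000 in
/-- Excess of the normalised stochastic term over the normalised majorant. -/
theorem IsModel.integral_excess_le (hM : IsModel P X f V a b c B C) (ha : 0 < a) (hb : 0 < b)
    (hB : 0 < B) (hc : 0 < c) (hC : 0 < C) (hφ : IsWindow φ V x₀ h lam)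
    {n : ℕ} (hL : 1 ≤ Real.log n) (hn : 0 < n) {q κ : ℝ} (hκ : 1 ≤ κ)
    (hq : 0 < q) (hθ : θ = (2 / q) / (8 * (1 + 2 / q)))
    (hY : Real.exp (Real.sqrt (Real.log n)) ≤ n * h) (hnh : (n : ℝ)⁻¹ ≤ h)
    (hlogh : Real.log n ^ (1 / q) ≤ h⁻¹)
    (hp1 : (q / 2 + 1) + 1 ≤ 3 / 4 * (q * |Real.log h|))
    (hlogn : |Real.log h| ≤ Real.log n)
    (hgap : 400 * Real.log n ^ (3 / b) ≤ Real.exp (Real.sqrt (Real.log n)))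
    (hgap2 : 32000000 * q ^ 3 * Real.log n ^ (7 / 2 + 6 / b) ≤
      (1 / (8 * κ ^ 2)) * Real.exp (Real.sqrt (Real.log n)))
    (hLD : (|Real.log (8 * c * (1 + lam) ^ 2)| + 10 * q + 3) / a ≤ Real.log n)
    (hbad : P.real {ω | delta n / (4 * κ ^ 2) * (n * h) / 2 <
      |∑ i ∈ Finset.Icc (1 : ℤ) n, φ (X i ω) ^ 2 - n * ∫ x, φ x ^ 2 * f x|} ≤
      (n : ℝ) ^ (-(2 * q + 1))) :
    ∫ ω, (max (|∑ i ∈ Finset.Icc (1 : ℤ) n, (φ (X i ω) - ∫ ω, φ (X i ω) ∂P)| -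
      Real.sqrt (2 * q * |Real.log h| * (∑ i ∈ Finset.Icc (1 : ℤ) n, φ (X i ω) ^ 2 +
        delta n / (4 * κ ^ 2) * (n * h)))) 0) ^ q ∂P ≤
      2 ^ q * (14 * (2 * q * |Real.log h| *
        ((B + 1 + excessConst q κ (remConst a b c B C lam θ)) * (n * h))) ^ (q / 2) *
          (Real.exp 1 * h ^ (3 / 4 * q)) +
        (2 * q * |Real.log h| * (n * h * (excessConst q κ (remConst a b c B C lam θ) *
          (h * Real.log n) ^ (1 / q)) * h)) ^ (q / 2)) + (n : ℝ) ^ q * (n : ℝ) ^ (-(2 * q + 1)) := by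
  have hn0 : (0 : ℝ) < n := by exact_mod_cast hn
  have hh := hφ.scale_pos
  have hh1 := hφ.scale_le_one
  have hlam := hφ.lam_nonneg
  have hτ : 0 < 2 / q := by positivity
  have hθ0 : 0 < θ := by rw [hθ]; positivity
  have hθ1 : θ ≤ 1 / 4 := by
    rw [hθ, div_le_div_iff₀ (by positivity) (by norm_num)]; linarith
  have hR := remConst_nonneg (a := a) (b := b) (c := c) (B := B) (C := C) (lam := lam) (θ := θ)
    hc hC hlam
  set R := remConst a b c B C lam θ
  have hrem := remainder_le (h := h) hq hκ hR hL hh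
  rw [← hθ] at hrem
  have hE : 0 ≤ excessConst q κ R := by unfold excessConst; positivity
  set E := excessConst q κ R
  set L := Real.log n
  set l := |Real.log h|
  have hL0 : 0 < L := by linarith
  have hNH : 0 < n * h := by positivity
  have hl : 0 < l := by
    have hl0 : 0 ≤ l := abs_nonneg _
    rcases hl0.eq_or_lt with h0 | h0
    · rw [← h0] at hp1; linarith
    · exact h0
  set d := delta n / (4 * κ ^ 2) * (n * h)
  have hδ : 0 < delta n := Real.rpow_pos_of_pos hL0 _
  have hδ1 : delta n ≤ 1 := Real.rpow_le_one_of_one_le_of_nonpos hL (by norm_num)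
  have hd : 0 < d := by positivity
  have hd1 : d ≤ n * h := by
    have : delta n / (4 * κ ^ 2) ≤ 1 := by
      rw [div_le_one (by positivity)]; nlinarith
    exact mul_le_of_le_one_left hNH.le this
  set e := n * h * (E * (h * L) ^ (1 / q)) * h
  have he : 0 ≤ e := by positivity
  set m₂ := ∫ x, φ x ^ 2 * f x
  have hm₂ : ∀ i, ∫ ω, φ (X i ω) ^ 2 ∂P = m₂ := fun i =>
    hM.density.integral_comp_eq (hφ.measurable.pow_const 2) i
  have hm₂B : m₂ ≤ B * h := by rw [← hm₂ 0]; exact hM.integral_sq_le hB hφ 0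
  have hm₂0 : 0 ≤ m₂ := by rw [← hm₂ 0]; exact integral_nonneg fun ω => sq_nonneg _
  have hV0 : 0 ≤ n * m₂ := by positivity
  have he1 : e ≤ E * (n * h) := by
    -- Uses the upper edge `h ≤ L^{-1/q}` of the grid.
    have e1 : (h * L) ^ (1 / q) * h ≤ 1 := by
      rw [Real.mul_rpow hh.le hL0.le]
      have f1 : h ^ (1 / q) ≤ 1 := Real.rpow_le_one hh.le hh1 (by positivity)
      have f2 : L ^ (1 / q) * h ≤ 1 := by
        have := mul_le_mul_of_nonneg_right hlogh hh.le
        rwa [inv_mul_cancel₀ hh.ne'] at this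
      calc h ^ (1 / q) * L ^ (1 / q) * h = h ^ (1 / q) * (L ^ (1 / q) * h) := by ring
        _ ≤ 1 := mul_le_one₀ f1 (by positivity) f2
    calc e = E * (n * h) * ((h * L) ^ (1 / q) * h) := by simp only [e]; ring
      _ ≤ _ := mul_le_of_le_one_right (by positivity) e1
  have hWc : n * m₂ + d / 2 + e ≤ (B + 1 + E) * (n * h) := by
    have := mul_le_mul_of_nonneg_left hm₂B hn0.le
    nlinarith
  have hW0 : 0 < n * m₂ + d / 2 + e := by positivity
  -- As large as the numerical margin allows, so that `e^{-p}` is at most `e · h^{3q/4}`. Hypothesis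
  -- `hp1` leaves room for the rounding and still gives `q ≤ 2p`.
  set p := ⌊3 / 4 * (q * l)⌋₊
  have hple : (p : ℝ) ≤ 3 / 4 * (q * l) := Nat.floor_le (by positivity)
  have hplt : 3 / 4 * (q * l) < p + 1 := Nat.lt_floor_add_one _
  have hp0 : 1 ≤ p := by
    have : (0 : ℝ) < p := by linarith
    exact_mod_cast this
  have hpD : (p : ℝ) ≤ q * L := by
    have := mul_le_mul_of_nonneg_left hlogn hq.le
    have := mul_pos hq hl
    linarith
  obtain ⟨hr1, -, -⟩ := gapLength_bounds hb hL
  obtain ⟨g1, g2⟩ := gap_conditions hb hL hn hgap hq.le hgap2 hY (by positivity) hpD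
  have hmeas : Measurable fun ω => ∑ i ∈ Finset.Icc (1 : ℤ) n, (φ (X i ω) - ∫ ω, φ (X i ω) ∂P) :=
    Finset.measurable_sum _ fun i _ => (hM.measurable_comp hφ i).sub_const _
  have hmeasU : Measurable fun ω => ∑ i ∈ Finset.Icc (1 : ℤ) n, φ (X i ω) ^ 2 :=
    Finset.measurable_sum _ fun i _ => (hM.measurable_comp hφ i).pow_const 2
  have hSc : ∀ ω, |∑ i ∈ Finset.Icc (1 : ℤ) n, (φ (X i ω) - ∫ ω, φ (X i ω) ∂P)| ≤ n := by
    intro ω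
    refine (Finset.abs_sum_le_sum_abs _ _).trans
      ((Finset.sum_le_sum (g := fun _ => (1 : ℝ)) fun i _ => ?_).trans (by simp))
    have e1 := hφ.abs_le (X i ω)
    have e2 : |∫ ω, φ (X i ω) ∂P| ≤ 1 / 2 := abs_integral_le_of_abs_le fun ω => hφ.abs_le _
    linarith [abs_sub (φ (X i ω)) (∫ ω, φ (X i ω) ∂P)]
  -- Here `W` keeps the exact second moment: half of the correction `d` and the extra term `e`
  -- together hold the covariance remainder, and the other half of `d` is left for the fluctuation
  -- of the empirical variance.
  have hmom := hM.integral_sum_pow_le ha hb hB hc hC hφ hθ0 (by linarith)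
    (fun i => (hm₂ i).le) hr1 g1 hp0 (W := n * m₂ + d / 2 + e)
    (by
      have e1 : h ^ (2 - 4 * θ) = h * h ^ (1 - 4 * θ) := by
        nth_rewrite 2 [← Real.rpow_one h]
        rw [← Real.rpow_add hh]; congr 1; ring
      have e2 := mul_le_mul_of_nonneg_left hrem hNH.le
      calc n * (m₂ + R * h ^ (2 - 4 * θ)) = n * m₂ + n * h * (R * h ^ (1 - 4 * θ)) := by
            rw [e1]; ring
        _ ≤ _ := add_le_add_right e2 _
        _ = _ := by simp only [d, e, delta]; ring)
    (g2.trans (by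
      have : 1 / (8 * κ ^ 2) * L ^ (-(1 / 2) : ℝ) * (n * h) = d / 2 := by
        simp only [d, delta, L]; field_simp; ring
      rw [this]; linarith))
    (decouplingError_le_one ha hb hc hlam hL hn hLD (by push_cast; linarith) hnh)
  have h1 := integral_max_sub_rpow_le hmeas hSc hq hl hW0 hple (by linarith) hmom
  have h2 := integral_max_sub_sqrt_rpow_le (P := P) (A := 2 * q * l) (V := n * m₂) (d := d) (e := e)
    hmeas hmeasU hSc (fun ω => Finset.sum_nonneg fun i _ => sq_nonneg _) hq (by positivity) hd.le he
    hbad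
  refine h2.trans ?_
  have h3 : Real.exp (-p) ≤ Real.exp 1 * h ^ (3 / 4 * q) := by
    rw [Real.rpow_def_of_pos hh, ← Real.exp_add]
    refine Real.exp_le_exp.mpr ?_
    have : Real.log h = -l := by
      rw [show l = -Real.log h from abs_of_nonpos (Real.log_nonpos hh.le hh1), neg_neg]
    rw [this]
    linarith
  gcongr
  refine h1.trans ?_
  gcongr

/-- Moments of the normalised majorant. -/
theorem IsModel.integral_majorant_le (hM : IsModel P X f V a b c B C)
    (hB : 0 < B) (hφ : IsWindow φ V x₀ h lam)
    {n : ℕ} (hL : 1 ≤ Real.log n) (hn : 0 < n) {q κ : ℝ} (hκ : 1 ≤ κ) (hq : 0 < q)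
    (hbad : P.real {ω | delta n / (4 * κ ^ 2) * (n * h) / 2 <
      |∑ i ∈ Finset.Icc (1 : ℤ) n, φ (X i ω) ^ 2 - n * ∫ x, φ x ^ 2 * f x|} ≤
      (n : ℝ) ^ (-(2 * q + 1))) :
    ∫ ω, Real.sqrt (2 * q * |Real.log h| * (∑ i ∈ Finset.Icc (1 : ℤ) n, φ (X i ω) ^ 2 +
        delta n / (4 * κ ^ 2) * (n * h))) ^ q ∂P ≤
      (2 * q * |Real.log h| * ((B + 2) * (n * h))) ^ (q / 2) +
        (2 * q * |Real.log h| * (2 * n)) ^ (q / 2) * (n : ℝ) ^ (-(2 * q + 1)) := by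
  have hn0 : (0 : ℝ) < n := by exact_mod_cast hn
  have hh := hφ.scale_pos
  have hh1 := hφ.scale_le_one
  have hL0 : 0 < Real.log n := by linarith
  have hNH : 0 < n * h := by positivity
  set d := delta n / (4 * κ ^ 2) * (n * h)
  have hδ : 0 < delta n := Real.rpow_pos_of_pos hL0 _
  have hδ1 : delta n ≤ 1 := Real.rpow_le_one_of_one_le_of_nonpos hL (by norm_num)
  have hd : 0 < d := by positivity
  have hd1 : d ≤ n * h := by
    have : delta n / (4 * κ ^ 2) ≤ 1 := by
      rw [div_le_one (by positivity)]; nlinarith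
    exact mul_le_of_le_one_left hNH.le this
  have hm₂ : ∫ ω, φ (X 0 ω) ^ 2 ∂P = ∫ x, φ x ^ 2 * f x :=
    hM.density.integral_comp_eq (hφ.measurable.pow_const 2) 0
  have hm₂B : ∫ x, φ x ^ 2 * f x ≤ B * h := by rw [← hm₂]; exact hM.integral_sq_le hB hφ 0
  have hm₂0 : 0 ≤ ∫ x, φ x ^ 2 * f x := by rw [← hm₂]; exact integral_nonneg fun ω => sq_nonneg _
  have hmeasU : Measurable fun ω => ∑ i ∈ Finset.Icc (1 : ℤ) n, φ (X i ω) ^ 2 :=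
    Finset.measurable_sum _ fun i _ => (hM.measurable_comp hφ i).pow_const 2
  refine (integral_sqrt_rpow_le (P := P) (c := n) (A := 2 * q * |Real.log h|) (d := d) hmeasU
    (fun ω => Finset.sum_nonneg fun i _ => sq_nonneg _) (fun ω => ?_)
    (mul_nonneg hn0.le hm₂0) hq (by positivity) hd.le hbad).trans ?_
  · refine (Finset.sum_le_sum (g := fun _ => (1 : ℝ)) fun i _ => ?_).trans (by simp)
    have := hφ.sq.abs_le (X i ω)
    linarith [le_abs_self (φ (X i ω) ^ 2)]
  · have e1 : n * (∫ x, φ x ^ 2 * f x) + 2 * d ≤ (B + 2) * (n * h) := by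
      have := mul_le_mul_of_nonneg_left hm₂B hn0.le
      nlinarith
    have e2 : (n : ℝ) + d ≤ 2 * n := by nlinarith
    gcongr

end

/-! ### Bookkeeping of the powers of `n` and `h` -/

section Algebra

variable {q κ N h l L : ℝ}

theorem scale_rpow (hκ : 1 ≤ κ) (hN : 1 ≤ N) (hh : 0 < h) (q : ℝ) :
    (2 * κ / (N * h)) ^ q = (2 * κ) ^ q * (N ^ (-q) * h ^ (-q)) := by
  rw [Real.div_rpow (by linarith) (by positivity), Real.mul_rpow (by linarith) hh.le,
    Real.rpow_neg (by linarith), Real.rpow_neg hh.le]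
  field_simp

theorem scale_rpow_gaussian_le {w : ℝ} (hq : 0 < q) (hκ : 1 ≤ κ) (hN : 1 ≤ N) (hh : 0 < h)
    (hl : 0 ≤ l) (hw : 0 ≤ w) (hlh : l * h ^ (1 / 4 : ℝ) ≤ 4) :
    (2 * κ / (N * h)) ^ q * ((2 * q * l * (w * (N * h))) ^ (q / 2) * h ^ (3 / 4 * q)) ≤
      (2 * κ) ^ q * (2 * q * w) ^ (q / 2) * 4 ^ (q / 2) * (N ^ (-(q / 2)) * h ^ (q / 8)) := by
  have hN0 : 0 < N := by linarith
  have e1 : (2 * q * l * (w * (N * h))) ^ (q / 2) =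
      (2 * q * w) ^ (q / 2) * (l ^ (q / 2) * (N ^ (q / 2) * h ^ (q / 2))) := by
    rw [← Real.mul_rpow hN0.le hh.le, ← Real.mul_rpow hl (by positivity),
      ← Real.mul_rpow (by positivity) (by positivity)]
    congr 1; ring
  have e2 : N ^ (-q) * N ^ (q / 2) = N ^ (-(q / 2)) := by
    rw [← Real.rpow_add hN0]; congr 1; ring
  have e3 : h ^ (-q) * h ^ (q / 2) * h ^ (3 / 4 * q) = h ^ (q / 8) * h ^ (q / 8) := by
    rw [← Real.rpow_add hh, ← Real.rpow_add hh, ← Real.rpow_add hh]; congr 1; ring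
  have e4 : l ^ (q / 2) * h ^ (q / 8) ≤ 4 ^ (q / 2) := by
    have : h ^ (q / 8) = (h ^ (1 / 4 : ℝ)) ^ (q / 2) := by
      rw [← Real.rpow_mul hh.le]; congr 1; ring
    rw [this, ← Real.mul_rpow hl (by positivity)]
    exact Real.rpow_le_rpow (by positivity) hlh (by positivity)
  rw [scale_rpow hκ hN hh, e1]
  calc _ = (2 * κ) ^ q * (2 * q * w) ^ (q / 2) * (N ^ (-q) * N ^ (q / 2)) *
        (l ^ (q / 2) * (h ^ (-q) * h ^ (q / 2) * h ^ (3 / 4 * q))) := by ring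
    _ = (2 * κ) ^ q * (2 * q * w) ^ (q / 2) * N ^ (-(q / 2)) * h ^ (q / 8) *
        (l ^ (q / 2) * h ^ (q / 8)) := by rw [e2, e3]; ring
    _ ≤ (2 * κ) ^ q * (2 * q * w) ^ (q / 2) * N ^ (-(q / 2)) * h ^ (q / 8) * 4 ^ (q / 2) := by
        gcongr
    _ = _ := by ring

theorem scale_rpow_remainder_le {E : ℝ} (hq : 0 < q) (hκ : 1 ≤ κ) (hN : 1 ≤ N) (hh : 0 < h)
    (hl : 0 ≤ l) (hE : 0 ≤ E) (hL : 0 ≤ L) (hlh : l * h ^ (1 / (2 * q)) ≤ 2 * q) :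
    (2 * κ / (N * h)) ^ q * (2 * q * l * (N * h * (E * (h * L) ^ (1 / q)) * h)) ^ (q / 2) ≤
      (2 * κ) ^ q * (2 * q * E) ^ (q / 2) * (2 * q) ^ (q / 2) *
        (N ^ (-(q / 2)) * (L ^ (1 / 2 : ℝ) * h ^ (1 / 4 : ℝ))) := by
  have hN0 : 0 < N := by linarith
  have e1 : (2 * q * l * (N * h * (E * (h * L) ^ (1 / q)) * h)) ^ (q / 2) =
      (2 * q * E) ^ (q / 2) * (l ^ (q / 2) * (N ^ (q / 2) * (h ^ q *
        (h ^ (1 / 2 : ℝ) * L ^ (1 / 2 : ℝ))))) := by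
    have f1 : h ^ (1 / 2 : ℝ) * L ^ (1 / 2 : ℝ) = ((h * L) ^ (1 / q)) ^ (q / 2) := by
      rw [← Real.mul_rpow hh.le hL, ← Real.rpow_mul (by positivity)]
      congr 1; field_simp
    have f2 : h ^ q = (h * h) ^ (q / 2) := by
      rw [Real.mul_rpow hh.le hh.le, ← Real.rpow_add hh]; congr 1; ring
    rw [f1, f2, ← Real.mul_rpow (by positivity) (by positivity),
      ← Real.mul_rpow (by positivity) (by positivity),
      ← Real.mul_rpow (by positivity) (by positivity),
      ← Real.mul_rpow (by positivity) (by positivity)]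
    congr 1; ring
  have e2 : N ^ (-q) * N ^ (q / 2) = N ^ (-(q / 2)) := by
    rw [← Real.rpow_add hN0]; congr 1; ring
  have e3 : h ^ (-q) * h ^ q = 1 := by
    rw [← Real.rpow_add hh]; simp
  have e5 : h ^ (1 / 2 : ℝ) = h ^ (1 / 4 : ℝ) * h ^ (1 / 4 : ℝ) := by
    rw [← Real.rpow_add hh]; norm_num
  have e4 : l ^ (q / 2) * h ^ (1 / 4 : ℝ) ≤ (2 * q) ^ (q / 2) := by
    have : h ^ (1 / 4 : ℝ) = (h ^ (1 / (2 * q))) ^ (q / 2) := by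
      rw [← Real.rpow_mul hh.le]; congr 1; field_simp; norm_num
    rw [this, ← Real.mul_rpow hl (by positivity)]
    exact Real.rpow_le_rpow (by positivity) hlh (by positivity)
  rw [scale_rpow hκ hN hh, e1]
  calc _ = (2 * κ) ^ q * (2 * q * E) ^ (q / 2) * (N ^ (-q) * N ^ (q / 2)) * (h ^ (-q) * h ^ q) *
        L ^ (1 / 2 : ℝ) * (l ^ (q / 2) * h ^ (1 / 2 : ℝ)) := by ring
    _ = (2 * κ) ^ q * (2 * q * E) ^ (q / 2) * N ^ (-(q / 2)) *
        L ^ (1 / 2 : ℝ) * h ^ (1 / 4 : ℝ) * (l ^ (q / 2) * h ^ (1 / 4 : ℝ)) := by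
        rw [e2, e3, e5]; ring
    _ ≤ (2 * κ) ^ q * (2 * q * E) ^ (q / 2) * N ^ (-(q / 2)) *
        L ^ (1 / 2 : ℝ) * h ^ (1 / 4 : ℝ) * (2 * q) ^ (q / 2) := by gcongr
    _ = _ := by ring

theorem scale_rpow_bad_le (hq : 0 < q) (hκ : 1 ≤ κ) (hN : 1 ≤ N) (hh : 0 < h) (hNh : N⁻¹ ≤ h) :
    (2 * κ / (N * h)) ^ q * (N ^ q * N ^ (-(2 * q + 1))) ≤
      (2 * κ) ^ q * (N ^ (-(q / 2)) * N⁻¹) := by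
  have hN0 : 0 < N := by linarith
  rw [scale_rpow hκ hN hh]
  have e1 : h ^ (-q) ≤ N ^ q := by
    rw [Real.rpow_neg hh.le, ← Real.inv_rpow hh.le]
    exact Real.rpow_le_rpow (by positivity) (inv_le_of_inv_le₀ hN0 hNh) hq.le
  calc _ = (2 * κ) ^ q * (N ^ (-q) * N ^ q * N ^ (-(2 * q + 1))) * h ^ (-q) := by ring
    _ ≤ (2 * κ) ^ q * (N ^ (-q) * N ^ q * N ^ (-(2 * q + 1))) * N ^ q := by gcongr
    _ = (2 * κ) ^ q * N ^ (-(q + 1)) := by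
        rw [mul_assoc, ← Real.rpow_add hN0, ← Real.rpow_add hN0, ← Real.rpow_add hN0]
        congr 2; ring
    _ ≤ (2 * κ) ^ q * N ^ (-(q / 2) + -1) := by
        gcongr
        linarith
    _ = _ := by rw [Real.rpow_add hN0, Real.rpow_neg_one]

theorem scale_rpow_majorant_eq {w : ℝ} (hq : 0 < q) (hκ : 1 ≤ κ) (hN : 1 ≤ N) (hh : 0 < h)
    (hl : 0 ≤ l) (hw : 0 ≤ w) :
    (2 * κ / (N * h)) ^ q * (2 * q * l * (w * (N * h))) ^ (q / 2) =
      (2 * κ) ^ q * (2 * q * w) ^ (q / 2) * (l / (N * h)) ^ (q / 2) := by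
  have hN0 : 0 < N := by linarith
  have e1 : (2 * κ / (N * h)) ^ q = (2 * κ) ^ q * ((N * h) ^ (2 : ℝ))⁻¹ ^ (q / 2) := by
    rw [Real.div_rpow (by positivity) (by positivity), div_eq_mul_inv, Real.inv_rpow (by positivity),
      ← Real.rpow_mul (by positivity)]
    congr 3; ring
  rw [e1, mul_assoc ((2 * κ) ^ q), mul_assoc ((2 * κ) ^ q), ← Real.mul_rpow (by positivity) (by positivity),
    ← Real.mul_rpow (by positivity) (by positivity)]
  congr 2
  rw [Real.rpow_two]
  field_simp

theorem scale_rpow_majorant_bad_le (hq : 0 < q) (hκ : 1 ≤ κ) (hN : 1 ≤ N) (hh : 0 < h)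
    (hl : 0 ≤ l) (hNh : 1 ≤ N * h) :
    (2 * κ / (N * h)) ^ q * ((2 * q * l * (2 * N)) ^ (q / 2) * N ^ (-(2 * q + 1))) ≤
      (2 * κ) ^ q * (4 * q) ^ (q / 2) * (l / (N * h)) ^ (q / 2) := by
  have hN0 : 0 < N := by linarith
  have e0 : (2 * q * l * (2 * N)) ^ (q / 2) ≤ (2 * q * l * (2 * (N * h))) ^ (q / 2) * N ^ (q / 2) := by
    rw [← Real.mul_rpow (by positivity) (by positivity)]
    refine Real.rpow_le_rpow (by positivity) ?_ (by positivity)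
    have : N ≤ N * h * N := le_mul_of_one_le_left hN0.le hNh
    calc 2 * q * l * (2 * N) ≤ 2 * q * l * (2 * (N * h * N)) := by gcongr
      _ = _ := by ring
  have e1 : N ^ (q / 2) * N ^ (-(2 * q + 1)) ≤ 1 := by
    rw [← Real.rpow_add hN0]
    exact Real.rpow_le_one_of_one_le_of_nonpos hN (by linarith)
  have e2 := scale_rpow_majorant_eq (w := 2) hq hκ hN hh hl (by norm_num)
  calc _ ≤ (2 * κ / (N * h)) ^ q * ((2 * q * l * (2 * (N * h))) ^ (q / 2) * N ^ (q / 2) *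
        N ^ (-(2 * q + 1))) := by gcongr
    _ = (2 * κ / (N * h)) ^ q * (2 * q * l * (2 * (N * h))) ^ (q / 2) *
        (N ^ (q / 2) * N ^ (-(2 * q + 1))) := by ring
    _ ≤ (2 * κ / (N * h)) ^ q * (2 * q * l * (2 * (N * h))) ^ (q / 2) :=
        mul_le_of_le_one_right (by positivity) e1
    _ = _ := by rw [e2]; congr 3; ring

end Algebra

open Filter in
/-- All the requirements on the sample size hold once `log n` is large. -/
theorem exists_threshold (a b c lam q κ B R : ℝ) (hB : 0 < B) (hκ : 1 ≤ κ) :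
    ∃ L₀ : ℝ, 1 ≤ L₀ ∧ ∀ L ≥ L₀,
      400 * L ^ (3 / b) ≤ Real.exp (Real.sqrt L) ∧
      32000000 * 2 ^ 3 * L ^ (7 / 2 + 6 / b) ≤ B * Real.exp (Real.sqrt L) ∧
      32000000 * q ^ 3 * L ^ (7 / 2 + 6 / b) ≤ (1 / (8 * κ ^ 2)) * Real.exp (Real.sqrt L) ∧
      (|Real.log (8 * c * (1 + lam) ^ 2)| + 10 * 2 + 3) / a ≤ L ∧
      (|Real.log (8 * c * (1 + lam) ^ 2)| + 10 * q + 3) / a ≤ L ∧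
      320 * κ ^ 4 * (B + R) * L ^ (2 : ℝ) ≤ Real.exp (-(2 * q + 4)) * Real.exp (Real.sqrt L) ∧
      q / 2 + 1 + 1 ≤ 3 / 4 * Real.log L := by
  have h1 := eventually_rpow_le_exp_sqrt 400 (3 / b) one_pos
  have h2 := eventually_rpow_le_exp_sqrt (32000000 * 2 ^ 3) (7 / 2 + 6 / b) hB
  have h3 := eventually_rpow_le_exp_sqrt (32000000 * q ^ 3) (7 / 2 + 6 / b)
    (ε := 1 / (8 * κ ^ 2)) (by positivity)
  have h4 := eventually_rpow_le_exp_sqrt (320 * κ ^ 4 * (B + R)) 2 (Real.exp_pos (-(2 * q + 4)))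
  have h5 := Real.tendsto_log_atTop.eventually_ge_atTop (4 / 3 * (q / 2 + 1 + 1))
  have h6 := eventually_ge_atTop ((|Real.log (8 * c * (1 + lam) ^ 2)| + 10 * 2 + 3) / a)
  have h7 := eventually_ge_atTop ((|Real.log (8 * c * (1 + lam) ^ 2)| + 10 * q + 3) / a)
  obtain ⟨L₁, hL₁⟩ := eventually_atTop.mp
    (h1.and (h2.and (h3.and (h4.and (h5.and (h6.and h7))))))
  refine ⟨max L₁ 1, le_max_right _ _, fun L hL => ?_⟩
  obtain ⟨g1, g2, g3, g4, g5, g6, g7⟩ := hL₁ L ((le_max_left _ _).trans hL)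
  exact ⟨by linarith, g2, g3, g6, g7, g4, by linarith⟩

section

variable {Ω : Type*} [MeasurableSpace Ω] {P : Measure Ω} {X : ℤ → Ω → ℝ} {f K : ℝ → ℝ}
  {q x₀ κ : ℝ} {n : ℕ}

theorem measurable_kernelEst (hX : ∀ i, Measurable (X i)) (hK : Measurable K) {H : Ω → ℝ}
    (hH : Measurable H) : Measurable fun ω => kernelEst K n (fun i => X i ω) x₀ (H ω) := by
  unfold kernelEst scaled
  exact (Finset.measurable_sum _ fun i _ => hH.inv.mul
    (hK.comp (hH.inv.mul ((hX i).const_sub x₀)))).const_mul _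

theorem measurable_majorant (hX : ∀ i, Measurable (X i)) (hK : Measurable K) (h : ℝ) :
    Measurable fun ω => majorant q K n (fun i => X i ω) x₀ h := by
  unfold majorant varEst scaled
  refine Real.continuous_sqrt.measurable.comp (Measurable.const_mul (Measurable.add_const
    (Measurable.const_mul (Finset.measurable_sum _ fun i _ => ?_) _) _) _)
  exact (((hK.comp (((hX i).const_sub x₀).const_mul _)).const_mul _).pow_const 2)

theorem abs_kernelEst_le (hκ : ∀ x, |K x| ≤ κ) (hn : 1 ≤ n) {h : ℝ}
    (hh : h ∈ grid q n) (x : ℤ → ℝ) : |kernelEst K n x x₀ h| ≤ n * κ := by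
  have hn' : (0 : ℝ) < n := by exact_mod_cast hn
  have h0 := grid_pos hn hh
  have h1 : h⁻¹ ≤ n := inv_le_of_inv_le₀ hn' (inv_le_of_mem_grid hn hh)
  unfold kernelEst
  rw [abs_mul, abs_of_pos (by positivity)]
  have h2 : |∑ i ∈ Finset.Icc (1 : ℤ) n, scaled K h (x₀ - x i)| ≤ n * (n * κ) := by
    refine (Finset.abs_sum_le_sum_abs _ _).trans
      ((Finset.sum_le_sum (g := fun _ => (n : ℝ) * κ) fun i _ => ?_).trans (by simp))
    unfold scaled
    rw [abs_mul, abs_of_pos (inv_pos.mpr h0)]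
    exact mul_le_mul h1 (hκ _) (abs_nonneg _) hn'.le
  calc _ ≤ 1 / (n : ℝ) * (n * (n * κ)) := mul_le_mul_of_nonneg_left h2 (by positivity)
    _ = _ := by field_simp

theorem abs_error_rpow_le (hq : 0 < q) (hκ : ∀ x, |K x| ≤ κ) (hn : 1 ≤ n) {h B : ℝ}
    (hh : h ∈ grid q n) (x : ℤ → ℝ) (hf0 : 0 ≤ f x₀) (hfB : f x₀ ≤ B) :
    |kernelEst K n x x₀ h - f x₀| ^ q ≤ (n * κ + B) ^ q := by
  refine Real.rpow_le_rpow (abs_nonneg _) ((abs_sub _ _).trans (add_le_add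
    (abs_kernelEst_le hκ hn hh x) ?_)) hq.le
  rwa [abs_of_nonneg hf0]

theorem integrable_error [IsProbabilityMeasure P] (hX : ∀ i, Measurable (X i)) (hK : Measurable K)
    (hq : 0 < q) (hκ : ∀ x, |K x| ≤ κ) (hn : 1 ≤ n) {H : Ω → ℝ} {B : ℝ}
    (hH : Measurable H) (hHg : ∀ ω, H ω ∈ grid q n) (hf0 : 0 ≤ f x₀) (hfB : f x₀ ≤ B) :
    Integrable (fun ω => |kernelEst K n (fun i => X i ω) x₀ (H ω) - f x₀| ^ q) P := by
  refine integrable_of_abs_le (((measurable_kernelEst hX hK hH).sub_const _).abs.pow_const q)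
    (c := (n * κ + B) ^ q) fun ω => ?_
  rw [abs_of_nonneg (by positivity)]
  exact abs_error_rpow_le hq hκ hn (hHg ω) _ hf0 hfB

end

theorem self_mem_nbhd (q : ℝ) (n : ℕ) (x₀ : ℝ) : x₀ ∈ nbhd q n x₀ := by
  have : 0 ≤ (1 / Real.log n) ^ (1 / q) := by
    have := Real.log_natCast_nonneg n
    positivity
  exact ⟨by linarith, by linarith⟩

/-- The stochastic part of the risk: sum of the excesses over the majorants, and moment of the
majorant at the oracle bandwidth. -/
noncomputable def stochasticBound (q C₂ : ℝ) (N L h : ℝ) : ℝ :=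
  C₂ * (N ^ (-(q / 2)) * h ^ (q / 8)) + C₂ * (N ^ (-(q / 2)) * (L ^ (1 / 2 : ℝ) * h ^ (1 / 4 : ℝ))) +
    C₂ * (N ^ (-(q / 2)) * N⁻¹)

theorem exists_stochastic_bound {q κ lam a b c B C : ℝ} {K : ℝ → ℝ} (hq : 0 < q)
    (hK : IsLipschitzKernel K) (hκ : 1 ≤ κ) (hlam : 0 ≤ lam) (hKκ : ∀ x, |K x| ≤ κ)
    (hKlip : ∀ x y, |K x - K y| ≤ lam * |x - y|) (ha : 0 < a) (hb : 0 < b) (hc : 0 < c)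
    (hB : 0 < B) (hC : 0 < C) :
    ∃ L₀ C₂ : ℝ, 1 ≤ L₀ ∧ 0 ≤ C₂ ∧ ∀ (Ω : Type*) [MeasurableSpace Ω] (P : Measure Ω)
      [IsProbabilityMeasure P] (X : ℤ → Ω → ℝ) (f : ℝ → ℝ) (x₀ : ℝ) (n : ℕ), 2 ≤ n →
      L₀ ≤ Real.log n → IsModel P X f (nbhd q n x₀) a b c B C → ∀ h ∈ grid q n,
        ∫ ω, (max (|kernelEst K n (fun i => X i ω) x₀ h - smoothed K f h x₀| -
          majorant q K n (fun i => X i ω) x₀ h) 0) ^ q ∂P ≤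
            stochasticBound q C₂ n (Real.log n) h ∧
        ∫ ω, majorant q K n (fun i => X i ω) x₀ h ^ q ∂P ≤
          C₂ * (|Real.log h| / (n * h)) ^ (q / 2) := by
  set θ := (2 / q) / (8 * (1 + 2 / q))
  have hτ : 0 < 2 / q := by positivity
  have hθ0 : 0 < θ := by positivity
  have hθ1 : θ ≤ 1 / 4 := by
    simp only [θ]
    rw [div_le_div_iff₀ (by positivity) (by norm_num)]; linarith
  have hR := remConst_nonneg (a := a) (b := b) (c := c) (B := B) (C := C) (lam := lam) (θ := θ)
    hc hC hlam
  set R := remConst a b c B C lam θ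
  set E := excessConst q κ R
  have hE : 0 ≤ E := by simp only [E, excessConst]; positivity
  obtain ⟨L₀, hL₀, hcond⟩ := exists_threshold a b c lam q κ B R hB hκ
  set D₁ := 2 ^ q * (14 * Real.exp 1) * ((2 * κ) ^ q * (2 * q * (B + 1 + E)) ^ (q / 2) * 4 ^ (q / 2))
  set D₂ := 2 ^ q * ((2 * κ) ^ q * (2 * q * E) ^ (q / 2) * (2 * q) ^ (q / 2))
  set D₃ := (2 * κ) ^ q
  set D₄ := (2 * κ) ^ q * (2 * q * (B + 2)) ^ (q / 2)
  set D₅ := (2 * κ) ^ q * (4 * q) ^ (q / 2)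
  have p1 : 0 ≤ D₁ := by positivity
  have p2 : 0 ≤ D₂ := by positivity
  have p3 : 0 ≤ D₃ := by positivity
  have p4 : 0 ≤ D₄ := by positivity
  have p5 : 0 ≤ D₅ := by positivity
  refine ⟨L₀, D₁ + D₂ + D₃ + (D₄ + D₅), hL₀, by positivity, ?_⟩
  intro Ω _ P _ X f x₀ n hn2 hLn hM h hh
  obtain ⟨c1, c2, c3, c4, c5, c6, c7⟩ := hcond _ hLn
  have hn : 1 ≤ n := by omega
  have hN : (1 : ℝ) ≤ n := by exact_mod_cast hn
  have hL : 1 ≤ Real.log n := hL₀.trans hLn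
  have h0 := grid_pos hn hh
  have h1 := grid_le_one hn hh
  have hY := exp_sqrt_le_of_mem_grid hn hh
  have hnh := inv_le_of_mem_grid hn hh
  have hNh : 1 ≤ n * h := (Real.one_le_exp (Real.sqrt_nonneg _)).trans hY
  have hw := isWindow_localKernel (x₀ := x₀) hK hκ hlam hKκ hKlip h0 h1
    (Icc_subset_nbhd_of_mem_grid hn x₀ hh)
  have hlogh := log_rpow_le_inv_of_mem_grid hL hn hh
  have hlogn := abs_log_le_of_mem_grid hn hh
  have hl : 0 ≤ |Real.log h| := abs_nonneg _
  have hll : Real.log (Real.log n) ≤ q * |Real.log h| := by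
    have := Real.log_le_log (by positivity) hlogh
    rw [Real.log_rpow (by linarith), Real.log_inv] at this
    have h2 : -Real.log h ≤ |Real.log h| := neg_le_abs _
    calc Real.log (Real.log n) = q * (1 / q * Real.log (Real.log n)) := by field_simp
      _ ≤ _ := mul_le_mul_of_nonneg_left (this.trans h2) hq.le
  have hbad := hM.measureReal_sum_sq_le ha hb hB hc hC hw hθ0 hθ1 hL hn hκ hq hY hnh c1 c2 c4 c6
  have hexc := hM.integral_excess_le ha hb hB hc hC hw hL hn hκ hq rfl hY hnh hlogh
    (by linarith) hlogn c1 c3 c5 hbad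
  have hmaj := hM.integral_majorant_le hB hw hL hn hκ hq hbad
  have hKm : Measurable K := hK.lipschitz.choose_spec.continuous.measurable
  have hs : 0 ≤ 2 * κ / (n * h) := by positivity
  constructor
  · have e1 : ∀ ω, (max (|kernelEst K n (fun i => X i ω) x₀ h - smoothed K f h x₀| -
        majorant q K n (fun i => X i ω) x₀ h) 0) ^ q = (2 * κ / (n * h)) ^ q *
        (max (|∑ i ∈ Finset.Icc (1 : ℤ) n, (localKernel K κ x₀ h (X i ω) -
          ∫ ω, localKernel K κ x₀ h (X i ω) ∂P)| - Real.sqrt (2 * q * |Real.log h| *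
          (∑ i ∈ Finset.Icc (1 : ℤ) n, localKernel K κ x₀ h (X i ω) ^ 2 +
            delta n / (4 * κ ^ 2) * (n * h)))) 0) ^ q := by
      intro ω
      rw [hM.density.kernelEst_sub_smoothed hKm hκ h0 hn, majorant_eq hκ q hn h0, abs_mul,
        abs_of_nonneg hs, ← mul_sub, ← Real.mul_rpow hs (le_max_right _ _),
        mul_max_of_nonneg _ _ hs, mul_zero]
    simp_rw [e1]
    rw [integral_const_mul]
    have a1 := scale_rpow_gaussian_le (w := B + 1 + E) hq hκ hN h0 hl (by positivity)
      ((abs_log_mul_rpow_le h0 h1 (by norm_num)).trans_eq (by norm_num))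
    have a2 := scale_rpow_remainder_le (L := Real.log n) hq hκ hN h0 hl hE (by linarith)
      ((abs_log_mul_rpow_le h0 h1 (by positivity)).trans_eq (by field_simp))
    have a3 := scale_rpow_bad_le hq hκ hN h0 hnh
    have t1 : 0 ≤ (n : ℝ) ^ (-(q / 2)) * h ^ (q / 8) := by positivity
    have t2 : 0 ≤ (n : ℝ) ^ (-(q / 2)) * (Real.log n ^ (1 / 2 : ℝ) * h ^ (1 / 4 : ℝ)) := by
      positivity
    have t3 : 0 ≤ (n : ℝ) ^ (-(q / 2)) * (n : ℝ)⁻¹ := by positivity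
    have k1 : 0 ≤ (2 : ℝ) ^ q * (14 * Real.exp 1) := by positivity
    have k2 : 0 ≤ (2 : ℝ) ^ q := by positivity
    unfold stochasticBound
    calc _ ≤ _ := mul_le_mul_of_nonneg_left hexc (by positivity)
      _ = 2 ^ q * (14 * Real.exp 1) * ((2 * κ / (n * h)) ^ q *
            ((2 * q * |Real.log h| * ((B + 1 + E) * (n * h))) ^ (q / 2) * h ^ (3 / 4 * q))) +
          2 ^ q * ((2 * κ / (n * h)) ^ q * (2 * q * |Real.log h| * (n * h * (E *
            (h * Real.log n) ^ (1 / q)) * h)) ^ (q / 2)) +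
          (2 * κ / (n * h)) ^ q * ((n : ℝ) ^ q * (n : ℝ) ^ (-(2 * q + 1))) := by ring
      _ ≤ D₁ * ((n : ℝ) ^ (-(q / 2)) * h ^ (q / 8)) +
          D₂ * ((n : ℝ) ^ (-(q / 2)) * (Real.log n ^ (1 / 2 : ℝ) * h ^ (1 / 4 : ℝ))) +
          D₃ * ((n : ℝ) ^ (-(q / 2)) * (n : ℝ)⁻¹) := by
          refine add_le_add (add_le_add ?_ ?_) a3
          · exact (mul_le_mul_of_nonneg_left a1 k1).trans_eq (by simp only [D₁]; ring)
          · exact (mul_le_mul_of_nonneg_left a2 k2).trans_eq (by simp only [D₂]; ring)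
      _ ≤ _ := by gcongr <;> linarith
  · have e1 : ∀ ω, majorant q K n (fun i => X i ω) x₀ h ^ q = (2 * κ / (n * h)) ^ q *
        Real.sqrt (2 * q * |Real.log h| *
          (∑ i ∈ Finset.Icc (1 : ℤ) n, localKernel K κ x₀ h (X i ω) ^ 2 +
            delta n / (4 * κ ^ 2) * (n * h))) ^ q := by
      intro ω
      rw [majorant_eq hκ q hn h0, Real.mul_rpow hs (Real.sqrt_nonneg _)]
    simp_rw [e1]
    rw [integral_const_mul]
    have a4 := scale_rpow_majorant_eq (w := B + 2) hq hκ hN h0 hl (by positivity)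
    have a5 := scale_rpow_majorant_bad_le hq hκ hN h0 hl hNh
    have t4 : 0 ≤ (|Real.log h| / (n * h)) ^ (q / 2) := by positivity
    calc _ ≤ _ := mul_le_mul_of_nonneg_left hmaj (by positivity)
      _ ≤ D₄ * (|Real.log h| / (n * h)) ^ (q / 2) + D₅ * (|Real.log h| / (n * h)) ^ (q / 2) := by
          rw [mul_add, a4]
          exact add_le_add_right a5 _
      _ = (D₄ + D₅) * (|Real.log h| / (n * h)) ^ (q / 2) := by ring
      _ ≤ _ := mul_le_mul_of_nonneg_right (by linarith) t4

/-- The sum of the excesses is dominated by the variance term at any bandwidth of the grid. -/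
theorem sum_stochasticBound_le {q C₂ : ℝ} {n : ℕ} (hq : 0 < q) (hC₂ : 0 ≤ C₂) (hn : 2 ≤ n)
    (hL : 1 ≤ Real.log n) {h : ℝ} (hh : h ∈ grid q n) :
    ∑ h' ∈ grid q n, stochasticBound q C₂ n (Real.log n) h' ≤
      C₂ * ((1 - (2 : ℝ)⁻¹ ^ (q / 8))⁻¹ + (1 - (2 : ℝ)⁻¹ ^ (1 / 4 : ℝ))⁻¹ + 2) /
        Real.log 2 ^ (q / 2) * (|Real.log h| / (n * h)) ^ (q / 2) := by
  have hn1 : 1 ≤ n := by omega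
  have hN : (1 : ℝ) ≤ n := by exact_mod_cast hn1
  have hN0 : (0 : ℝ) < n := by linarith
  have h0 := grid_pos hn1 hh
  set L := Real.log n
  have hL0 : 0 < L := by linarith
  have hlog2 : 0 < Real.log 2 := Real.log_pos (by norm_num)
  have s1 := sum_grid_rpow_le (q := q) (n := n) (s := q / 8) (by positivity)
  have s2 := sum_grid_rpow_le (q := q) (n := n) (s := (1 / 4 : ℝ)) (by norm_num)
  have s3 : ∑ h' ∈ grid q n, (n : ℝ)⁻¹ ≤ 2 := by
    rw [Finset.sum_const, nsmul_eq_mul, ← div_eq_mul_inv, div_le_iff₀ hN0]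
    linarith [card_grid_le (q := q) (n := n)]
  have hLs : 1 ≤ L ^ (1 / 2 : ℝ) := Real.one_le_rpow hL (by norm_num)
  set G₁ := (1 - (2 : ℝ)⁻¹ ^ (q / 8))⁻¹
  set G₂ := (1 - (2 : ℝ)⁻¹ ^ (1 / 4 : ℝ))⁻¹
  have hG1 : 0 ≤ G₁ := (Finset.sum_nonneg fun h' hh' =>
    Real.rpow_nonneg (grid_pos hn1 hh').le _).trans s1
  have key : Real.log 2 ^ (q / 2) * ((n : ℝ) ^ (-(q / 2)) * L ^ (1 / 2 : ℝ)) ≤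
      (|Real.log h| / (n * h)) ^ (q / 2) := by
    have e1 : L ^ (1 / 2 : ℝ) = (L ^ (1 / q)) ^ (q / 2) := by
      rw [← Real.rpow_mul hL0.le]; congr 1; field_simp
    have e2 : (n : ℝ) ^ (-(q / 2)) = ((n : ℝ)⁻¹) ^ (q / 2) := by
      rw [Real.rpow_neg hN0.le, Real.inv_rpow hN0.le]
    rw [e1, e2, ← Real.mul_rpow (by positivity) (by positivity),
      ← Real.mul_rpow hlog2.le (by positivity)]
    refine Real.rpow_le_rpow (by positivity) ?_ (by positivity)
    rw [show |Real.log h| / (n * h) = |Real.log h| * ((n : ℝ)⁻¹ * h⁻¹) by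
      rw [div_eq_mul_inv, mul_inv]]
    have := log_two_le_of_mem_grid hq hn hh
    have := log_rpow_le_inv_of_mem_grid hL hn1 hh
    gcongr
  unfold stochasticBound
  rw [Finset.sum_add_distrib, Finset.sum_add_distrib, ← Finset.mul_sum, ← Finset.mul_sum,
    ← Finset.mul_sum, ← Finset.mul_sum, ← Finset.mul_sum, ← Finset.mul_sum, ← Finset.mul_sum]
  calc _ ≤ C₂ * ((n : ℝ) ^ (-(q / 2)) * G₁) + C₂ * ((n : ℝ) ^ (-(q / 2)) * (L ^ (1 / 2 : ℝ) * G₂)) +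
        C₂ * ((n : ℝ) ^ (-(q / 2)) * 2) := by gcongr
    _ ≤ C₂ * ((n : ℝ) ^ (-(q / 2)) * (G₁ * L ^ (1 / 2 : ℝ))) +
        C₂ * ((n : ℝ) ^ (-(q / 2)) * (L ^ (1 / 2 : ℝ) * G₂)) +
        C₂ * ((n : ℝ) ^ (-(q / 2)) * (2 * L ^ (1 / 2 : ℝ))) := by
        gcongr
        · exact le_mul_of_one_le_right hG1 hLs
        · linarith
    _ = C₂ * (G₁ + G₂ + 2) / Real.log 2 ^ (q / 2) *
        (Real.log 2 ^ (q / 2) * ((n : ℝ) ^ (-(q / 2)) * L ^ (1 / 2 : ℝ))) := by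
        have : Real.log 2 ^ (q / 2) ≠ 0 := (Real.rpow_pos_of_pos hlog2 _).ne'
        field_simp
    _ ≤ _ := by
        have hG2 : 0 ≤ G₂ := (Finset.sum_nonneg fun h' hh' =>
          Real.rpow_nonneg (grid_pos hn1 hh').le _).trans s2
        gcongr

/-- The oracle inequality for the `q`-th moment of the error. -/
theorem exists_oracle_constant {q : ℝ} {K : ℝ → ℝ} (hq : 0 < q) (hK : IsLipschitzKernel K)
    {a b c B C : ℝ} (ha : 0 < a) (hb : 0 < b) (hc : 0 < c) (hB : 0 < B) (hC : 0 < C) :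
    ∃ C₁ : ℝ, 0 < C₁ ∧ ∀ (Ω : Type*) [MeasurableSpace Ω] (P : Measure Ω) [IsProbabilityMeasure P]
      (X : ℤ → Ω → ℝ) (f : ℝ → ℝ) (x₀ : ℝ) (n : ℕ), 2 ≤ n →
      IsModel P X f (nbhd q n x₀) a b c B C → ∀ hsel : Ω → ℝ, Measurable hsel →
      (∀ ω, IsSelected q K n (fun i => X i ω) x₀ (hsel ω)) →
      Integrable (fun ω => |kernelEst K n (fun i => X i ω) x₀ (hsel ω) - f x₀| ^ q) P ∧
      ∀ h ∈ grid q n, ∫ ω, |kernelEst K n (fun i => X i ω) x₀ (hsel ω) - f x₀| ^ q ∂P ≤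
        C₁ * oracleTerm q K f n x₀ h := by
  obtain ⟨κ, lam, hκ, hlam, hKκ, hKlip⟩ := hK.exists_bound
  obtain ⟨L₀, C₂, hL₀, hC₂, hbound⟩ :=
    exists_stochastic_bound hq hK hκ hlam hKκ hKlip ha hb hc hB hC
  have hKm : Measurable K := hK.lipschitz.choose_spec.continuous.measurable
  have hlog2 : 0 < Real.log 2 := Real.log_pos (by norm_num)
  set G := C₂ * ((1 - (2 : ℝ)⁻¹ ^ (q / 8))⁻¹ + (1 - (2 : ℝ)⁻¹ ^ (1 / 4 : ℝ))⁻¹ + 2) /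
        Real.log 2 ^ (q / 2)
  have hgeo : ∀ s : ℝ, 0 < s → 0 ≤ (1 - (2 : ℝ)⁻¹ ^ s)⁻¹ := fun s hs =>
    inv_nonneg.mpr (sub_nonneg.mpr (Real.rpow_le_one (by norm_num) (by norm_num) hs.le))
  have hG : 0 ≤ G := by
    have := hgeo (q / 8) (by positivity)
    have := hgeo (1 / 4) (by norm_num)
    positivity
  set F := (Real.exp L₀ * κ + B) ^ q / (Real.log 2 / Real.exp L₀) ^ (q / 2)
  have hF : 0 < F := by positivity
  refine ⟨20 ^ q * (1 + G + C₂) + F, by positivity, ?_⟩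
  intro Ω _ P _ X f x₀ n hn hM hsel hselm hselS
  have hn1 : 1 ≤ n := by omega
  have hN0 : (0 : ℝ) < n := by exact_mod_cast hn1
  have hX := hM.density.measurable_process
  have hf0 := hM.density.nonneg x₀
  have hfB := hM.le_bound x₀ (self_mem_nbhd q n x₀)
  have hκ0 : 0 ≤ κ := by linarith
  have hint : Integrable (fun ω => |kernelEst K n (fun i => X i ω) x₀ (hsel ω) - f x₀| ^ q) P :=
    integrable_error hX hKm hq hKκ hn1 hselm (fun ω => (hselS ω).1) hf0 hfB
  refine ⟨hint, fun h hh => ?_⟩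
  have h0 := grid_pos hn1 hh
  have hvar : 0 ≤ (|Real.log h| / (n * h)) ^ (q / 2) := by positivity
  have hmb : (0 : ℝ) ≤ maxBias q K f n x₀ h := NNReal.coe_nonneg _
  have hor : 0 ≤ oracleTerm q K f n x₀ h := add_nonneg hmb hvar
  rw [add_mul]
  rcases le_or_gt L₀ (Real.log n) with hL | hL
  · have hL1 := hL₀.trans hL
    have hb2 := hbound Ω P X f x₀ n hn hL hM
    have hexcm : ∀ h' ∈ grid q n, Integrable (fun ω =>
        (max (|kernelEst K n (fun i => X i ω) x₀ h' - smoothed K f h' x₀| -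
          majorant q K n (fun i => X i ω) x₀ h') 0) ^ q) P := fun h' hh' =>
      integrable_max_sub_rpow ((measurable_kernelEst hX hKm measurable_const).sub_const _)
        (measurable_majorant hX hKm h') hq (c := n * κ + |smoothed K f h' x₀|)
        (fun ω => (abs_sub _ _).trans
          (add_le_add_left (abs_kernelEst_le hKκ hn1 hh' _) _))
        fun ω => majorant_nonneg h'
    have hmajm : Integrable (fun ω => majorant q K n (fun i => X i ω) x₀ h ^ q) P := by
      have hbd : ∀ ω, majorant q K n (fun i => X i ω) x₀ h ≤
          2 * κ / (n * h) * Real.sqrt (2 * q * |Real.log h| *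
            (n + delta n / (4 * κ ^ 2) * (n * h))) := by
        intro ω
        rw [majorant_eq hκ q hn1 h0]
        gcongr
        refine (Finset.sum_le_sum (g := fun _ => (1 : ℝ)) fun i _ => ?_).trans (by simp)
        have hw := isWindow_localKernel (x₀ := x₀) hK hκ hlam hKκ hKlip h0 (grid_le_one hn1 hh)
          (Icc_subset_nbhd_of_mem_grid hn1 x₀ hh)
        have := hw.sq.abs_le (X i ω)
        linarith [le_abs_self (localKernel K κ x₀ h (X i ω) ^ 2)]
      refine integrable_of_abs_le ((measurable_majorant hX hKm h).pow_const q)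
        (c := (2 * κ / (n * h) * Real.sqrt (2 * q * |Real.log h| *
            (n + delta n / (4 * κ ^ 2) * (n * h)))) ^ q) fun ω => ?_
      rw [abs_of_nonneg (Real.rpow_nonneg (majorant_nonneg h) q)]
      exact Real.rpow_le_rpow (majorant_nonneg h) (hbd ω) hq.le
    have hsumm := integrable_finsetSum (grid q n) hexcm
    have hadd : Integrable (fun ω => (∑ h' ∈ grid q n,
        (max (|kernelEst K n (fun i => X i ω) x₀ h' - smoothed K f h' x₀| -
          majorant q K n (fun i => X i ω) x₀ h') 0) ^ q) +
        majorant q K n (fun i => X i ω) x₀ h ^ q) P := hsumm.add hmajm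
    have hstep : ∫ ω, |kernelEst K n (fun i => X i ω) x₀ (hsel ω) - f x₀| ^ q ∂P ≤
        20 ^ q * (maxBias q K f n x₀ h + (G * (|Real.log h| / (n * h)) ^ (q / 2) +
          C₂ * (|Real.log h| / (n * h)) ^ (q / 2))) := by
      refine (integral_mono hint (((integrable_const (maxBias q K f n x₀ h : ℝ)).add
        hadd).const_mul (20 ^ q))
        fun ω => (hselS ω).abs_sub_rpow_le hq hh).trans ?_
      rw [integral_const_mul]
      refine mul_le_mul_of_nonneg_left ?_ (by positivity)
      simp only [Pi.add_apply]
      rw [integral_add (integrable_const _) hadd]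
      refine add_le_add (by simp) ?_
      rw [integral_add hsumm hmajm]
      refine add_le_add ?_ (hb2 h hh).2
      rw [integral_finsetSum _ hexcm]
      exact (Finset.sum_le_sum fun h' hh' => (hb2 h' hh').1).trans
        (sum_stochasticBound_le hq hC₂ hn hL1 hh)
    have h4 : (maxBias q K f n x₀ h : ℝ) + (G * (|Real.log h| / (n * h)) ^ (q / 2) +
          C₂ * (|Real.log h| / (n * h)) ^ (q / 2)) ≤
        (1 + G + C₂) * oracleTerm q K f n x₀ h := by
      unfold oracleTerm
      have := mul_nonneg hG hmb
      have := mul_nonneg hC₂ hmb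
      nlinarith
    have h5 := mul_le_mul_of_nonneg_left h4 (by positivity : (0 : ℝ) ≤ 20 ^ q)
    have h6 := mul_nonneg hF.le hor
    linarith
  · have hne : (n : ℝ) ≤ Real.exp L₀ := by
      rw [← Real.exp_log hN0]; exact Real.exp_le_exp.mpr hL.le
    have h1 : ∫ ω, |kernelEst K n (fun i => X i ω) x₀ (hsel ω) - f x₀| ^ q ∂P ≤
        (Real.exp L₀ * κ + B) ^ q := by
      refine (le_abs_self _).trans (abs_integral_le_of_abs_le fun ω => ?_)
      rw [abs_of_nonneg (by positivity)]
      refine (abs_error_rpow_le hq hKκ hn1 (hselS ω).1 _ hf0 hfB).trans ?_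
      gcongr
    have h2 : (Real.log 2 / Real.exp L₀) ^ (q / 2) ≤ oracleTerm q K f n x₀ h := by
      refine le_trans ?_ (le_add_of_nonneg_left hmb)
      refine Real.rpow_le_rpow (by positivity) ?_ (by positivity)
      have e1 := log_two_le_of_mem_grid hq hn hh
      have e2 : n * h ≤ Real.exp L₀ :=
        (mul_le_of_le_one_right hN0.le (grid_le_one hn1 hh)).trans hne
      gcongr
    have h3 : (Real.exp L₀ * κ + B) ^ q ≤ F * oracleTerm q K f n x₀ h := by
      calc _ = F * (Real.log 2 / Real.exp L₀) ^ (q / 2) := by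
            simp only [F]
            rw [div_mul_cancel₀]
            positivity
        _ ≤ _ := mul_le_mul_of_nonneg_left h2 hF.le
    have h4 : 0 ≤ 20 ^ q * (1 + G + C₂) * oracleTerm q K f n x₀ h := by positivity
    linarith

end GLDensity

theorem theorem1 (q : ℝ) (hq : 0 < q) (K : ℝ → ℝ) (hK : GLDensity.IsLipschitzKernel K)
    (a b c B C : ℝ) (ha : 0 < a) (hb : 0 < b) (hc : 0 < c) (hB : 0 < B) (hC : 0 < C) :
    ∃ C₁ : ℝ, 0 < C₁ ∧
      ∀ (Ω : Type*) [MeasurableSpace Ω] (P : Measure Ω) [IsProbabilityMeasure P]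
        (X : ℤ → Ω → ℝ) (f : ℝ → ℝ) (x₀ : ℝ) (n : ℕ) (_ : 2 ≤ n)
        (hgrid : (GLDensity.grid q n).Nonempty),
        GLDensity.HasMarginalDensity P X f →
        (∀ x ∈ GLDensity.nbhd q n x₀, f x ≤ B) →
        (∀ r : ℕ, 1 ≤ r → GLDensity.rho P X (GLDensity.nbhd q n x₀) r ≤
          ENNReal.ofReal (c * Real.exp (-a * (r : ℝ) ^ b))) →
        GLDensity.crossMoment P X (GLDensity.nbhd q n x₀) ≤ ENNReal.ofReal C →
        ∀ hsel : Ω → ℝ, Measurable hsel →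
          (∀ ω, GLDensity.IsSelected q K n (fun i => X i ω) x₀ (hsel ω)) →
          Integrable (fun ω =>
            |GLDensity.kernelEst K n (fun i => X i ω) x₀ (hsel ω) - f x₀| ^ q) P ∧
          GLDensity.risk P q
              (fun ω => GLDensity.kernelEst K n (fun i => X i ω) x₀ (hsel ω)) (f x₀) ^ q ≤
            C₁ * (GLDensity.grid q n).inf' hgrid
              (fun h => GLDensity.oracleTerm q K f n x₀ h) := by
  obtain ⟨C₁, hC₁, hmain⟩ := GLDensity.exists_oracle_constant hq hK ha hb hc hB hC
  refine ⟨C₁, hC₁, ?_⟩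
  intro Ω _ P _ X f x₀ n hn hgrid hdens hbound hrho hcross hsel hselm hselS
  obtain ⟨hint, hle⟩ := hmain Ω P X f x₀ n hn ⟨hdens, hbound, hrho, hcross⟩ hsel hselm hselS
  refine ⟨hint, ?_⟩
  obtain ⟨h, hh, heq⟩ := Finset.exists_mem_eq_inf' hgrid
    fun h => GLDensity.oracleTerm q K f n x₀ h
  rw [heq]
  unfold GLDensity.risk
  rw [← Real.rpow_mul (integral_nonneg fun ω => by positivity), one_div_mul_cancel hq.ne',
    Real.rpow_one]
  exact hle h hh
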